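/- Let $(M,\Omega)$ be a connected symplectic manifold without boundary (closed or open), of dimension $2n$. For a function $\varphi$ on $M$ put $\|\varphi\|=\max_M\varphi-\min_M\varphi$. A smooth time-dependent Hamiltonian $F(x,t)=F_t(x)$ on $M\times[a,b]$, $a<b$, is normalized if, for $M$ closed, every $F_t$ has zero mean with respect to the volume form $\Omega^n/n!$, and, for $M$ open, all the supports $\operatorname{supp}F_t$ lie in one compact subset of $M$; the same terminology is used for smooth families $F(x,t,\epsilon)$. The group $\mathrm{Ham}(M,\Omega)$ consists of the time-one maps of the flows of the fields $\operatorname{sgrad}F_t$, $i_{\operatorname{sgrad}F_t}\Omega=-dF_t$, for normalized Hamiltonians $F$ on $M\times[0,1]$. Let $\{f_t\}_{t\in[a,b]}$ be a smooth path in $\mathrm{Ham}(M,\Omega)$ whose supports lie in one compact set, and let $F$ be its normalized Hamiltonian: $\frac{d}{dt}f_tx=\operatorname{sgrad}F_t(f_tx)$ for all $x\in M$, $t\in[a,b]$. A variation of $\{f_t\}$ is a smooth family $\{f_{t,\epsilon}\}$, $t\in[a,b]$, $\epsilon\in(-\epsilon_0,\epsilon_0)$, of elements of $\mathrm{Ham}(M,\Omega)$,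 supported in one compact set, with $f_{a,\epsilon}=f_a$, $f_{b,\epsilon}=f_b$ and $f_{t,0}=f_t$. Its length function is $\ell(\epsilon)=\int_a^b\|F(\cdot,t,\epsilon)\|\,dt$, where $F(x,t,\epsilon)$ is the smooth family of normalized Hamiltonians generating the paths $t\mapsto f_{t,\epsilon}$. The value $\epsilon=0$ is called a critical point of $\ell$ if there are $\delta>0$, $C>0$ and a convex function $u$ on $(-\delta,\delta)$ such that $|\ell(\epsilon)-u(\epsilon)|\le C\epsilon^2$ for all $\epsilon\in(-\delta,\delta)$ and $u$ attains its minimum at $0$. The path $\{f_t\}$ is a geodesic of the Hofer metric if $\|F_t\|$ does not depend on $t$ and if, for every variation of $\{f_t\}$, $\epsilon=0$ is a critical point of $\ell$. Theorem. The path $\{f_t\}$ is a geodesic if and only if $F$ has fixed extrema, that is, there are points $x_-,x_+\in M$ such that $F(x_-,t)=\min_xF(x,t)$ and $F(x_+,t)=\max_xF(x,t)$ for all $t\in[a,b]$, and $F(x_+,t)-F(x_-,t)$ does not depend on $t$. -/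

import Mathlib

open scoped Manifold ContDiff
open MeasureTheory

namespace Hofer

noncomputable section

/-- The model space `ℝ²ⁿ`. -/
abbrev Model (n : ℕ) : Type := EuclideanSpace ℝ (Fin (2 * n))

/-- The expression of a differential 2-form `Ω` on `M` in the preferred chart `φ` at `c`, i.e. the
pullback of `Ω` by `φ⁻¹` (meaningful on the target of `φ`). -/
def formInChart {n : ℕ} {M : Type*} [TopologicalSpace M] [ChartedSpace (Model n) M]
    (Ω : (x : M) → (TangentSpace (𝓡 (2 * n)) x) [⋀^Fin 2]→L[ℝ] ℝ) (c : M) (y : Model n) :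
    (Model n) [⋀^Fin 2]→L[ℝ] ℝ :=
  (Ω ((extChartAt (𝓡 (2 * n)) c).symm y)).compContinuousLinearMap
    (mfderiv 𝓘(ℝ, Model n) (𝓡 (2 * n)) (extChartAt (𝓡 (2 * n)) c).symm y)

/-- A symplectic form on the `2n`-dimensional manifold `M`: a smooth, closed, nondegenerate
differential 2-form. Smoothness and closedness are expressed in the charts of `M`. -/
structure SymplecticForm (n : ℕ) (M : Type*) [TopologicalSpace M]
    [ChartedSpace (Model n) M] where
  toForm : (x : M) → (TangentSpace (𝓡 (2 * n)) x) [⋀^Fin 2]→L[ℝ] ℝ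
  smooth : ∀ c : M, ContDiffOn ℝ ∞ (formInChart toForm c) (extChartAt (𝓡 (2 * n)) c).target
  closed : ∀ c : M, ∀ y ∈ (extChartAt (𝓡 (2 * n)) c).target,
    extDeriv (formInChart toForm c) y = 0
  nondegenerate : ∀ (x : M) (u : TangentSpace (𝓡 (2 * n)) x),
    (∀ v : TangentSpace (𝓡 (2 * n)) x, toForm x ![u, v] = 0) → u = 0

section

variable {n : ℕ} {M : Type*} [TopologicalSpace M] [ChartedSpace (Model n) M]

/-- `|Ωⁿ / n!|` in the preferred chart at `c`, as a density with respect to Lebesgue measure: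
the absolute value of the Pfaffian of the Gram matrix `(Ω(∂ᵢ, ∂ⱼ))`, i.e. `√|det Ω(∂ᵢ, ∂ⱼ)|`. -/
def volumeDensity (Ω : SymplecticForm n M) (c : M) (y : Model n) : ℝ :=
  √|(Matrix.of fun i j : Fin (2 * n) =>
      formInChart Ω.toForm c y
        ![EuclideanSpace.single i (1 : ℝ), EuclideanSpace.single j (1 : ℝ)]).det|

/-- The canonical volume of `Ω` on the domain of the preferred chart at `c` (zero outside). -/
def chartVolume [MeasurableSpace M] (Ω : SymplecticForm n M) (c : M) : Measure M :=
  (((volume : Measure (Model n)).restrict (extChartAt (𝓡 (2 * n)) c).target).withDensity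
    fun y => ENNReal.ofReal (volumeDensity Ω c y)).map (extChartAt (𝓡 (2 * n)) c).symm

/-- The measure on `M` of the canonical volume form `Ωⁿ / n!`. The measures `chartVolume Ω c` are
its restrictions to the chart domains, so it is their supremum. -/
def canonicalVolume [MeasurableSpace M] (Ω : SymplecticForm n M) : Measure M :=
  ⨆ c : M, chartVolume Ω c

/-- `X = sgrad F`: the vector field with `i_X Ω = -dF`. -/
def IsSgrad (Ω : SymplecticForm n M) (F : M → ℝ) (X : (x : M) → TangentSpace (𝓡 (2 * n)) x) :
    Prop :=
  ∀ (x : M) (v : TangentSpace (𝓡 (2 * n)) x),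
    Ω.toForm x ![X x, v] = -(mfderiv (𝓡 (2 * n)) 𝓘(ℝ, ℝ) F x v : ℝ)

section Families

variable {P : Type*} [NormedAddCommGroup P] [NormedSpace ℝ P]

/-- A smooth family, over the parameters `p ∈ S`, of normalized Hamiltonians on `M`. If `M` is
closed, each `F p` has zero mean for the canonical volume; if `M` is open, the supports of all
`F p` lie in a common compact subset. -/
structure IsNormalizedHamiltonian [MeasurableSpace M] (Ω : SymplecticForm n M) (S : Set P)
    (F : P → M → ℝ) : Prop where
  smooth : ContMDiffOn (𝓘(ℝ, P).prod (𝓡 (2 * n))) 𝓘(ℝ, ℝ) ∞ (fun q : P × M => F q.1 q.2)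
    (S ×ˢ Set.univ)
  mean_zero : CompactSpace M → ∀ p ∈ S, ∫ x, F p x ∂(canonicalVolume Ω) = 0
  compact_support : ¬ CompactSpace M → ∃ K : Set M, IsCompact K ∧ ∀ p ∈ S, tsupport (F p) ⊆ K

/-- A smooth family, over the parameters `p ∈ S`, of diffeomorphisms of `M` whose supports lie in
a common compact subset. For `S` an interval of `ℝ` this is a path of diffeomorphisms. -/
structure IsSmoothFamily (S : Set P)
    (f : P → M ≃ₘ⟮𝓡 (2 * n), 𝓡 (2 * n)⟯ M) : Prop where
  smooth : ContMDiffOn (𝓘(ℝ, P).prod (𝓡 (2 * n))) (𝓡 (2 * n)) ∞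
    (fun q : P × M => f q.1 q.2) (S ×ˢ Set.univ)
  compact_support : ∃ K : Set M, IsCompact K ∧ ∀ p ∈ S, closure {x | f p x ≠ x} ⊆ K

end Families

/-- On the time interval `[a, b]` the path `f` satisfies `d/dt f_t x = sgrad F_t (f_t x)` for all
`x ∈ M`. -/
def Generates (Ω : SymplecticForm n M) (a b : ℝ) (F : ℝ → M → ℝ)
    (f : ℝ → M ≃ₘ⟮𝓡 (2 * n), 𝓡 (2 * n)⟯ M) : Prop :=
  ∃ X : ℝ → (x : M) → TangentSpace (𝓡 (2 * n)) x,
    ∀ t ∈ Set.Icc a b, IsSgrad Ω (F t) (X t) ∧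
      ∀ x : M, HasMFDerivWithinAt 𝓘(ℝ, ℝ) (𝓡 (2 * n)) (fun s => f s x) (Set.Icc a b) t
        ((1 : ℝ →L[ℝ] ℝ).smulRight (X t (f t x)))

/-- The group `Ham(M, Ω)`: the time-one maps of the flows of normalized Hamiltonians. -/
def Ham [MeasurableSpace M] (Ω : SymplecticForm n M) :
    Set (M ≃ₘ⟮𝓡 (2 * n), 𝓡 (2 * n)⟯ M) :=
  {φ | ∃ (F : ℝ → M → ℝ) (f : ℝ → M ≃ₘ⟮𝓡 (2 * n), 𝓡 (2 * n)⟯ M),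
    IsNormalizedHamiltonian Ω (Set.Icc (0 : ℝ) 1) F ∧ IsSmoothFamily (Set.Icc (0 : ℝ) 1) f ∧
    Generates Ω 0 1 F f ∧ f 0 = Diffeomorph.refl (𝓡 (2 * n)) M ∞ ∧ f 1 = φ}

/-- `f_t`, `t ∈ [a, b]`, is a smooth path in `Ham(M, Ω)`. -/
structure IsHamiltonianPath [MeasurableSpace M] (Ω : SymplecticForm n M) (a b : ℝ)
    (f : ℝ → M ≃ₘ⟮𝓡 (2 * n), 𝓡 (2 * n)⟯ M) : Prop where
  smooth : IsSmoothFamily (Set.Icc a b) f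
  mem_Ham : ∀ t ∈ Set.Icc a b, f t ∈ Ham Ω

/-- `F` is the normalized Hamiltonian of the path `f_t`, `t ∈ [a, b]`. -/
structure IsHamiltonianOf [MeasurableSpace M] (Ω : SymplecticForm n M) (a b : ℝ)
    (F : ℝ → M → ℝ) (f : ℝ → M ≃ₘ⟮𝓡 (2 * n), 𝓡 (2 * n)⟯ M) : Prop where
  normalized : IsNormalizedHamiltonian Ω (Set.Icc a b) F
  generates : Generates Ω a b F f

/-- A variation `f_{t,ε} = g (t, ε)`, `t ∈ [a, b]`, `ε ∈ (-ε₀, ε₀)`, of the path `f`: a smooth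
family of paths in `Ham(M, Ω)`, with a common compact support, fixed end points, and
`f_{t,0} = f_t`. -/
structure IsVariation [MeasurableSpace M] (Ω : SymplecticForm n M) (a b : ℝ)
    (f : ℝ → M ≃ₘ⟮𝓡 (2 * n), 𝓡 (2 * n)⟯ M) (ε₀ : ℝ)
    (g : ℝ × ℝ → M ≃ₘ⟮𝓡 (2 * n), 𝓡 (2 * n)⟯ M) : Prop where
  pos : 0 < ε₀
  smooth : IsSmoothFamily (Set.Icc a b ×ˢ Set.Ioo (-ε₀) ε₀) g
  mem_Ham : ∀ t ∈ Set.Icc a b, ∀ ε ∈ Set.Ioo (-ε₀) ε₀, g (t, ε) ∈ Ham Ω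
  left : ∀ ε ∈ Set.Ioo (-ε₀) ε₀, g (a, ε) = f a
  right : ∀ ε ∈ Set.Ioo (-ε₀) ε₀, g (b, ε) = f b
  center : ∀ t ∈ Set.Icc a b, g (t, 0) = f t

/-- `G(x, t, ε)` is the normalized Hamiltonian of the paths `t ↦ g (t, ε)` of a variation. -/
structure IsHamiltonianOfVariation [MeasurableSpace M] (Ω : SymplecticForm n M) (a b ε₀ : ℝ)
    (G : ℝ × ℝ → M → ℝ) (g : ℝ × ℝ → M ≃ₘ⟮𝓡 (2 * n), 𝓡 (2 * n)⟯ M) : Prop where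
  normalized : IsNormalizedHamiltonian Ω (Set.Icc a b ×ˢ Set.Ioo (-ε₀) ε₀) G
  generates : ∀ ε ∈ Set.Ioo (-ε₀) ε₀,
    Generates Ω a b (fun t => G (t, ε)) (fun t => g (t, ε))

end

/-- The norm `max F - min F` on normalized functions. -/
def osc {M : Type*} (F : M → ℝ) : ℝ := (⨆ x, F x) - ⨅ x, F x

/-- The Hofer length `∫ₐᵇ (max F_t - min F_t) dt` of a path with normalized Hamiltonian `F`. -/
def hoferLength {M : Type*} (a b : ℝ) (F : ℝ → M → ℝ) : ℝ := ∫ t in a..b, osc (F t)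

/-- `0` is a critical point of `l`, in the sense of convex approximation to second order: near `0`
the function `l` agrees, up to `C ε²`, with a convex function `u` that attains its minimum at
`0`. -/
def IsCriticalAtZero (l : ℝ → ℝ) : Prop :=
  ∃ (u : ℝ → ℝ) (δ C : ℝ), 0 < δ ∧ 0 < C ∧ ConvexOn ℝ (Set.Ioo (-δ) δ) u ∧
    (∀ ε ∈ Set.Ioo (-δ) δ, |l ε - u ε| ≤ C * ε ^ 2) ∧ ∀ ε ∈ Set.Ioo (-δ) δ, u 0 ≤ u ε

/-- `f_t`, `t ∈ [a, b]`, is a geodesic of the Hofer metric: its speed is constant, and for each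
variation the length function `ε ↦ ℓ(ε)` has a critical point at `0`. -/
structure IsGeodesic {n : ℕ} {M : Type*} [TopologicalSpace M] [ChartedSpace (Model n) M]
    [MeasurableSpace M] (Ω : SymplecticForm n M) (a b : ℝ)
    (f : ℝ → M ≃ₘ⟮𝓡 (2 * n), 𝓡 (2 * n)⟯ M) : Prop where
  constant_speed : ∃ F : ℝ → M → ℝ, IsHamiltonianOf Ω a b F f ∧
    ∃ c : ℝ, ∀ t ∈ Set.Icc a b, osc (F t) = c
  critical : ∀ (ε₀ : ℝ) (g : ℝ × ℝ → M ≃ₘ⟮𝓡 (2 * n), 𝓡 (2 * n)⟯ M) (G : ℝ × ℝ → M → ℝ),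
    IsVariation Ω a b f ε₀ g → IsHamiltonianOfVariation Ω a b ε₀ G g →
      IsCriticalAtZero fun ε => hoferLength a b fun t => G (t, ε)

/-- `F` has fixed extrema on `[a, b]` (is quasi-autonomous): there are time-independent points
`xm`, `xp` at which each `F_t` attains its minimum and maximum, and `F_t(xp) - F_t(xm)` does not
depend on `t`. -/
def HasFixedExtrema {M : Type*} (a b : ℝ) (F : ℝ → M → ℝ) : Prop :=
  ∃ xm xp : M, (∀ t ∈ Set.Icc a b, ∀ x, F t xm ≤ F t x ∧ F t x ≤ F t xp) ∧
    ∃ c : ℝ, ∀ t ∈ Set.Icc a b, F t xp - F t xm = c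

end

end Hofer

/-!
# Geodesics of the Hofer metric

Let `G` be the Hamiltonian of a variation and write `G (t, ε) = G₀ + ε G₁ + O(ε²)`. To first order
the length is the integral of the oscillation of `G₀ + ε G₁`, a convex function of `ε`, so the
question is which first variations `G₁` occur and how they act on the oscillation.

*Fixed extrema imply criticality* (`isGeodesic_of_hasFixedExtrema`). The first variation, integrated
over time along a trajectory `t ↦ f_t y`, does not depend on `y`
(`IsVariation.integral_derivSnd_eq`). Indeed, for `Γ(t, ε, y) = g_{t,ε}(y)` the contraction of `Γ^*
Ω` with `∂ₜ` is minus the differential of the Hamiltonian up to a multiple of `dt` and the first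
variation times `dε`; as `Γ^* Ω` is closed, the `y`-derivative of the integral is a difference of
values of `Γ^* Ω(∂_ε, ·)` at the end points, where `∂_ε Γ = 0`. Fixed extrema `x₊`, `x₋` are
critical points of all `F_t`, hence constant trajectories
(`Generates.apply_eq_of_differential_eq_zero`). Therefore `G₁(x₊) - G₁(x₋)` has integral zero, and
evaluation at `x₊` and `x₋` bounds the integrated oscillation of `G₀ + ε G₁` below by its value at
`ε = 0`.

*Criticality implies fixed extrema* (`hasFixedExtrema_of_isGeodesic`). If the `F_t` have no common
maximum, or no common minimum, then by compactness this is seen at finitely many times. At these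
times there are functions `h_t` with sum zero, each smaller at the maxima of `F_t` than at its
minima. Adding `χ_t' h_t` to `F`, where `χ_t` rises from `0` to `1` near the time `t`, decreases the
length to first order (`exists_length_decrease`). It remains to realize `∑ χ_t' h_t` as a first
variation with fixed end points (`exists_variation`). A partition of unity cuts the `h_t` into
pieces supported in chart domains, each of which generates a flow `ψ` (`exists_hamiltonianFlow`).
The path is composed with `ψ_{ε χ_t}` for all the pieces and then with the inverses of these flows
at common times `ε χ₀`, in reverse order. This restores the end point, and since the `h_t` have sum
zero the inverses do not contribute to the first variation.

Two ingredients are not specific to the Hofer metric. The smooth dependence of a flow on time and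
initial value (`exists_contDiff_flow`) follows from the implicit function theorem in the space of
curves. On a closed manifold the composed Hamiltonians keep mean zero because a Hamiltonian flow
preserves `Ω` (`IsHamiltonianFlow.isSymplectic`) and hence the canonical volume
(`measurePreserving_of_isSymplectic`).
-/

namespace Hofer

noncomputable section

/-! ### Superposition and integration operators on curves -/

/-- The Nemytskii (superposition) operator `u ↦ v ∘ u` on continuous curves `[0,1] → E`. -/
def superposition {E F : Type} [NormedAddCommGroup E] [NormedAddCommGroup F] (v : C(E, F))
    (u : C(unitInterval, E)) : C(unitInterval, F) := v.comp u

/-- Pointwise application of a curve of operators to a curve of vectors. -/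
def curveApply (E F : Type) [NormedAddCommGroup E] [NormedSpace ℝ E] [NormedAddCommGroup F]
    [NormedSpace ℝ F] :
    C(unitInterval, E →L[ℝ] F) →L[ℝ] C(unitInterval, E) →L[ℝ] C(unitInterval, F) :=
  LinearMap.mkContinuous₂
    (LinearMap.mk₂ ℝ (fun (A : C(unitInterval, E →L[ℝ] F)) (h : C(unitInterval, E)) =>
      (⟨fun s => A s (h s), by fun_prop⟩ : C(unitInterval, F)))
      (fun _ _ _ => by ext; simp) (fun _ _ _ => by ext; simp)
      (fun _ _ _ => by ext; simp) (fun _ _ _ => by ext; simp)) 1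
    (fun A h => by
      rw [ContinuousMap.norm_le _ (by positivity)]
      intro s
      simp only [LinearMap.mk₂_apply, ContinuousMap.coe_mk, one_mul]
      exact ((A s).le_opNorm _).trans
        (by gcongr; exacts [A.norm_coe_le_norm s, h.norm_coe_le_norm s]))

/-- The derivative of `u ↦ v ∘ u` at `u` applies `v' ∘ u` pointwise. Uniform continuity of `v'`
makes the remainder small uniformly on `[0, 1]`. -/
theorem superposition_hasFDerivAt {E F : Type} [NormedAddCommGroup E] [NormedSpace ℝ E]
    [NormedAddCommGroup F] [NormedSpace ℝ F] (v : C(E, F)) (v' : C(E, E →L[ℝ] F))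
    (hv : ∀ x, HasFDerivAt v (v' x) x) (hc : UniformContinuous v') (u : C(unitInterval, E)) :
    HasFDerivAt (superposition v) (curveApply E F (superposition v' u)) u := by
  rw [hasFDerivAt_iff_isLittleO_nhds_zero, Asymptotics.isLittleO_iff]
  intro c hcpos
  obtain ⟨δ, hδ, hδ'⟩ := Metric.uniformContinuous_iff.1 hc c hcpos
  filter_upwards [Metric.ball_mem_nhds (0 : C(unitInterval, E)) hδ] with h hh
  rw [mem_ball_zero_iff] at hh
  rw [ContinuousMap.norm_le _ (by positivity)]
  intro s
  have hs : ‖h s‖ < δ := (h.norm_coe_le_norm s).trans_lt hh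
  have key : ‖v (u s + h s) - v (u s) - v' (u s) (u s + h s - u s)‖ ≤ c * ‖u s + h s - u s‖ := by
    refine (convex_ball (u s) δ).norm_image_sub_le_of_norm_hasFDerivWithin_le' (f := v) (f' := v')
      (φ := v' (u s)) (𝕜 := ℝ) (fun x _ => (hv x).hasFDerivWithinAt) ?_ (Metric.mem_ball_self hδ) ?_
    rotate_left
    · simpa using hs
    · intro x hx
      have h1 := hδ' (Metric.mem_ball.1 hx)
      rw [dist_eq_norm] at h1
      exact h1.le
  simp only [add_sub_cancel_left] at key
  exact key.trans (mul_le_mul_of_nonneg_left (h.norm_coe_le_norm s) hcpos.le)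

/-- The derivative of a superposition operator is built from the superposition operator of `v'`, so
its smoothness follows by induction, for all target spaces at once. The compact support provides the
uniform continuity of the derivatives. -/
theorem superposition_contDiff_nat (n : ℕ) : ∀ {E F : Type} [NormedAddCommGroup E]
    [NormedSpace ℝ E] [NormedAddCommGroup F] [NormedSpace ℝ F]
    (v : C(E, F)), ContDiff ℝ ∞ v → HasCompactSupport v → ContDiff ℝ n (superposition v) := by
  induction n with
  | zero =>
    intro E F _ _ _ _ v _ _
    simp only [CharP.cast_eq_zero, contDiff_zero]
    exact ContinuousMap.continuous_postcomp v
  | succ n ih =>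
    intro E F _ _ _ _ v hv hs
    have hdc : ContDiff ℝ ∞ (fderiv ℝ v) := hv.fderiv_right (by simp)
    let v' : C(E, E →L[ℝ] F) := ⟨fderiv ℝ v, hdc.continuous⟩
    have hs' : HasCompactSupport v' := hs.fderiv (𝕜 := ℝ)
    have hd : ∀ u, HasFDerivAt (superposition v) (curveApply E F (superposition v' u)) u :=
      superposition_hasFDerivAt v v'
        (fun x => (hv.differentiable (by simp) x).hasFDerivAt)
        (hs'.uniformContinuous_of_continuous v'.continuous)
    have : ContDiff ℝ (n + 1) (superposition v) := by
      rw [contDiff_succ_iff_fderiv]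
      refine ⟨fun u => (hd u).differentiableAt, by simp, ?_⟩
      rw [show fderiv ℝ (superposition v) = fun u => curveApply E F (superposition v' u) from
        funext fun u => (hd u).fderiv]
      exact ContDiff.comp (g := curveApply E F) (ContinuousLinearMap.contDiff _) (ih v' hdc hs')
    exact_mod_cast this

theorem superposition_contDiff {E F : Type} [NormedAddCommGroup E]
    [NormedSpace ℝ E] [NormedAddCommGroup F] [NormedSpace ℝ F]
    (v : C(E, F)) (hv : ContDiff ℝ ∞ v) (hs : HasCompactSupport v) :
    ContDiff ℝ ∞ (superposition v) :=
  contDiff_infty.2 fun n => superposition_contDiff_nat n v hv hs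

/-- The Volterra operator `(V u)(s) = ∫₀ˢ u`. To be integrated, the curve `u` is extended to `ℝ` by
its end values. -/
def volterra (E : Type) [NormedAddCommGroup E] [NormedSpace ℝ E] :
    C(unitInterval, E) →L[ℝ] C(unitInterval, E) :=
  LinearMap.mkContinuous
    { toFun := fun u =>
        ⟨fun s => ∫ r in (0 : ℝ)..s, Set.IccExtend zero_le_one u r, by
          have : Continuous fun s : ℝ => ∫ r in (0 : ℝ)..s, Set.IccExtend zero_le_one u r :=
            intervalIntegral.continuous_primitive
              (fun a b => (u.continuous.Icc_extend' (h := zero_le_one)).intervalIntegrable a b) 0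
          exact this.comp continuous_subtype_val⟩
      map_add' := fun u w => by
        ext s
        exact intervalIntegral.integral_add
          ((u.continuous.Icc_extend' (h := zero_le_one)).intervalIntegrable _ _)
          ((w.continuous.Icc_extend' (h := zero_le_one)).intervalIntegrable _ _)
      map_smul' := fun c u => by
        ext s
        exact intervalIntegral.integral_smul c _ } 1
    (fun u => by
      rw [ContinuousMap.norm_le _ (by positivity)]
      intro s
      have := intervalIntegral.norm_integral_le_of_norm_le_const (a := (0 : ℝ)) (b := s)
        (f := Set.IccExtend zero_le_one u) (C := ‖u‖) (fun x _ => u.norm_coe_le_norm _)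
      refine this.trans ?_
      rw [mul_comm]
      gcongr
      rw [sub_zero, abs_of_nonneg s.2.1]
      exact s.2.2)

theorem norm_volterra_le {E : Type} [NormedAddCommGroup E] [NormedSpace ℝ E] :
    ‖volterra E‖ ≤ 1 := LinearMap.mkContinuous_norm_le _ zero_le_one _

/-! ### Solution curves and the implicit function theorem -/

section Flow

variable {E : Type} [NormedAddCommGroup E] [NormedSpace ℝ E]

theorem superposition_lipschitz {E F : Type} [NormedAddCommGroup E] [NormedAddCommGroup F]
    (v : C(E, F)) {L : NNReal} (hL : LipschitzWith L v) : LipschitzWith L (superposition v) := by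
  refine LipschitzWith.of_dist_le_mul fun u w => ?_
  rw [ContinuousMap.dist_le (by positivity)]
  intro s
  exact (hL.dist_le_mul _ _).trans (by gcongr; exact ContinuousMap.dist_apply_le_dist s)

/-- The curve `u : [0,1] → E` solves `u(s) = x + τ ∫₀ˢ v(u)`, i.e. `u' = τ v(u)`, `u(0) = x`. -/
def IsPicardCurve (v : C(E, E)) (τ : ℝ) (x : E) (u : C(unitInterval, E)) : Prop :=
  u = ContinuousMap.const _ x + τ • volterra E (superposition v u)

theorem isPicardCurve_iff {v : C(E, E)} {τ : ℝ} {x : E} {u : C(unitInterval, E)} :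
    IsPicardCurve v τ x u ↔ ∀ s : unitInterval, u s =
      x + τ • ∫ r in (0 : ℝ)..s, v (Set.IccExtend zero_le_one u r) := by
  rw [IsPicardCurve, ContinuousMap.ext_iff]
  rfl

/-- For small times the Picard iteration is a contraction. -/
theorem existsUnique_picardCurve [CompleteSpace E] {v : C(E, E)} {L : NNReal}
    (hL : LipschitzWith L v) {τ : ℝ}
    (hτ : |τ| * L < 1) (x : E) : ∃! u, IsPicardCurve v τ x u := by
  let T : C(unitInterval, E) → C(unitInterval, E) := fun u =>
    ContinuousMap.const _ x + τ • volterra E (superposition v u)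
  have hT : ContractingWith (‖τ‖₊ * L) T := by
    refine ⟨by exact_mod_cast hτ, LipschitzWith.of_dist_le_mul fun u w => ?_⟩
    simp only [T, dist_add_left, NNReal.coe_mul, coe_nnnorm, Real.norm_eq_abs]
    rw [dist_eq_norm, ← smul_sub, ← map_sub, norm_smul, Real.norm_eq_abs, mul_assoc]
    gcongr
    refine ((volterra E).le_of_opNorm_le norm_volterra_le _).trans ?_
    rw [one_mul, ← dist_eq_norm]
    exact (superposition_lipschitz v hL).dist_le_mul _ _
  exact ⟨hT.fixedPoint, hT.fixedPoint_isFixedPt.symm,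
    fun u hu => hT.fixedPoint_unique (Eq.symm hu)⟩

/-- The map `(τ, x, u) ↦ u - x - τ V(v ∘ u)`, whose zeros are the solution curves. -/
def picardDefect (v : C(E, E)) (q : (ℝ × E) × C(unitInterval, E)) : C(unitInterval, E) :=
  q.2 - ContinuousLinearMap.const ℝ unitInterval q.1.2 - q.1.1 • volterra E (superposition v q.2)

theorem picardDefect_contDiff (v : C(E, E)) (hv : ContDiff ℝ ∞ v) (hs : HasCompactSupport v) :
    ContDiff ℝ ∞ (picardDefect v) := by
  have h1 := superposition_contDiff v hv hs
  unfold picardDefect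
  refine (contDiff_snd.sub ?_).sub ?_
  · exact ContDiff.comp (g := ContinuousLinearMap.const ℝ unitInterval)
      (ContinuousLinearMap.contDiff _) (contDiff_snd.comp contDiff_fst)
  · refine (contDiff_fst.comp contDiff_fst).smul ?_
    exact ContDiff.comp (g := volterra E) (ContinuousLinearMap.contDiff _) (h1.comp contDiff_snd)

theorem isInvertible_one_sub_smul {X : Type} [NormedAddCommGroup X] [NormedSpace ℝ X]
    [CompleteSpace X] {A : X →L[ℝ] X} {L τ : ℝ} (hA : ‖A‖ ≤ L) (hτ : |τ| * L < 1) :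
    ((1 : X →L[ℝ] X) - τ • A).IsInvertible := by
  have hn : ‖τ • A‖ < 1 := by
    rw [norm_smul, Real.norm_eq_abs]
    exact (mul_le_mul_of_nonneg_left hA (abs_nonneg _)).trans_lt hτ
  exact ⟨ContinuousLinearEquiv.unitsEquiv ℝ _ (Units.oneSub _ hn), by ext; rfl⟩

/-- The solution curve with initial value `x`, as a point of `C([0,1], E)`, depends smoothly on the
time scale and the initial value: it is given by the implicit function theorem. -/
theorem contDiffOn_picardCurve [CompleteSpace E] (v : C(E, E)) (hv : ContDiff ℝ ∞ v)
    (hs : HasCompactSupport v) {L : NNReal} (hL : LipschitzWith L v) (U : ℝ × E → C(unitInterval, E))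
    (hU : ∀ p : ℝ × E, |p.1| * L < 1 → IsPicardCurve v p.1 p.2 (U p)) :
    ContDiffOn ℝ ∞ U {p | |p.1| * L < 1} := by
  intro p hp
  have hsm := picardDefect_contDiff v hv hs
  have hsup := superposition_contDiff v hv hs
  have hdef : ∀ p : ℝ × E, ∀ u, picardDefect v (p, u) = 0 ↔ IsPicardCurve v p.1 p.2 u := by
    intro p u
    rw [picardDefect, IsPicardCurve, sub_sub, sub_eq_zero]
    rfl
  -- the partial derivative in the curve is `1 - τ V D`, where `D` is the derivative of `u ↦ v ∘ u`
  have hpart : (fderiv ℝ (picardDefect v) (p, U p)) ∘L .inr ℝ (ℝ × E) C(unitInterval, E) =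
      1 - p.1 • (volterra E ∘L fderiv ℝ (superposition v) (U p)) := by
    have h1 : HasFDerivAt (fun u => picardDefect v (p, u))
        ((fderiv ℝ (picardDefect v) (p, U p)) ∘L .inr ℝ (ℝ × E) C(unitInterval, E)) (U p) :=
      ((hsm.differentiable (by simp) _).hasFDerivAt).comp (U p) (hasFDerivAt_prodMk_right p (U p))
    refine h1.unique ?_
    unfold picardDefect
    have h2 : HasFDerivAt (fun u => volterra E (superposition v u))
        (volterra E ∘L fderiv ℝ (superposition v) (U p)) (U p) :=
      HasFDerivAt.comp (g := volterra E) _ (ContinuousLinearMap.hasFDerivAt _)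
        (hsup.differentiable (by simp) _).hasFDerivAt
    exact ((hasFDerivAt_id (U p)).sub_const
      (ContinuousLinearMap.const ℝ unitInterval p.2)).sub (h2.const_smul p.1)
  have hinv : ((fderiv ℝ (picardDefect v) (p, U p)) ∘L
      .inr ℝ (ℝ × E) C(unitInterval, E)).IsInvertible := by
    rw [hpart]
    refine isInvertible_one_sub_smul ?_ hp
    refine (ContinuousLinearMap.opNorm_comp_le _ _).trans ?_
    have := norm_fderiv_le_of_lipschitz ℝ (superposition_lipschitz v hL) (x₀ := U p)
    calc ‖volterra E‖ * ‖fderiv ℝ (superposition v) (U p)‖ ≤ 1 * L := by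
          gcongr; exact norm_volterra_le
      _ = L := one_mul _
  have hat : ContDiffAt ℝ ∞ (picardDefect v) (p, U p) := hsm.contDiffAt
  have himp := hat.contDiffAt_implicitFunction (by simp) hinv
  have hev := hat.eventually_apply_implicitFunction (by simp) hinv
  have hopen : IsOpen {p : ℝ × E | |p.1| * L < 1} :=
    isOpen_lt (by fun_prop) continuous_const
  refine (himp.congr_of_eventuallyEq ?_).contDiffWithinAt
  filter_upwards [hev, hopen.mem_nhds hp] with q hq hq'
  rw [(hdef p (U p)).2 (hU p hp), hdef] at hq
  exact (existsUnique_picardCurve hL hq' q.2).unique (hU q hq') hq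

end Flow

/-! ### Smooth flows of compactly supported fields -/

section Flow

variable {E : Type} [NormedAddCommGroup E] [NormedSpace ℝ E]

/-- A restriction of a solution curve to `[0, σ]`, rescaled to `[0, 1]`, is again one. -/
theorem IsPicardCurve.rescale {v : C(E, E)} {τ : ℝ} {x : E} {u : C(unitInterval, E)}
    (hu : IsPicardCurve v τ x u) (σ : unitInterval) :
    IsPicardCurve v (σ * τ) x ⟨fun s => u (σ * s), by fun_prop⟩ := by
  rw [isPicardCurve_iff] at hu ⊢
  intro s
  rw [ContinuousMap.coe_mk, hu (σ * s), mul_comm (σ : ℝ) τ, mul_smul,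
    show ((σ * s : unitInterval) : ℝ) = σ * s from rfl]
  have h := intervalIntegral.smul_integral_comp_mul_left
    (fun r => v (Set.IccExtend zero_le_one u r)) (σ : ℝ) (a := 0) (b := s)
  rw [mul_zero] at h
  rw [← h]
  congr 3
  apply intervalIntegral.integral_congr
  intro r hr
  rw [Set.uIcc_of_le s.2.1] at hr
  have hr' : r ∈ Set.Icc (0 : ℝ) 1 := ⟨hr.1, hr.2.trans s.2.2⟩
  have h2 : (σ : ℝ) * r ∈ Set.Icc (0 : ℝ) 1 := (σ * ⟨r, hr'⟩ : unitInterval).2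
  simp only [Set.IccExtend_of_mem _ _ hr', Set.IccExtend_of_mem _ _ h2]
  rfl

/-- A solution curve run backwards is a solution curve for the opposite time scale. -/
theorem IsPicardCurve.reverse {v : C(E, E)} {τ : ℝ} {x : E} {u : C(unitInterval, E)}
    (hu : IsPicardCurve v τ x u) :
    IsPicardCurve v (-τ) (u 1) ⟨fun s => u (unitInterval.symm s), by fun_prop⟩ := by
  rw [isPicardCurve_iff] at hu ⊢
  intro s
  have hc : Continuous fun r => v (Set.IccExtend zero_le_one u r) :=
    v.continuous.comp u.continuous.Icc_extend'
  rw [ContinuousMap.coe_mk, hu (unitInterval.symm s), hu 1, unitInterval.coe_symm_eq,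
    Set.Icc.coe_one]
  have h := intervalIntegral.integral_comp_sub_left
    (fun r => v (Set.IccExtend zero_le_one u r)) (1 : ℝ) (a := 0) (b := s)
  have h3 : (∫ r in (0 : ℝ)..s, v (Set.IccExtend zero_le_one
      (fun s : unitInterval => u (unitInterval.symm s)) r)) =
      ∫ r in (0 : ℝ)..s, v (Set.IccExtend zero_le_one u (1 - r)) := by
    apply intervalIntegral.integral_congr
    intro r hr
    rw [Set.uIcc_of_le s.2.1] at hr
    have hr' : r ∈ Set.Icc (0 : ℝ) 1 := ⟨hr.1, hr.2.trans s.2.2⟩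
    have h2 : 1 - r ∈ Set.Icc (0 : ℝ) 1 := (unitInterval.symm ⟨r, hr'⟩).2
    simp only [Set.IccExtend_of_mem _ _ hr', Set.IccExtend_of_mem _ _ h2]
    rfl
  rw [h3, h, sub_zero, ← intervalIntegral.integral_add_adjacent_intervals
    (hc.intervalIntegrable 0 (1 - s)) (hc.intervalIntegrable (1 - s) 1)]
  module

theorem isPicardCurve_const {v : C(E, E)} {x : E} (hx : v x = 0) (τ : ℝ) :
    IsPicardCurve v τ x (ContinuousMap.const _ x) := by
  rw [isPicardCurve_iff]
  intro s
  have : ∀ r : ℝ, v (Set.IccExtend zero_le_one (ContinuousMap.const unitInterval x) r) = 0 :=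
    fun r => hx
  simp only [this]
  simp

/-- A smooth compactly supported vector field `v` has a smooth local flow. Time is reparametrized
by `τ ↦ c sin τ` with a small `c`, so that the family is defined and smooth for all `τ`. -/
theorem exists_contDiff_flow [CompleteSpace E] (v : E → E) (hv : ContDiff ℝ ∞ v)
    (hs : HasCompactSupport v) : ∃ c : ℝ, 0 < c ∧ ∃ ψ : ℝ → E → E,
      ContDiff ℝ ∞ (fun p : ℝ × E => ψ p.1 p.2) ∧ (∀ x, ψ 0 x = x) ∧
      (∀ τ x, HasDerivAt (fun τ => ψ τ x) ((c * Real.cos τ) • v (ψ τ x)) τ) ∧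
      (∀ τ x, ψ (-τ) (ψ τ x) = x) ∧ ∀ τ x, v x = 0 → ψ τ x = x := by
  obtain ⟨L, hL⟩ : ∃ L, LipschitzWith L v :=
    ContDiff.lipschitzWith_of_hasCompactSupport hs hv (by simp)
  let w : C(E, E) := ⟨v, hv.continuous⟩
  have hL' : LipschitzWith L w := hL
  have hex : ∀ p : ℝ × E, ∃ u, |p.1| * L < 1 → IsPicardCurve w p.1 p.2 u := by
    intro p
    by_cases hp : |p.1| * L < 1
    · obtain ⟨u, hu, -⟩ := existsUnique_picardCurve hL' hp p.2
      exact ⟨u, fun _ => hu⟩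
    · exact ⟨0, fun h => absurd h hp⟩
  choose U hU using hex
  have huniq : ∀ p : ℝ × E, |p.1| * L < 1 → ∀ u, IsPicardCurve w p.1 p.2 u → u = U p :=
    fun p hp u hu => (existsUnique_picardCurve hL' hp p.2).unique hu (hU p hp)
  have hsm := contDiffOn_picardCurve w hv hs hL' U hU
  let φ : ℝ × E → E := fun p => U p 1
  have hφsm : ContDiffOn ℝ ∞ φ {p | |p.1| * L < 1} :=
    ContDiff.comp_contDiffOn (g := ContinuousMap.evalCLM ℝ (1 : unitInterval))
      (ContinuousLinearMap.contDiff _) hsm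
  -- by uniqueness, `U (τ, x)` is the trajectory of `x` run up to the time `τ`
  have hφU : ∀ (τ : ℝ) x, |τ| * L < 1 → ∀ σ : unitInterval, φ (σ * τ, x) = U (τ, x) σ := by
    intro τ x hτ σ
    have h1 : |(σ : ℝ) * τ| * L < 1 := by
      refine lt_of_le_of_lt ?_ hτ
      rw [abs_mul, abs_of_nonneg σ.2.1]
      gcongr
      exact mul_le_of_le_one_left (abs_nonneg _) σ.2.2
    have := huniq (σ * τ, x) h1 _ ((hU (τ, x) hτ).rescale σ)
    simp only [φ]
    rw [← this]
    simp
  have hint : ∀ (τ : ℝ) x, |τ| * L < 1 → φ (τ, x) = x + ∫ r in (0 : ℝ)..τ, v (φ (r, x)) := by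
    intro τ x hτ
    have h := isPicardCurve_iff.1 (hU (τ, x) hτ) 1
    have h2 := intervalIntegral.smul_integral_comp_mul_right
      (fun r => v (φ (r, x))) τ (a := 0) (b := 1)
    rw [zero_mul, one_mul] at h2
    rw [← h2]
    refine h.trans ?_
    congr 2
    apply intervalIntegral.integral_congr
    intro r hr
    simp only [Set.Icc.coe_one, Set.uIcc_of_le zero_le_one] at hr
    simp only [Set.IccExtend_of_mem _ _ hr]
    rw [← hφU τ x hτ ⟨r, hr⟩]
    rfl
  have hopen : IsOpen {τ : ℝ | |τ| * L < 1} := isOpen_lt (by fun_prop) continuous_const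
  have hcont : ∀ x, ContinuousOn (fun r => v (φ (r, x))) {τ : ℝ | |τ| * L < 1} := fun x =>
    hv.continuous.comp_continuousOn (hφsm.continuousOn.comp (by fun_prop) (fun r hr => hr))
  have hord : Set.OrdConnected {τ : ℝ | |τ| * L < 1} := by
    refine ⟨fun a ha b hb r hr => ?_⟩
    rcases le_max_iff.1 (abs_le_max_abs_abs hr.1 hr.2) with h | h
    · exact (mul_le_mul_of_nonneg_right h L.2).trans_lt ha
    · exact (mul_le_mul_of_nonneg_right h L.2).trans_lt hb
  have hzero : (0 : ℝ) ∈ {τ : ℝ | |τ| * L < 1} := by simp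
  have hderiv : ∀ (τ : ℝ) x, |τ| * L < 1 → HasDerivAt (fun τ => φ (τ, x)) (v (φ (τ, x))) τ := by
    intro τ x hτ
    have h1 : HasDerivAt (fun t => ∫ r in (0 : ℝ)..t, v (φ (r, x))) (v (φ (τ, x))) τ := by
      refine intervalIntegral.integral_hasDerivAt_right ?_ ?_ ?_
      · exact ((hcont x).mono (hord.uIcc_subset hzero hτ)).intervalIntegrable
      · exact (hcont x).stronglyMeasurableAtFilter hopen _ hτ
      · exact (hcont x).continuousAt (hopen.mem_nhds hτ)
    refine (h1.const_add x).congr_of_eventuallyEq ?_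
    filter_upwards [hopen.mem_nhds hτ] with t ht using hint t x ht
  have hinv : ∀ (τ : ℝ) x, |τ| * L < 1 → φ (-τ, φ (τ, x)) = x := by
    intro τ x hτ
    have h := huniq (-τ, φ (τ, x)) (by simpa using hτ) _ (hU (τ, x) hτ).reverse
    have h1 : φ (-τ, φ (τ, x)) = U (τ, x) 0 := by
      change U _ 1 = _
      rw [← h]
      simp
    rw [h1, isPicardCurve_iff.1 (hU (τ, x) hτ) 0]
    simp
  have hfix : ∀ (τ : ℝ) x, |τ| * L < 1 → v x = 0 → φ (τ, x) = x := by
    intro τ x hτ hx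
    have h := huniq (τ, x) hτ _ (isPicardCurve_const (v := w) hx τ)
    simp only [φ]
    rw [← h]
    rfl
  -- as `c < 1 / L`, the time `c sin τ` stays in the domain of the local flow
  set c : ℝ := 1 / (L + 1) with hc
  have hcpos : 0 < c := by positivity
  have hsmall : ∀ τ, |c * Real.sin τ| * L < 1 := by
    intro τ
    rw [abs_mul, abs_of_pos hcpos]
    calc c * |Real.sin τ| * L ≤ c * 1 * L := by gcongr; exact Real.abs_sin_le_one τ
      _ < 1 := by
        rw [hc, mul_one, one_div, inv_mul_lt_iff₀ (by positivity)]
        linarith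
  refine ⟨c, hcpos, fun τ x => φ (c * Real.sin τ, x), ?_, ?_, ?_, ?_, ?_⟩
  · rw [← contDiffOn_univ]
    refine hφsm.comp (t := {p : ℝ × E | |p.1| * L < 1})
      (f := fun p : ℝ × E => (c * Real.sin p.1, p.2)) ?_ (fun p _ => hsmall p.1)
    exact ((contDiff_const.mul (Real.contDiff_sin.comp contDiff_fst)).prodMk
      contDiff_snd).contDiffOn
  · intro x
    have := hint 0 x hzero
    simpa using this
  · intro τ x
    have := (hderiv _ x (hsmall τ)).scomp τ ((Real.hasDerivAt_sin τ).const_mul c)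
    exact this
  · intro τ x
    simpa [Real.sin_neg] using hinv _ x (hsmall τ)
  · intro τ x hx
    exact hfix _ x (hsmall τ) hx

end Flow

/-! ### Two-forms and their pullback by maps to the manifold -/

/-- A continuous alternating 2-form as a bilinear map. -/
def bilinOfForm (E : Type*) [NormedAddCommGroup E] [NormedSpace ℝ E] :
    (E [⋀^Fin 2]→L[ℝ] ℝ) →L[ℝ] E →L[ℝ] E →L[ℝ] ℝ :=
  (ContinuousLinearMap.compL ℝ E (E [⋀^Fin 1]→L[ℝ] ℝ) (E →L[ℝ] ℝ)
    ((ContinuousLinearMap.compL ℝ E (E [⋀^Fin 0]→L[ℝ] ℝ) ℝ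
      (ContinuousAlternatingMap.apply ℝ E ℝ ![])) ∘L
        ContinuousAlternatingMap.curryLeftLI.toContinuousLinearMap)) ∘L
    ContinuousAlternatingMap.curryLeftLI.toContinuousLinearMap

theorem two_le_smooth : (2 : WithTop ℕ∞) ≤ ∞ :=
  WithTop.coe_le_coe.2 (le_top : (2 : ℕ∞) ≤ ⊤)

theorem bilinOfForm_apply {E : Type*} [NormedAddCommGroup E] [NormedSpace ℝ E]
    (η : E [⋀^Fin 2]→L[ℝ] ℝ) (u v : E) : bilinOfForm E η u v = η ![u, v] := rfl

theorem comp_pair {E F : Type*} [NormedAddCommGroup E] [NormedSpace ℝ E] [NormedAddCommGroup F]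
    [NormedSpace ℝ F] (η : F [⋀^Fin 2]→L[ℝ] ℝ) (A : E →L[ℝ] F) (u v : E) :
    η.compContinuousLinearMap A ![u, v] = η ![A u, A v] := by
  rw [ContinuousAlternatingMap.compContinuousLinearMap_apply]
  congr 1
  ext i
  fin_cases i <;> rfl

/-- The exterior derivative of a 2-form on constant vector fields. -/
theorem extDerivWithin_two_apply {E : Type*} [NormedAddCommGroup E] [NormedSpace ℝ E]
    {α : E → E [⋀^Fin 2]→L[ℝ] ℝ} {s : Set E} {x : E} (h : DifferentiableWithinAt ℝ α s x)
    (hs : UniqueDiffWithinAt ℝ s x) (u v w : E) :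
    extDerivWithin α s x ![u, v, w] = fderivWithin ℝ (fun y => α y ![v, w]) s x u -
      fderivWithin ℝ (fun y => α y ![u, w]) s x v +
      fderivWithin ℝ (fun y => α y ![u, v]) s x w := by
  rw [extDerivWithin_apply h hs, Fin.sum_univ_three]
  have e0 : (0 : Fin 3).removeNth ![u, v, w] = ![v, w] := by
    ext i; fin_cases i <;> rfl
  have e1 : (1 : Fin 3).removeNth ![u, v, w] = ![u, w] := by
    ext i; fin_cases i <;> rfl
  have e2 : (2 : Fin 3).removeNth ![u, v, w] = ![u, v] := by
    ext i; fin_cases i <;> rfl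
  rw [e0, e1, e2]
  simp
  ring

section

variable {n : ℕ} {M : Type*} [TopologicalSpace M] [ChartedSpace (Model n) M]

theorem formInChart_apply (Ω : (x : M) → (TangentSpace (𝓡 (2 * n)) x) [⋀^Fin 2]→L[ℝ] ℝ)
    (c : M) (y u v : Model n) : formInChart Ω c y ![u, v] =
      Ω ((extChartAt (𝓡 (2 * n)) c).symm y)
        ![mfderiv 𝓘(ℝ, Model n) (𝓡 (2 * n)) (extChartAt (𝓡 (2 * n)) c).symm y u,
          mfderiv 𝓘(ℝ, Model n) (𝓡 (2 * n)) (extChartAt (𝓡 (2 * n)) c).symm y v] :=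
  comp_pair (E := Model n) (F := Model n) _ _ u v

theorem mem_extChartAt_target_nhds {c : M} {y : Model n}
    (hy : y ∈ (extChartAt (𝓡 (2 * n)) c).target) : (extChartAt (𝓡 (2 * n)) c).target ∈ nhds y :=
  (isOpen_extChartAt_target c).mem_nhds hy

theorem contMDiffAt_extChartAt_symm_target [IsManifold (𝓡 (2 * n)) ∞ M] {c : M} {y : Model n}
    (hy : y ∈ (extChartAt (𝓡 (2 * n)) c).target) :
    ContMDiffAt 𝓘(ℝ, Model n) (𝓡 (2 * n)) ∞ (extChartAt (𝓡 (2 * n)) c).symm y :=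
  (contMDiffOn_extChartAt_symm c).contMDiffAt (mem_extChartAt_target_nhds hy)

/-- The coefficient of `Γ^* Ω` along the constant vector fields `u`, `v`, for a map `Γ` from a
subset `S` of a normed space to `M`. -/
def pull {Q : Type*} [NormedAddCommGroup Q] [NormedSpace ℝ Q] (Ω : SymplecticForm n M)
    (Γ : Q → M) (S : Set Q) (u v : Q) (q : Q) : ℝ :=
  Ω.toForm (Γ q) ![mfderivWithin 𝓘(ℝ, Q) (𝓡 (2 * n)) Γ S q u,
    mfderivWithin 𝓘(ℝ, Q) (𝓡 (2 * n)) Γ S q v]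

section

variable [IsManifold (𝓡 (2 * n)) ∞ M] {Q : Type*} [NormedAddCommGroup Q] [NormedSpace ℝ Q]
  (Ω : SymplecticForm n M) {Γ : Q → M} {S : Set Q}

theorem chart_comp_contDiffWithinAt (hΓ : ContMDiffOn 𝓘(ℝ, Q) (𝓡 (2 * n)) ∞ Γ S) {q : Q}
    (hq : q ∈ S) {c : M} (hc : Γ q ∈ (extChartAt (𝓡 (2 * n)) c).source) :
    ContDiffWithinAt ℝ ∞ (fun q => extChartAt (𝓡 (2 * n)) c (Γ q)) S q := by
  rw [← contMDiffWithinAt_iff_contDiffWithinAt]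
  rw [extChartAt_source] at hc
  exact (contMDiffAt_extChartAt' hc).comp_contMDiffWithinAt q (hΓ q hq)

/-- The differential of `Γ` is the differential of its expression in a chart, transported to
`M`. -/
theorem mfderivWithin_eq_chart (hS : UniqueDiffOn ℝ S)
    (hΓ : ContMDiffOn 𝓘(ℝ, Q) (𝓡 (2 * n)) ∞ Γ S) {q : Q} (hq : q ∈ S) {c : M}
    (hc : Γ q ∈ (extChartAt (𝓡 (2 * n)) c).source) :
    mfderivWithin 𝓘(ℝ, Q) (𝓡 (2 * n)) Γ S q =
      (mfderiv 𝓘(ℝ, Model n) (𝓡 (2 * n)) (extChartAt (𝓡 (2 * n)) c).symm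
        (extChartAt (𝓡 (2 * n)) c (Γ q))).comp
      (fderivWithin ℝ (fun q => extChartAt (𝓡 (2 * n)) c (Γ q)) S q) := by
  have hu : UniqueMDiffWithinAt 𝓘(ℝ, Q) S q :=
    uniqueMDiffWithinAt_iff_uniqueDiffWithinAt.2 (hS q hq)
  have hw := (chart_comp_contDiffWithinAt hΓ hq hc).differentiableWithinAt (by simp)
  have hsymm := (contMDiffAt_extChartAt_symm_target
    ((extChartAt (𝓡 (2 * n)) c).map_source hc)).mdifferentiableAt (by simp)
  have hcomp := HasMFDerivAt.comp_hasMFDerivWithinAt q hsymm.hasMFDerivAt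
    hw.hasFDerivWithinAt.hasMFDerivWithinAt
  refine HasMFDerivWithinAt.mfderivWithin (hcomp.congr_of_eventuallyEq ?_ ?_) hu
  · filter_upwards [(hΓ q hq).continuousWithinAt.preimage_mem_nhdsWithin
      ((isOpen_extChartAt_source c).mem_nhds hc)] with r hr
    exact ((extChartAt (𝓡 (2 * n)) c).left_inv hr).symm
  · exact ((extChartAt (𝓡 (2 * n)) c).left_inv hc).symm

/-- In a chart, `Γ^* Ω` is the pullback of the local expression of `Ω`. -/
theorem pull_eq_chart (hS : UniqueDiffOn ℝ S) (hΓ : ContMDiffOn 𝓘(ℝ, Q) (𝓡 (2 * n)) ∞ Γ S) {q : Q}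
    (hq : q ∈ S) {c : M} (hc : Γ q ∈ (extChartAt (𝓡 (2 * n)) c).source) (u v : Q) :
    pull Ω Γ S u v q = (formInChart Ω.toForm c (extChartAt (𝓡 (2 * n)) c (Γ q)))
      ![fderivWithin ℝ (fun q => extChartAt (𝓡 (2 * n)) c (Γ q)) S q u,
        fderivWithin ℝ (fun q => extChartAt (𝓡 (2 * n)) c (Γ q)) S q v] := by
  rw [formInChart_apply, pull, mfderivWithin_eq_chart hS hΓ hq hc,
    (extChartAt (𝓡 (2 * n)) c).left_inv hc]
  rfl

omit [IsManifold (𝓡 (2 * n)) ∞ M] in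
theorem eventually_mem_source (hΓ : ContMDiffOn 𝓘(ℝ, Q) (𝓡 (2 * n)) ∞ Γ S) {q : Q} (hq : q ∈ S) :
    ∀ᶠ r in nhdsWithin q S, r ∈ S ∧ Γ r ∈ (extChartAt (𝓡 (2 * n)) (Γ q)).source := by
  have hc := mem_extChartAt_source (I := 𝓡 (2 * n)) (Γ q)
  filter_upwards [(hΓ q hq).continuousWithinAt.preimage_mem_nhdsWithin
      ((isOpen_extChartAt_source (Γ q)).mem_nhds hc),
      self_mem_nhdsWithin] with r hr hr' using ⟨hr', hr⟩

theorem pull_contDiffOn (hS : UniqueDiffOn ℝ S) (hΓ : ContMDiffOn 𝓘(ℝ, Q) (𝓡 (2 * n)) ∞ Γ S)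
    (u v : Q) : ContDiffOn ℝ ∞ (pull Ω Γ S u v) S := by
  intro q hq
  have hc := mem_extChartAt_source (I := 𝓡 (2 * n)) (Γ q)
  have hw := chart_comp_contDiffWithinAt hΓ hq hc
  have hη : ContDiffAt ℝ ∞ (formInChart Ω.toForm (Γ q)) (extChartAt (𝓡 (2 * n)) (Γ q) (Γ q)) :=
    (Ω.smooth (Γ q)).contDiffAt (mem_extChartAt_target_nhds ((extChartAt _ _).map_source hc))
  have h1 : ContDiffWithinAt ℝ ∞ (fun q' => bilinOfForm (Model n)
      (formInChart Ω.toForm (Γ q) (extChartAt (𝓡 (2 * n)) (Γ q) (Γ q')))) S q :=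
    ContDiffAt.comp_contDiffWithinAt (g := bilinOfForm (Model n)) q
      (ContinuousLinearMap.contDiff _).contDiffAt
      (ContDiffAt.comp_contDiffWithinAt (g := formInChart Ω.toForm (Γ q)) q hη hw)
  have h2 := hw.fderivWithin_right hS (m := ∞) (by simp) hq
  have h3 := (h1.clm_apply (h2.clm_apply (contDiffWithinAt_const (c := u)))).clm_apply
    (h2.clm_apply (contDiffWithinAt_const (c := v)))
  refine h3.congr_of_eventuallyEq ?_ (pull_eq_chart Ω hS hΓ hq hc u v)
  filter_upwards [eventually_mem_source hΓ hq] with r hr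
  exact pull_eq_chart Ω hS hΓ hr.1 hr.2 u v

/-- The form `Γ^* Ω` is closed: in a chart, the exterior derivative commutes with the pullback. -/
theorem pull_closed (hS : UniqueDiffOn ℝ S) (hΓ : ContMDiffOn 𝓘(ℝ, Q) (𝓡 (2 * n)) ∞ Γ S) {q : Q}
    (hq : q ∈ S) (hcl : q ∈ closure (interior S)) (u v w : Q) :
    fderivWithin ℝ (pull Ω Γ S v w) S q u - fderivWithin ℝ (pull Ω Γ S u w) S q v +
      fderivWithin ℝ (pull Ω Γ S u v) S q w = 0 := by
  have hc := mem_extChartAt_source (I := 𝓡 (2 * n)) (Γ q)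
  have hw := chart_comp_contDiffWithinAt hΓ hq hc
  set φ := fun q' => extChartAt (𝓡 (2 * n)) (Γ q) (Γ q') with hφ
  have htgt : φ q ∈ (extChartAt (𝓡 (2 * n)) (Γ q)).target := (extChartAt _ _).map_source hc
  have hη : DifferentiableAt ℝ (formInChart Ω.toForm (Γ q)) (φ q) :=
    ((Ω.smooth (Γ q)).contDiffAt (mem_extChartAt_target_nhds htgt)).differentiableAt (by simp)
  have hd2 := (hw.fderivWithin_right hS (m := ∞) (by simp) hq).differentiableWithinAt (by simp)
  have hpb := extDerivWithin_pullback (t := Set.univ) hη.differentiableWithinAt hw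
    (by simpa using two_le_smooth) hS hcl hq (Set.mapsTo_univ _ _)
  rw [extDerivWithin_univ, Ω.closed _ _ htgt] at hpb
  have hdiff : DifferentiableWithinAt ℝ (fun x => (formInChart Ω.toForm (Γ q)
      (φ x)).compContinuousLinearMap (fderivWithin ℝ φ S x)) S q := by
    have := hη.comp_differentiableWithinAt q (hw.differentiableWithinAt (by simp))
    exact (HasFDerivWithinAt.continuousAlternatingMapCompContinuousLinearMap
      this.hasFDerivWithinAt hd2.hasFDerivWithinAt).differentiableWithinAt
  have key := congrArg (fun η => η ![u, v, w]) hpb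
  rw [extDerivWithin_two_apply hdiff (hS q hq)] at key
  have e : ∀ a b : Q, fderivWithin ℝ (pull Ω Γ S a b) S q = fderivWithin ℝ
      (fun x => (formInChart Ω.toForm (Γ q) (φ x)).compContinuousLinearMap
        (fderivWithin ℝ φ S x) ![a, b]) S q := by
    intro a b
    refine Filter.EventuallyEq.fderivWithin_eq ?_ ?_
    · filter_upwards [eventually_mem_source hΓ hq] with r hr
      rw [pull_eq_chart Ω hS hΓ hr.1 hr.2, comp_pair]
    · rw [pull_eq_chart Ω hS hΓ hq hc, comp_pair]
  rw [e, e, e, key]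
  rfl

end
end

/-! ### Smooth families of functions on the manifold -/

section

variable {n : ℕ} {M : Type*} [TopologicalSpace M] [ChartedSpace (Model n) M]
  {P : Type*} [NormedAddCommGroup P] [NormedSpace ℝ P]
  {Q : Type*} [NormedAddCommGroup Q] [NormedSpace ℝ Q]

/-- The differential of a function as a linear form on the tangent space. -/
def differential (f : M → ℝ) (x : M) : TangentSpace (𝓡 (2 * n)) x →L[ℝ] ℝ :=
  mfderiv (𝓡 (2 * n)) 𝓘(ℝ, ℝ) f x

/-- The functions `G p` of a smooth family are smooth. -/
theorem family_contMDiff {SP : Set P} {G : P → M → ℝ}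
    (hG : ContMDiffOn (𝓘(ℝ, P).prod (𝓡 (2 * n))) 𝓘(ℝ, ℝ) ∞ (fun q : P × M => G q.1 q.2)
      (SP ×ˢ Set.univ)) {p : P} (hp : p ∈ SP) : ContMDiff (𝓡 (2 * n)) 𝓘(ℝ, ℝ) ∞ (G p) := by
  rw [← contMDiffOn_univ]
  exact hG.comp (t := SP ×ˢ Set.univ) (f := fun x : M => (p, x))
    ((contMDiff_const.prodMk contMDiff_id).contMDiffOn) (fun x _ => ⟨hp, trivial⟩)

/-- Chain rule for a smooth family of functions composed with maps to the parameter space and to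
the manifold. -/
theorem family_comp_hasFDerivWithinAt {SP : Set P} (hSP : UniqueDiffOn ℝ SP) {G : P → M → ℝ}
    (hG : ContMDiffOn (𝓘(ℝ, P).prod (𝓡 (2 * n))) 𝓘(ℝ, ℝ) ∞ (fun q : P × M => G q.1 q.2)
      (SP ×ˢ Set.univ)) {S : Set Q} {q : Q} (hq : q ∈ S) {π : Q → P} {π' : Q →L[ℝ] P}
    (hπS : Set.MapsTo π S SP) (hπ : HasFDerivWithinAt π π' S q) {Γ : Q → M}
    {Γ' : Q →L[ℝ] TangentSpace (𝓡 (2 * n)) (Γ q)}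
    (hΓ : HasMFDerivWithinAt 𝓘(ℝ, Q) (𝓡 (2 * n)) Γ S q Γ') :
    HasFDerivWithinAt (fun q => G (π q) (Γ q))
      ((fderivWithin ℝ (fun p => G p (Γ q)) SP (π q)).comp π' +
        (differential (G (π q)) (Γ q)).comp Γ') S q := by
  have hp : π q ∈ SP := hπS hq
  have hD := ((hG (π q, Γ q) ⟨hp, trivial⟩).mdifferentiableWithinAt
    (by simp)).hasMFDerivWithinAt
  -- the total differential of `G`, split into its restrictions to the two factors
  let D : P × Model n →L[ℝ] ℝ := mfderivWithin (𝓘(ℝ, P).prod (𝓡 (2 * n))) 𝓘(ℝ, ℝ)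
    (fun q : P × M => G q.1 q.2) (SP ×ˢ Set.univ) (π q, Γ q)
  have h1 : HasMFDerivWithinAt 𝓘(ℝ, P) (𝓘(ℝ, P).prod (𝓡 (2 * n)))
      (fun p : P => (p, Γ q)) SP (π q)
      ((ContinuousLinearMap.id ℝ P).prod (0 : P →L[ℝ] Model n)) :=
    (hasMFDerivWithinAt_id (I := 𝓘(ℝ, P)) (M := P) SP (π q)).prodMk
      (hasMFDerivWithinAt_const (Γ q) SP (π q))
  have h2 : HasMFDerivWithinAt (𝓡 (2 * n)) (𝓘(ℝ, P).prod (𝓡 (2 * n)))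
      (fun x : M => (π q, x)) Set.univ (Γ q)
      ((0 : Model n →L[ℝ] P).prod (ContinuousLinearMap.id ℝ (Model n))) :=
    (hasMFDerivWithinAt_const (I' := 𝓘(ℝ, P)) (M' := P) (π q) Set.univ (Γ q)).prodMk
      (hasMFDerivWithinAt_id Set.univ (Γ q))
  have h3 : HasMFDerivWithinAt 𝓘(ℝ, Q) (𝓘(ℝ, P).prod (𝓡 (2 * n)))
      (fun q : Q => (π q, Γ q)) S q (π'.prod Γ') :=
    hπ.hasMFDerivWithinAt.prodMk hΓ
  have s1 : SP ⊆ (fun p : P => (p, Γ q)) ⁻¹' (SP ×ˢ Set.univ) := fun p hp => ⟨hp, trivial⟩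
  have s2 : Set.univ ⊆ (fun x : M => (π q, x)) ⁻¹' (SP ×ˢ Set.univ) := fun x _ => ⟨hp, trivial⟩
  have s3 : S ⊆ (fun q : Q => (π q, Γ q)) ⁻¹' (SP ×ˢ Set.univ) := fun r hr => ⟨hπS hr, trivial⟩
  have e1 : HasFDerivWithinAt (fun p => G p (Γ q))
      (D.comp ((ContinuousLinearMap.id ℝ P).prod (0 : P →L[ℝ] Model n))) SP (π q) := by
    have := (HasMFDerivWithinAt.comp (π q) hD h1 s1).hasFDerivWithinAt
    exact this
  have e2 := HasMFDerivWithinAt.comp (Γ q) hD h2 s2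
  have e3 := (HasMFDerivWithinAt.comp q hD h3 s3).hasFDerivWithinAt
  rw [hasMFDerivWithinAt_univ] at e2
  have f1 : fderivWithin ℝ (fun p => G p (Γ q)) SP (π q) =
    D.comp ((ContinuousLinearMap.id ℝ P).prod (0 : P →L[ℝ] Model n)) := e1.fderivWithin (hSP _ hp)
  have f2 : differential (G (π q)) (Γ q) =
    D.comp ((0 : Model n →L[ℝ] P).prod (ContinuousLinearMap.id ℝ (Model n))) := e2.mfderiv
  refine e3.congr_fderiv (ContinuousLinearMap.ext fun u => ?_)
  rw [f1, f2]
  have g3 : ((π' u, Γ' u) : P × Model n) = (π' u, 0) + (0, Γ' u) :=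
    Prod.ext (add_zero _).symm (zero_add _).symm
  exact (congrArg D g3).trans (map_add D _ _)

/-- If `Γ` moves in the direction `τ` with the velocity `sgrad G_{π(q)}`, the contraction of `Γ^* Ω`
with `τ` is `-d(G_{π(q)} ∘ Γ)`, corrected by the derivative of `G` in the parameter. -/
theorem pull_of_isSgrad {Ω : SymplecticForm n M} {SP : Set P} (hSP : UniqueDiffOn ℝ SP)
    {G : P → M → ℝ} (hG : ContMDiffOn (𝓘(ℝ, P).prod (𝓡 (2 * n))) 𝓘(ℝ, ℝ) ∞
      (fun q : P × M => G q.1 q.2) (SP ×ˢ Set.univ)) {S : Set Q} (hS : UniqueDiffOn ℝ S)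
    {Γ : Q → M} (hΓ : ContMDiffOn 𝓘(ℝ, Q) (𝓡 (2 * n)) ∞ Γ S) (π : Q →L[ℝ] P)
    (hπS : Set.MapsTo π S SP) {q : Q} (hq : q ∈ S) {τ : Q}
    {X : (x : M) → TangentSpace (𝓡 (2 * n)) x} (hX : IsSgrad Ω (G (π q)) X)
    (hτ : mfderivWithin 𝓘(ℝ, Q) (𝓡 (2 * n)) Γ S q τ = X (Γ q)) (u : Q) :
    pull Ω Γ S τ u q = fderivWithin ℝ (fun p => G p (Γ q)) SP (π q) (π u) -
      fderivWithin ℝ (fun q => G (π q) (Γ q)) S q u := by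
  have h := family_comp_hasFDerivWithinAt hSP hG hq hπS π.hasFDerivWithinAt
    ((hΓ q hq).mdifferentiableWithinAt (by simp)).hasMFDerivWithinAt
  rw [h.fderivWithin (hS q hq), pull, hτ, hX]
  exact (sub_add_cancel_left (fderivWithin ℝ (fun p => G p (Γ q)) SP (π q) (π u)) _).symm

end

/-! ### Symplectic gradients in charts -/

section

variable {n : ℕ} {M : Type*} [TopologicalSpace M] [ChartedSpace (Model n) M]

theorem isInvertible_mfderiv_symm [IsManifold (𝓡 (2 * n)) ∞ M] {c : M} {y : Model n}
    (hy : y ∈ (extChartAt (𝓡 (2 * n)) c).target) :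
    (mfderiv 𝓘(ℝ, Model n) (𝓡 (2 * n)) (extChartAt (𝓡 (2 * n)) c).symm y).IsInvertible := by
  have : IsManifold (𝓡 (2 * n)) 1 M := .of_le (n := ∞) (mod_cast le_top)
  have h := isInvertible_mfderivWithin_extChartAt_symm (I := 𝓡 (2 * n)) hy
  rwa [(𝓡 (2 * n)).range_eq_univ, mfderivWithin_univ] at h

/-- The value of `Ω` at `x` as a form on the model space. -/
def formAt (Ω : SymplecticForm n M) (x : M) : (Model n) [⋀^Fin 2]→L[ℝ] ℝ := Ω.toForm x

/-- The differential of the inverse of the chart at `c`, as an endomorphism of the model space. -/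
def chartVec (c : M) (y : Model n) : Model n →L[ℝ] Model n :=
  mfderiv 𝓘(ℝ, Model n) (𝓡 (2 * n)) (extChartAt (𝓡 (2 * n)) c).symm y

theorem isInvertible_chartVec [IsManifold (𝓡 (2 * n)) ∞ M] {c : M} {y : Model n}
    (hy : y ∈ (extChartAt (𝓡 (2 * n)) c).target) : (chartVec c y).IsInvertible :=
  isInvertible_mfderiv_symm hy

theorem bilinOfForm_formInChart (Ω : SymplecticForm n M) (c : M) (y u v : Model n) :
    bilinOfForm (Model n) (formInChart Ω.toForm c y) u v =
      formAt Ω ((extChartAt (𝓡 (2 * n)) c).symm y) ![chartVec c y u, chartVec c y v] :=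
  formInChart_apply Ω.toForm c y u v

/-- A function `f` on `M`, written in the chart at `c`. -/
def inChart (f : M → ℝ) (c : M) (y : Model n) : ℝ := f ((extChartAt (𝓡 (2 * n)) c).symm y)

variable [IsManifold (𝓡 (2 * n)) ∞ M] (Ω : SymplecticForm n M)

/-- The local expression of `Ω`, as a map `u ↦ Ω(u, ·)`, is invertible. -/
theorem isInvertible_bilinOfForm {c : M} {y : Model n}
    (hy : y ∈ (extChartAt (𝓡 (2 * n)) c).target) :
    (bilinOfForm (Model n) (formInChart Ω.toForm c y)).IsInvertible := by
  obtain ⟨D, hD⟩ := isInvertible_chartVec hy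
  set J := bilinOfForm (Model n) (formInChart Ω.toForm c y) with hJ
  have hinj : Function.Injective J.toLinearMap := by
    rw [← LinearMap.ker_eq_bot, LinearMap.ker_eq_bot']
    intro u hu
    have h1 : D u = 0 := by
      refine Ω.nondegenerate ((extChartAt (𝓡 (2 * n)) c).symm y) (D u)
        fun (v : Model n) => ?_
      have h2 : J u (D.symm v) = 0 := by
        have : J u = 0 := hu
        rw [this]; rfl
      rw [hJ, bilinOfForm_formInChart, ← hD] at h2
      have h4 : (D : Model n →L[ℝ] Model n) (D.symm v) = v := D.apply_symm_apply v
      rw [h4] at h2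
      exact h2
    exact D.injective (h1.trans (map_zero D).symm)
  have hdim : Module.finrank ℝ (Model n) = Module.finrank ℝ (Model n →L[ℝ] ℝ) := by
    rw [← LinearEquiv.finrank_eq (LinearMap.toContinuousLinearMap (𝕜 := ℝ) (E := Model n) (F' := ℝ))]
    exact (Subspace.dual_finrank_eq (K := ℝ) (V := Model n)).symm
  refine ⟨(LinearMap.linearEquivOfInjective J.toLinearMap hinj hdim).toContinuousLinearEquiv, ?_⟩
  ext u
  rfl

theorem contDiffOn_inChart {f : M → ℝ} (hf : ContMDiff (𝓡 (2 * n)) 𝓘(ℝ, ℝ) ∞ f) (c : M) :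
    ContDiffOn ℝ ∞ (inChart f c) (extChartAt (𝓡 (2 * n)) c).target := by
  rw [← contMDiffOn_iff_contDiffOn]
  exact hf.comp_contMDiffOn (contMDiffOn_extChartAt_symm c)

theorem fderiv_inChart {f : M → ℝ} (hf : ContMDiff (𝓡 (2 * n)) 𝓘(ℝ, ℝ) ∞ f) {c : M} {y : Model n}
    (hy : y ∈ (extChartAt (𝓡 (2 * n)) c).target) (w : Model n) :
    fderiv ℝ (inChart f c) y w = differential f ((extChartAt (𝓡 (2 * n)) c).symm y)
      (chartVec c y w) := by
  have h1 := (contMDiffAt_extChartAt_symm_target hy).mdifferentiableAt (by simp)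
  have h2 := (hf.mdifferentiable (by simp) ((extChartAt (𝓡 (2 * n)) c).symm y))
  have h3 := HasMFDerivAt.comp y h2.hasMFDerivAt h1.hasMFDerivAt
  have h4 : HasFDerivAt (inChart f c)
      ((differential f ((extChartAt (𝓡 (2 * n)) c).symm y) : Model n →L[ℝ] ℝ).comp
        (chartVec c y)) y := by
    have := h3.hasFDerivAt
    exact this
  rw [h4.fderiv]
  rfl

/-- The local expression of `sgrad f` in the chart at `c`. -/
def localSgrad (f : M → ℝ) (c : M) (y : Model n) : Model n :=
  (bilinOfForm (Model n) (formInChart Ω.toForm c y)).inverse (-fderiv ℝ (inChart f c) y)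

theorem localSgrad_contDiffOn {f : M → ℝ} (hf : ContMDiff (𝓡 (2 * n)) 𝓘(ℝ, ℝ) ∞ f) (c : M) :
    ContDiffOn ℝ ∞ (localSgrad Ω f c) (extChartAt (𝓡 (2 * n)) c).target := by
  intro y hy
  have h1 : ContDiffAt ℝ ∞ (fun y => bilinOfForm (Model n) (formInChart Ω.toForm c y)) y :=
    ContDiffAt.comp (g := bilinOfForm (Model n)) y (ContinuousLinearMap.contDiff _).contDiffAt
      ((Ω.smooth c).contDiffAt (mem_extChartAt_target_nhds hy))
  have h2 := (isInvertible_bilinOfForm Ω hy).contDiffAt_map_inverse (n := ∞)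
  have h3 : ContDiffAt ℝ ∞ (fderiv ℝ (inChart f c)) y :=
    ((contDiffOn_inChart hf c).contDiffAt (mem_extChartAt_target_nhds hy)).fderiv_right
      (m := ∞) (by simp)
  exact ((ContDiffAt.comp y h2 h1).clm_apply h3.neg).contDiffWithinAt

theorem formInChart_localSgrad (f : M → ℝ) {c : M} {y : Model n}
    (hy : y ∈ (extChartAt (𝓡 (2 * n)) c).target) (w : Model n) :
    formInChart Ω.toForm c y ![localSgrad Ω f c y, w] = -fderiv ℝ (inChart f c) y w := by
  rw [← bilinOfForm_apply, localSgrad]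
  obtain ⟨J, hJ⟩ := isInvertible_bilinOfForm Ω hy
  rw [← hJ, ContinuousLinearMap.inverse_equiv]
  exact congrArg (fun A => A w) (J.apply_symm_apply (-fderiv ℝ (inChart f c) y))

/-- The vector field on `M` with local expression `localSgrad Ω f c` is `sgrad f`. -/
theorem formAt_chartVec_localSgrad {f : M → ℝ} (hf : ContMDiff (𝓡 (2 * n)) 𝓘(ℝ, ℝ) ∞ f) {c z : M}
    (hz : z ∈ (extChartAt (𝓡 (2 * n)) c).source) (r : ℝ) (w : Model n) :
    formAt Ω z ![chartVec c (extChartAt (𝓡 (2 * n)) c z)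
      (r • localSgrad Ω f c (extChartAt (𝓡 (2 * n)) c z)), w] =
      -(r * differential f z w) := by
  have hy := (extChartAt (𝓡 (2 * n)) c).map_source hz
  have hzz := (extChartAt (𝓡 (2 * n)) c).left_inv hz
  set y := extChartAt (𝓡 (2 * n)) c z
  obtain ⟨D, hD⟩ := isInvertible_chartVec hy
  have h4 : chartVec c y (D.symm w) = w := by rw [← hD]; exact D.apply_symm_apply w
  have h1 := bilinOfForm_formInChart Ω c y (r • localSgrad Ω f c y) (D.symm w)
  have h2 := fderiv_inChart hf hy (D.symm w)
  have h3 := formInChart_localSgrad Ω f hy (D.symm w)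
  rw [map_smul, smul_apply, bilinOfForm_apply, h3, h2, h4, hzz] at h1
  rw [← h1, smul_eq_mul, mul_neg]

end

/-! ### Hamiltonian flows supported in a chart domain -/

section

variable {n : ℕ} {M : Type*} [TopologicalSpace M] [ChartedSpace (Model n) M]

/-- A smooth family `ψ_τ`, `τ ∈ ℝ`, of compactly supported diffeomorphisms with `ψ_{-τ} = ψ_τ⁻¹`,
generated by the normalized Hamiltonians `k_τ`. The group law is not required, so that time may be
reparametrized by an odd function. -/
structure IsHamiltonianFlow [MeasurableSpace M] (Ω : SymplecticForm n M)
    (ψ : ℝ → M ≃ₘ⟮𝓡 (2 * n), 𝓡 (2 * n)⟯ M) (k : ℝ → M → ℝ) : Prop where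
  smooth : ContMDiff (𝓘(ℝ, ℝ).prod (𝓡 (2 * n))) (𝓡 (2 * n)) ∞ (fun q : ℝ × M => ψ q.1 q.2)
  compact_support : ∃ K : Set M, IsCompact K ∧ ∀ τ, closure {x | ψ τ x ≠ x} ⊆ K
  zero : ∀ x, ψ 0 x = x
  neg : ∀ τ x, ψ (-τ) (ψ τ x) = x
  generates : ∀ τ, ∃ X : (x : M) → TangentSpace (𝓡 (2 * n)) x, IsSgrad Ω (k τ) X ∧
    ∀ x, HasMFDerivAt 𝓘(ℝ, ℝ) (𝓡 (2 * n)) (fun s => ψ s x) τ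
      ((1 : ℝ →L[ℝ] ℝ).smulRight (X (ψ τ x)))
  normalized : IsNormalizedHamiltonian Ω (Set.univ : Set ℝ) k

section
variable [IsManifold (𝓡 (2 * n)) ∞ M] (Ω : SymplecticForm n M)

omit [IsManifold (𝓡 (2 * n)) ∞ M] in
theorem localSgrad_eq_zero {h : M → ℝ} {c : M} {y : Model n}
    (hy : y ∈ (extChartAt (𝓡 (2 * n)) c).target)
    (hyh : (extChartAt (𝓡 (2 * n)) c).symm y ∉ tsupport h) : localSgrad Ω h c y = 0 := by
  have h1 : inChart h c =ᶠ[nhds y] fun _ => 0 := by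
    filter_upwards [(continuousAt_extChartAt_symm'' hy).preimage_mem_nhds
      ((isClosed_tsupport h).isOpen_compl.mem_nhds hyh)] with z hz
    exact image_eq_zero_of_notMem_tsupport (f := h) hz
  rw [localSgrad, h1.fderiv_eq]
  simp

/-- The local expression of `sgrad h`, extended by zero, for `h` supported in a chart domain. -/
def cutSgrad (h : M → ℝ) (c : M) : Model n → Model n :=
  (extChartAt (𝓡 (2 * n)) c).target.indicator (localSgrad Ω h c)

omit [IsManifold (𝓡 (2 * n)) ∞ M] in
theorem cutSgrad_eq_zero {h : M → ℝ} {c : M} {y : Model n}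
    (hy : y ∉ extChartAt (𝓡 (2 * n)) c '' tsupport h) : cutSgrad Ω h c y = 0 := by
  by_cases hyt : y ∈ (extChartAt (𝓡 (2 * n)) c).target
  · rw [cutSgrad, Set.indicator_of_mem hyt]
    refine localSgrad_eq_zero Ω hyt fun hmem => hy ⟨_, hmem, ?_⟩
    exact (extChartAt (𝓡 (2 * n)) c).right_inv hyt
  · exact Set.indicator_of_notMem hyt _

variable {h : M → ℝ} {c : M}

omit [IsManifold (𝓡 (2 * n)) ∞ M] in
theorem isCompact_image_tsupport (hK : HasCompactSupport h)
    (hc : tsupport h ⊆ (extChartAt (𝓡 (2 * n)) c).source) :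
    IsCompact (extChartAt (𝓡 (2 * n)) c '' tsupport h) :=
  IsCompact.image_of_continuousOn hK ((continuousOn_extChartAt c).mono hc)

omit [IsManifold (𝓡 (2 * n)) ∞ M] in
theorem image_tsupport_subset (hc : tsupport h ⊆ (extChartAt (𝓡 (2 * n)) c).source) :
    extChartAt (𝓡 (2 * n)) c '' tsupport h ⊆ (extChartAt (𝓡 (2 * n)) c).target := by
  rintro _ ⟨x, hx, rfl⟩
  exact (extChartAt (𝓡 (2 * n)) c).map_source (hc hx)

theorem cutSgrad_contDiff (hh : ContMDiff (𝓡 (2 * n)) 𝓘(ℝ, ℝ) ∞ h) (hK : HasCompactSupport h)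
    (hc : tsupport h ⊆ (extChartAt (𝓡 (2 * n)) c).source) : ContDiff ℝ ∞ (cutSgrad Ω h c) := by
  rw [contDiff_iff_contDiffAt]
  intro y
  by_cases hy : y ∈ (extChartAt (𝓡 (2 * n)) c).target
  · refine ((localSgrad_contDiffOn Ω hh c).contDiffAt
      (mem_extChartAt_target_nhds hy)).congr_of_eventuallyEq ?_
    filter_upwards [mem_extChartAt_target_nhds hy] with z hz
    exact Set.indicator_of_mem hz _
  · refine (contDiffAt_const (c := (0 : Model n))).congr_of_eventuallyEq ?_
    filter_upwards [(isCompact_image_tsupport hK hc).isClosed.isOpen_compl.mem_nhds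
      (fun hmem => hy (image_tsupport_subset hc hmem))] with z hz
    exact cutSgrad_eq_zero Ω hz

/-- A function supported in a chart domain generates, after rescaling time, a Hamiltonian flow. The
constant `m` is the normalization of `h`. -/
theorem exists_hamiltonianFlow [MeasurableSpace M] [T2Space M]
    (hh : ContMDiff (𝓡 (2 * n)) 𝓘(ℝ, ℝ) ∞ h) (hK : HasCompactSupport h)
    (hc : tsupport h ⊆ (extChartAt (𝓡 (2 * n)) c).source) {m : ℝ}
    (hm : CompactSpace M → ∫ x, (h x - m) ∂(canonicalVolume Ω) = 0)
    (hm' : ¬ CompactSpace M → m = 0) :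
    ∃ r : ℝ, 0 < r ∧ ∃ ψ : ℝ → M ≃ₘ⟮𝓡 (2 * n), 𝓡 (2 * n)⟯ M,
      IsHamiltonianFlow Ω ψ fun τ x => r * Real.cos τ * (h x - m) := by
  classical
  set φ := extChartAt (𝓡 (2 * n)) c with hφ
  have hvK : HasCompactSupport (cutSgrad Ω h c) :=
    HasCompactSupport.intro (isCompact_image_tsupport hK hc) fun y hy => cutSgrad_eq_zero Ω hy
  obtain ⟨r, hr, f, hf, hf0, hfd, hfn, hffix⟩ :=
    exists_contDiff_flow (cutSgrad Ω h c) (cutSgrad_contDiff Ω hh hK hc) hvK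
  -- zeros of the field are fixed, so no solution leaves the image of the chart
  have htgt : ∀ τ, ∀ y ∈ φ.target, f τ y ∈ φ.target := by
    intro τ y hy
    by_contra hny
    have h0 : cutSgrad Ω h c (f τ y) = 0 := Set.indicator_of_notMem hny _
    have h1 := hffix (-τ) _ h0
    rw [hfn] at h1
    exact hny (h1 ▸ hy)
  -- the flow, transported to `M` and extended by the identity
  let Ψ : ℝ → M → M := fun τ x => if x ∈ φ.source then φ.symm (f τ (φ x)) else x
  have hΨin : ∀ τ, ∀ x ∈ φ.source, Ψ τ x = φ.symm (f τ (φ x)) := fun τ x hx => if_pos hx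
  have hΨout : ∀ τ, ∀ x, x ∉ tsupport h → Ψ τ x = x := by
    intro τ x hx
    by_cases hxs : x ∈ φ.source
    · have h0 : cutSgrad Ω h c (φ x) = 0 := by
        apply cutSgrad_eq_zero
        rintro ⟨z, hz, hzx⟩
        exact hx ((φ.injOn (hc hz) hxs hzx) ▸ hz)
      rw [hΨin τ x hxs, hffix _ _ h0, φ.left_inv hxs]
    · exact if_neg hxs
  have hsrc : ∀ τ, ∀ x ∈ φ.source, Ψ τ x ∈ φ.source := by
    intro τ x hx
    rw [hΨin τ x hx]
    exact φ.map_target (htgt _ _ (φ.map_source hx))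
  have hneg : ∀ τ x, Ψ (-τ) (Ψ τ x) = x := by
    intro τ x
    by_cases hx : x ∈ φ.source
    · rw [hΨin _ _ (hsrc τ x hx), hΨin τ x hx, φ.right_inv (htgt _ _ (φ.map_source hx)), hfn,
        φ.left_inv hx]
    · simp only [Ψ, if_neg hx]
  have hsm : ContMDiff (𝓘(ℝ, ℝ).prod (𝓡 (2 * n))) (𝓡 (2 * n)) ∞
      (fun q : ℝ × M => Ψ q.1 q.2) := by
    rintro ⟨τ, x⟩
    by_cases hx : x ∈ φ.source
    · have e1 : ContMDiffAt (𝓘(ℝ, ℝ).prod (𝓡 (2 * n))) 𝓘(ℝ, Model n) ∞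
          (fun q : ℝ × M => φ q.2) (τ, x) :=
        (contMDiffAt_extChartAt' (by simpa [hφ] using hx)).comp (τ, x) contMDiffAt_snd
      have e2 : ContMDiffAt (𝓘(ℝ, ℝ).prod (𝓡 (2 * n))) 𝓘(ℝ, Model n) ∞
          (fun q : ℝ × M => f q.1 (φ q.2)) (τ, x) :=
        hf.contMDiff.contMDiffAt.comp (τ, x) (contMDiffAt_fst.prodMk_space e1)
      have e3 : ContMDiffAt (𝓘(ℝ, ℝ).prod (𝓡 (2 * n))) (𝓡 (2 * n)) ∞
          (fun q : ℝ × M => φ.symm (f q.1 (φ q.2))) (τ, x) :=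
        (contMDiffAt_extChartAt_symm_target (htgt _ _ (φ.map_source hx))).comp (τ, x) e2
      refine e3.congr_of_eventuallyEq ?_
      filter_upwards [continuousAt_snd.preimage_mem_nhds
        ((isOpen_extChartAt_source c).mem_nhds hx)] with q hq
      exact hΨin _ _ hq
    · refine contMDiffAt_snd.congr_of_eventuallyEq ?_
      filter_upwards [continuousAt_snd.preimage_mem_nhds
        ((isClosed_tsupport h).isOpen_compl.mem_nhds (fun hmem => hx (hc hmem)))] with q hq
      exact hΨout _ _ hq
  have hslice : ∀ τ, ContMDiff (𝓡 (2 * n)) (𝓡 (2 * n)) ∞ (Ψ τ) := fun τ =>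
    hsm.comp (contMDiff_const.prodMk contMDiff_id)
  let ψ : ℝ → M ≃ₘ⟮𝓡 (2 * n), 𝓡 (2 * n)⟯ M := fun τ =>
    { toFun := Ψ τ
      invFun := Ψ (-τ)
      left_inv := hneg τ
      right_inv := fun x => by simpa using hneg (-τ) x
      contMDiff_toFun := hslice τ
      contMDiff_invFun := hslice (-τ) }
  refine ⟨r, hr, ψ, hsm, ⟨tsupport h, hK, fun τ => ?_⟩, ?_, hneg, ?_, ?_, ?_, ?_⟩
  · refine closure_minimal (fun x hx => ?_) (isClosed_tsupport h)
    by_contra hn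
    exact hx (hΨout τ x hn)
  · intro x
    by_cases hx : x ∈ φ.source
    · change Ψ 0 x = x
      rw [hΨin 0 x hx, hf0, φ.left_inv hx]
    · exact if_neg hx
  · intro τ
    refine ⟨fun z => if z ∈ φ.source then
      chartVec c (φ z) ((r * Real.cos τ) • cutSgrad Ω h c (φ z)) else (0 : Model n), ?_, ?_⟩
    · intro z w
      have hd : differential (fun x => r * Real.cos τ * (h x - m)) z w =
          r * Real.cos τ * differential h z w := by
        have e1 := (hh.mdifferentiable (by simp) z).hasMFDerivAt
        have e2 : HasMFDerivAt (𝓡 (2 * n)) 𝓘(ℝ, ℝ) (fun x => r * Real.cos τ * (h x - m)) z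
            ((r * Real.cos τ) • differential h z) := by
          have e3 : HasFDerivAt (fun s : ℝ => r * Real.cos τ * (s - m))
              ((r * Real.cos τ) • ContinuousLinearMap.id ℝ ℝ) (h z) :=
            ((hasFDerivAt_id (h z)).sub_const m).const_mul _
          exact HasMFDerivAt.comp z e3.hasMFDerivAt e1
        exact congrArg (fun A => A w) e2.mfderiv
      change formAt Ω z ![(if z ∈ φ.source then
        chartVec c (φ z) ((r * Real.cos τ) • cutSgrad Ω h c (φ z)) else (0 : Model n)), w] =
          -differential (fun x => r * Real.cos τ * (h x - m)) z w
      rw [hd]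
      by_cases hz : z ∈ φ.source
      · rw [if_pos hz, cutSgrad, Set.indicator_of_mem (φ.map_source hz)]
        exact formAt_chartVec_localSgrad Ω hh hz _ w
      · rw [if_neg hz]
        have e1 : h =ᶠ[nhds z] fun _ => 0 := by
          filter_upwards [(isClosed_tsupport h).isOpen_compl.mem_nhds
            (fun hmem => hz (hc hmem))] with x hx
          exact image_eq_zero_of_notMem_tsupport hx
        have e2 : differential h z w = 0 := by
          have : HasMFDerivAt (𝓡 (2 * n)) 𝓘(ℝ, ℝ) h z (0 : Model n →L[ℝ] ℝ) :=
            (hasMFDerivAt_const (0 : ℝ) z).congr_of_eventuallyEq e1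
          exact congrArg (fun A => A w) this.mfderiv
        rw [e2, mul_zero, neg_zero]
        exact congrArg (fun A : Model n →L[ℝ] ℝ => A w) (bilinOfForm (Model n) (formAt Ω z)).map_zero
    · intro x
      by_cases hx : x ∈ φ.source
      · have e1 : HasFDerivAt (fun s => f s (φ x)) ((1 : ℝ →L[ℝ] ℝ).smulRight
            ((r * Real.cos τ) • cutSgrad Ω h c (f τ (φ x)))) τ := (hfd τ (φ x)).hasFDerivAt
        have hft := htgt τ _ (φ.map_source hx)
        have e2 := ((contMDiffAt_extChartAt_symm_target hft).mdifferentiableAt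
          (by simp)).hasMFDerivAt
        have e3 := HasMFDerivAt.comp τ e2 e1.hasMFDerivAt
        have e4 : HasMFDerivAt 𝓘(ℝ, ℝ) (𝓡 (2 * n)) (fun s => Ψ s x) τ
            ((chartVec c (f τ (φ x))).comp ((1 : ℝ →L[ℝ] ℝ).smulRight
            ((r * Real.cos τ) • cutSgrad Ω h c (f τ (φ x))))) :=
          e3.congr_of_eventuallyEq (Filter.Eventually.of_forall fun s => hΨin s x hx)
        refine e4.congr_mfderiv ?_
        have e5 : φ (Ψ τ x) = f τ (φ x) := by rw [hΨin τ x hx, φ.right_inv hft]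
        change _ = (1 : ℝ →L[ℝ] ℝ).smulRight (if Ψ τ x ∈ φ.source then
          chartVec c (φ (Ψ τ x)) ((r * Real.cos τ) • cutSgrad Ω h c (φ (Ψ τ x)))
            else (0 : Model n))
        rw [if_pos (hsrc τ x hx), e5]
        refine ContinuousLinearMap.ext fun t => ?_
        exact (chartVec c (f τ (φ x))).map_smul t _
      · have e1 : ∀ s, Ψ s x = x := fun s => if_neg hx
        have e4 : HasMFDerivAt 𝓘(ℝ, ℝ) (𝓡 (2 * n)) (fun s => Ψ s x) τ (0 : ℝ →L[ℝ] Model n) :=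
          (hasMFDerivAt_const x τ).congr_of_eventuallyEq (Filter.Eventually.of_forall e1)
        refine e4.congr_mfderiv ?_
        change _ = (1 : ℝ →L[ℝ] ℝ).smulRight (if Ψ τ x ∈ φ.source then
          chartVec c (φ (Ψ τ x)) ((r * Real.cos τ) • cutSgrad Ω h c (φ (Ψ τ x)))
            else (0 : Model n))
        rw [if_neg (by rw [e1]; exact hx)]
        simp
  · refine ContMDiff.contMDiffOn ?_
    have e1 : ContMDiff (𝓘(ℝ, ℝ).prod (𝓡 (2 * n))) 𝓘(ℝ, ℝ) ∞
        (fun q : ℝ × M => r * Real.cos q.1) :=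
      (contDiff_const.mul Real.contDiff_cos).contMDiff.comp contMDiff_fst
    exact e1.mul ((hh.comp contMDiff_snd).sub contMDiff_const)
  · intro hM τ _
    rw [integral_const_mul, hm hM, mul_zero]
  · intro hM
    refine ⟨tsupport h, hK, fun τ _ => ?_⟩
    simp only [hm' hM, sub_zero]
    exact closure_mono (Function.support_mul_subset_right _ _)

end
end

/-! ### Hamiltonian flows are symplectic -/

section

variable {n : ℕ} {M : Type*} [TopologicalSpace M] [ChartedSpace (Model n) M]

section
variable [IsManifold (𝓡 (2 * n)) ∞ M] {Q : Type*} [NormedAddCommGroup Q] [NormedSpace ℝ Q]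
  {Ω : SymplecticForm n M} {Γ : Q → M} {S : Set Q}

/-- If the contraction of `Γ^* Ω` with `τ` is a multiple of `dB` up to the corrections `fu`, `fv`,
then closedness computes the derivative of `Γ^* Ω (u, v)` along `τ`: the second derivatives of the
potential `B` cancel. -/
theorem fderivWithin_pull_of_potential (hS : UniqueDiffOn ℝ S)
    (hΓ : ContMDiffOn 𝓘(ℝ, Q) (𝓡 (2 * n)) ∞ Γ S) {q : Q} (hq : q ∈ S)
    (hcl : q ∈ closure (interior S)) {τ u v : Q} {B fu fv : Q → ℝ} (hB : ContDiffOn ℝ ∞ B S)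
    (hfu : DifferentiableWithinAt ℝ fu S q) (hfv : DifferentiableWithinAt ℝ fv S q)
    (hu : ∀ r ∈ S, pull Ω Γ S τ u r = fu r - fderivWithin ℝ B S r u)
    (hv : ∀ r ∈ S, pull Ω Γ S τ v r = fv r - fderivWithin ℝ B S r v) :
    fderivWithin ℝ (pull Ω Γ S u v) S q τ =
      fderivWithin ℝ fv S q u - fderivWithin ℝ fu S q v := by
  have hc := pull_closed Ω hS hΓ hq hcl τ u v
  have hDB : DifferentiableWithinAt ℝ (fderivWithin ℝ B S) S q :=
    ((hB.fderivWithin hS (m := ∞) (by simp)).differentiableOn (by simp)) q hq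
  have hu' := hS q hq
  have hd : ∀ w z : Q, fderivWithin ℝ (fun r => fderivWithin ℝ B S r w) S q z =
      fderivWithin ℝ (fderivWithin ℝ B S) S q z w := by
    intro w z
    have h1 := (hDB.hasFDerivWithinAt.clm_apply (hasFDerivWithinAt_const w q S)).fderivWithin hu'
    rw [h1]
    simp
  have hdw : ∀ w, DifferentiableWithinAt ℝ (fun r => fderivWithin ℝ B S r w) S q := fun w =>
    hDB.clm_apply (differentiableWithinAt_const w)
  have hsym : fderivWithin ℝ (fderivWithin ℝ B S) S q u v =
      fderivWithin ℝ (fderivWithin ℝ B S) S q v u :=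
    ((hB q hq).isSymmSndFDerivWithinAt (by simpa using two_le_smooth) hS hcl hq) u v
  have e1 : fderivWithin ℝ (pull Ω Γ S τ v) S q u =
      fderivWithin ℝ fv S q u - fderivWithin ℝ (fderivWithin ℝ B S) S q u v := by
    rw [fderivWithin_congr hv (hv q hq), fderivWithin_fun_sub hu' hfv (hdw v), ← hd v u]
    rfl
  have e2 : fderivWithin ℝ (pull Ω Γ S τ u) S q v =
      fderivWithin ℝ fu S q v - fderivWithin ℝ (fderivWithin ℝ B S) S q v u := by
    rw [fderivWithin_congr hu (hu q hq), fderivWithin_fun_sub hu' hfu (hdw u), ← hd u v]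
    rfl
  rw [e1, e2] at hc
  linarith
end

/-- The differential of `g : M → M`, as an endomorphism of the model space. -/
def pushVec (g : M → M) (x : M) : Model n →L[ℝ] Model n := mfderiv (𝓡 (2 * n)) (𝓡 (2 * n)) g x

variable [IsManifold (𝓡 (2 * n)) ∞ M] {Ω : SymplecticForm n M}

/-- A map `g` is symplectic if `g^* Ω = Ω`. -/
def IsSymplectic (Ω : SymplecticForm n M) (g : M → M) : Prop :=
  ∀ (x : M) (u v : Model n), formAt Ω (g x) ![pushVec g x u, pushVec g x v] = formAt Ω x ![u, v]

variable [MeasurableSpace M]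
  {ψ : ℝ → M ≃ₘ⟮𝓡 (2 * n), 𝓡 (2 * n)⟯ M} {k : ℝ → M → ℝ}

/-- In a chart let `Γ(τ, y) = ψ_τ(y)`. On vectors tangent to `M` the contraction of `Γ^* Ω` with
`∂_τ` is exact, so by closedness the values of `Γ^* Ω` on such vectors do not depend on `τ`. -/
theorem IsHamiltonianFlow.isSymplectic (hψ : IsHamiltonianFlow Ω ψ k) (τ : ℝ) :
    IsSymplectic Ω (ψ τ) := by
  intro x u v
  set φ := extChartAt (𝓡 (2 * n)) x with hφ
  have hx : φ x ∈ φ.target := mem_extChartAt_target x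
  have hxx : φ.symm (φ x) = x := extChartAt_to_inv x
  obtain ⟨D, hD⟩ := isInvertible_chartVec hx
  obtain ⟨u₀, rfl⟩ := D.surjective u
  obtain ⟨v₀, rfl⟩ := D.surjective v
  set S : Set (ℝ × Model n) := Set.univ ×ˢ φ.target with hS
  have hSo : IsOpen S := isOpen_univ.prod (isOpen_extChartAt_target x)
  set Γ : ℝ × Model n → M := fun q => ψ q.1 (φ.symm q.2) with hΓdef
  have hΓ : ContMDiffOn 𝓘(ℝ, ℝ × Model n) (𝓡 (2 * n)) ∞ Γ S := by
    intro q hq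
    have e1 : ContMDiffAt 𝓘(ℝ, ℝ × Model n) (𝓡 (2 * n)) ∞ (fun q : ℝ × Model n => φ.symm q.2) q :=
      (contMDiffAt_extChartAt_symm_target hq.2).comp q contDiffAt_snd.contMDiffAt
    exact (hψ.smooth.contMDiffAt.comp q
      (contDiffAt_fst.contMDiffAt.prodMk e1)).contMDiffWithinAt
  have hkS : ContMDiffOn (𝓘(ℝ, ℝ).prod (𝓡 (2 * n))) 𝓘(ℝ, ℝ) ∞ (fun q : ℝ × M => k q.1 q.2)
    (Set.univ ×ˢ Set.univ) := hψ.normalized.smooth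
  have hmd : ∀ q ∈ S, MDifferentiableAt 𝓘(ℝ, ℝ × Model n) (𝓡 (2 * n)) Γ q := fun q hq =>
    ((hΓ q hq).contMDiffAt (hSo.mem_nhds hq)).mdifferentiableAt (by simp)
  have hwithin : ∀ q ∈ S, mfderivWithin 𝓘(ℝ, ℝ × Model n) (𝓡 (2 * n)) Γ S q =
      mfderiv 𝓘(ℝ, ℝ × Model n) (𝓡 (2 * n)) Γ q := fun q hq =>
    mfderivWithin_of_mem_nhds (hSo.mem_nhds hq)
  have hB : ContDiffOn ℝ ∞ (fun q : ℝ × Model n => k q.1 (Γ q)) S := by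
    rw [← contMDiffOn_iff_contDiffOn]
    exact hkS.comp (contDiff_fst.contMDiff.contMDiffOn.prodMk hΓ) fun q hq => ⟨trivial, trivial⟩
  have hpull : ∀ w : Model n, ∀ q ∈ S, pull Ω Γ S (1, 0) (0, w) q =
      (fun _ => (0 : ℝ)) q - fderivWithin ℝ (fun q : ℝ × Model n => k q.1 (Γ q)) S q (0, w) := by
    intro w q hq
    obtain ⟨X, hX, hXd⟩ := hψ.generates q.1
    have e1 : mfderivWithin 𝓘(ℝ, ℝ × Model n) (𝓡 (2 * n)) Γ S q (1, 0) = X (Γ q) := by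
      rw [hwithin q hq]
      have h1 : HasFDerivAt (fun s : ℝ => (s, q.2)) (ContinuousLinearMap.inl ℝ ℝ (Model n)) q.1 :=
        hasFDerivAt_prodMk_left q.1 q.2
      have h2 := HasMFDerivAt.comp q.1 (hmd (q.1, q.2) hq).hasMFDerivAt h1.hasMFDerivAt
      have h3 := hasMFDerivAt_unique h2 (hXd (φ.symm q.2))
      have h4 := congrArg (fun A : ℝ →L[ℝ] Model n => A 1) h3
      exact h4.trans (one_smul ℝ (X (Γ q) : Model n))
    rw [pull_of_isSgrad (G := k) uniqueDiffOn_univ hkS hSo.uniqueDiffOn hΓ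
      (ContinuousLinearMap.fst ℝ ℝ (Model n)) (fun _ _ => trivial) hq hX e1 (0, w)]
    simp
  have hzero : ∀ q ∈ S, fderivWithin ℝ (pull Ω Γ S (0, u₀) (0, v₀)) S q (1, 0) = 0 := by
    intro q hq
    have := fderivWithin_pull_of_potential hSo.uniqueDiffOn hΓ hq
      (by rw [hSo.interior_eq]; exact subset_closure hq) hB (differentiableWithinAt_const 0)
      (differentiableWithinAt_const 0) (hpull u₀) (hpull v₀)
    simpa using this
  have hconst : pull Ω Γ S (0, u₀) (0, v₀) (τ, φ x) = pull Ω Γ S (0, u₀) (0, v₀) (0, φ x) := by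
    refine is_const_of_deriv_eq_zero (f := fun s => pull Ω Γ S (0, u₀) (0, v₀) (s, φ x))
      ?_ ?_ τ 0
    all_goals
      have hd : ∀ s : ℝ, HasDerivAt (fun s => pull Ω Γ S (0, u₀) (0, v₀) (s, φ x)) 0 s := by
        intro s
        have hs : (s, φ x) ∈ S := ⟨trivial, hx⟩
        have h1 := (((pull_contDiffOn Ω hSo.uniqueDiffOn hΓ (0, u₀) (0, v₀)).differentiableOn
          (by simp)) _ hs).hasFDerivWithinAt
        have h2 := (h1.hasFDerivAt (hSo.mem_nhds hs)).comp_hasDerivAt s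
          ((hasFDerivAt_prodMk_left (𝕜 := ℝ) s (φ x)).hasDerivAt)
        exact h2.congr_deriv (hzero _ hs)
    · exact fun s => (hd s).differentiableAt
    · exact fun s => (hd s).deriv
  have hslice : ∀ s w, (mfderivWithin 𝓘(ℝ, ℝ × Model n) (𝓡 (2 * n)) Γ S (s, φ x) (0, w) : Model n) =
      pushVec (ψ s) (φ.symm (φ x)) (chartVec x (φ x) w) := by
    intro s w
    have hs : (s, φ x) ∈ S := ⟨trivial, hx⟩
    rw [hwithin _ hs]
    have h1 : HasFDerivAt (fun y : Model n => (s, y)) (ContinuousLinearMap.inr ℝ ℝ (Model n)) (φ x) :=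
      hasFDerivAt_prodMk_right s (φ x)
    have h2 := HasMFDerivAt.comp (φ x) (hmd _ hs).hasMFDerivAt h1.hasMFDerivAt
    have h3 := HasMFDerivAt.comp (φ x)
      (((ψ s).contMDiff.mdifferentiable (by simp)) (φ.symm (φ x))).hasMFDerivAt
      ((contMDiffAt_extChartAt_symm_target hx).mdifferentiableAt (by simp)).hasMFDerivAt
    exact congrArg (fun A : Model n →L[ℝ] Model n => A w) (hasMFDerivAt_unique h2 h3)
  have hval : ∀ s, pull Ω Γ S (0, u₀) (0, v₀) (s, φ x) =
      formAt Ω (ψ s x) ![pushVec (ψ s) x (D u₀), pushVec (ψ s) x (D v₀)] := by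
    intro s
    change formAt Ω (ψ s (φ.symm (φ x)))
      ![(mfderivWithin 𝓘(ℝ, ℝ × Model n) (𝓡 (2 * n)) Γ S (s, φ x) (0, u₀) : Model n),
        (mfderivWithin 𝓘(ℝ, ℝ × Model n) (𝓡 (2 * n)) Γ S (s, φ x) (0, v₀) : Model n)] = _
    rw [hslice, hslice, hxx, ← hD]
    rfl
  have hid : ∀ w, pushVec (n := n) (ψ 0) x w = w := by
    intro w
    have h1 : HasMFDerivAt (𝓡 (2 * n)) (𝓡 (2 * n)) (ψ 0) x
        (ContinuousLinearMap.id ℝ (TangentSpace (𝓡 (2 * n)) x)) :=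
      (hasMFDerivAt_id x).congr_of_eventuallyEq (Filter.Eventually.of_forall hψ.zero)
    exact congrArg (fun A : Model n →L[ℝ] Model n => A w) h1.mfderiv
  rw [← hval, hconst, hval, hid, hid, hψ.zero]
end

/-! ### The canonical volume and symplectic maps -/

section

variable {n : ℕ} {M : Type*} [TopologicalSpace M] [ChartedSpace (Model n) M]

/-- The density of the volume of a linear 2-form on the model space. -/
def formDensity (η : (Model n) [⋀^Fin 2]→L[ℝ] ℝ) : ℝ :=
  √|(Matrix.of fun i j : Fin (2 * n) =>
      η ![EuclideanSpace.single i (1 : ℝ), EuclideanSpace.single j (1 : ℝ)]).det|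

/-- The Gram matrix of the form pulled back by `T` is `Tᵗ A T`, where `A` is that of the form. -/
theorem formDensity_comp (η : (Model n) [⋀^Fin 2]→L[ℝ] ℝ) (T : Model n →L[ℝ] Model n) :
    formDensity (η.compContinuousLinearMap T) = |T.det| * formDensity η := by
  set b := (EuclideanSpace.basisFun (Fin (2 * n)) ℝ).toBasis with hb
  have hform : ∀ ζ : (Model n) [⋀^Fin 2]→L[ℝ] ℝ, ∃ B : Model n →ₗ[ℝ] Model n →ₗ[ℝ] ℝ,
      ∀ u v, B u v = ζ ![u, v] := fun ζ =>
    ⟨((ContinuousLinearMap.coeLM ℝ).comp (bilinOfForm (Model n) ζ).toLinearMap), fun u v => rfl⟩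
  have hmat : ∀ (ζ : (Model n) [⋀^Fin 2]→L[ℝ] ℝ) (B : Model n →ₗ[ℝ] Model n →ₗ[ℝ] ℝ),
      (∀ u v, B u v = ζ ![u, v]) → (Matrix.of fun i j : Fin (2 * n) =>
      ζ ![EuclideanSpace.single i (1 : ℝ), EuclideanSpace.single j (1 : ℝ)]) =
        LinearMap.toMatrix₂ b b B := by
    intro ζ B hB
    ext i j
    simp [LinearMap.toMatrix₂_apply, hB, hb]
  obtain ⟨B, hB⟩ := hform η
  have hB' : ∀ u v, B.compl₁₂ (T : Model n →ₗ[ℝ] Model n) (T : Model n →ₗ[ℝ] Model n) u v =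
      η.compContinuousLinearMap T ![u, v] := by
    intro u v
    rw [comp_pair, ← hB]
    rfl
  rw [formDensity, formDensity, hmat _ _ hB, hmat _ _ hB', LinearMap.toMatrix₂_compl₁₂ b b b b,
    Matrix.det_mul, Matrix.det_mul, Matrix.det_transpose, LinearMap.det_toMatrix]
  have e : |LinearMap.det (T : Model n →ₗ[ℝ] Model n) * (LinearMap.toMatrix₂ b b B).det *
      LinearMap.det (T : Model n →ₗ[ℝ] Model n)| = |T.det| ^ 2 * |(LinearMap.toMatrix₂ b b B).det| := by
    rw [abs_mul, abs_mul]
    change |T.det| * _ * |T.det| = _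
    ring
  rw [e, Real.sqrt_mul (by positivity), Real.sqrt_sq (abs_nonneg _)]

variable [IsManifold (𝓡 (2 * n)) ∞ M] {Ω : SymplecticForm n M}

/-- The expression of a smooth map `g` in the charts at `c` and `c'`. -/
def mapInChart (g : M → M) (c c' : M) (y : Model n) : Model n :=
  extChartAt (𝓡 (2 * n)) c' (g ((extChartAt (𝓡 (2 * n)) c).symm y))

theorem mapInChart_differentiableAt {g : M → M} (hg : ContMDiff (𝓡 (2 * n)) (𝓡 (2 * n)) ∞ g)
    {c c' : M} {y : Model n} (hy : y ∈ (extChartAt (𝓡 (2 * n)) c).target)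
    (hy' : g ((extChartAt (𝓡 (2 * n)) c).symm y) ∈ (extChartAt (𝓡 (2 * n)) c').source) :
    DifferentiableAt ℝ (mapInChart g c c') y := by
  have h1 : ContMDiffAt 𝓘(ℝ, Model n) 𝓘(ℝ, Model n) ∞ (mapInChart g c c') y :=
    (contMDiffAt_extChartAt' (by simpa using hy')).comp y
      (hg.contMDiffAt.comp y (contMDiffAt_extChartAt_symm_target hy))
  exact h1.contDiffAt.differentiableAt (by simp)

theorem chartVec_comp_fderiv_mapInChart {g : M → M}
    (hg : ContMDiff (𝓡 (2 * n)) (𝓡 (2 * n)) ∞ g)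
    {c c' : M} {y : Model n} (hy : y ∈ (extChartAt (𝓡 (2 * n)) c).target)
    (hy' : g ((extChartAt (𝓡 (2 * n)) c).symm y) ∈ (extChartAt (𝓡 (2 * n)) c').source)
    (w : Model n) :
    chartVec c' (mapInChart g c c' y) (fderiv ℝ (mapInChart g c c') y w) =
      pushVec g ((extChartAt (𝓡 (2 * n)) c).symm y) (chartVec c y w) := by
  have ht : mapInChart g c c' y ∈ (extChartAt (𝓡 (2 * n)) c').target :=
    (extChartAt (𝓡 (2 * n)) c').map_source hy'
  have h1 := HasMFDerivAt.comp y
    ((contMDiffAt_extChartAt_symm_target ht).mdifferentiableAt (by simp)).hasMFDerivAt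
    (mapInChart_differentiableAt hg hy hy').hasFDerivAt.hasMFDerivAt
  have h2 := HasMFDerivAt.comp y
    ((hg.mdifferentiable (by simp)) ((extChartAt (𝓡 (2 * n)) c).symm y)).hasMFDerivAt
    ((contMDiffAt_extChartAt_symm_target hy).mdifferentiableAt (by simp)).hasMFDerivAt
  have h3 : (extChartAt (𝓡 (2 * n)) c').symm ∘ mapInChart g c c' =ᶠ[nhds y]
      g ∘ (extChartAt (𝓡 (2 * n)) c).symm := by
    have hcont : ContinuousAt (fun z => g ((extChartAt (𝓡 (2 * n)) c).symm z)) y :=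
      hg.continuous.continuousAt.comp (continuousAt_extChartAt_symm'' hy)
    filter_upwards [hcont.preimage_mem_nhds ((isOpen_extChartAt_source c').mem_nhds hy')] with z hz
    exact (extChartAt (𝓡 (2 * n)) c').left_inv hz
  exact congrArg (fun A : Model n →L[ℝ] Model n => A w)
    (hasMFDerivAt_unique h1 (h2.congr_of_eventuallyEq h3))

/-- The transformation rule of the volume density under a symplectic map. -/
theorem volumeDensity_mapInChart {g : M → M} (hg : ContMDiff (𝓡 (2 * n)) (𝓡 (2 * n)) ∞ g)
    (hs : IsSymplectic Ω g)
    {c c' : M} {y : Model n} (hy : y ∈ (extChartAt (𝓡 (2 * n)) c).target)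
    (hy' : g ((extChartAt (𝓡 (2 * n)) c).symm y) ∈ (extChartAt (𝓡 (2 * n)) c').source) :
    volumeDensity Ω c y = |(fderiv ℝ (mapInChart g c c') y).det| *
      volumeDensity Ω c' (mapInChart g c c' y) := by
  have e : formInChart Ω.toForm c y = (formInChart Ω.toForm c' (mapInChart g c c' y)).compContinuousLinearMap
      (fderiv ℝ (mapInChart g c c') y) := by
    have hpair : ∀ u v : Model n, formInChart Ω.toForm c y ![u, v] =
        ((formInChart Ω.toForm c' (mapInChart g c c' y)).compContinuousLinearMap
          (fderiv ℝ (mapInChart g c c') y)) ![u, v] := by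
      intro u v
      rw [comp_pair, ← bilinOfForm_apply, ← bilinOfForm_apply, bilinOfForm_formInChart,
        bilinOfForm_formInChart, chartVec_comp_fderiv_mapInChart hg hy hy',
        chartVec_comp_fderiv_mapInChart hg hy hy', ← hs]
      congr 2
      exact ((extChartAt (𝓡 (2 * n)) c').left_inv hy').symm
    ext m
    have hm : m = ![m 0, m 1] := by
      ext i
      fin_cases i <;> rfl
    rw [hm]
    exact hpair _ _
  change formDensity _ = _ * formDensity _
  rw [e, formDensity_comp]

variable [MeasurableSpace M] [BorelSpace M]

omit [IsManifold (𝓡 (2 * n)) ∞ M] in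
theorem chartVolume_apply {c : M} {A : Set M} (hA : MeasurableSet A) :
    chartVolume Ω c A = ∫⁻ y in (extChartAt (𝓡 (2 * n)) c).target ∩
      (extChartAt (𝓡 (2 * n)) c).symm ⁻¹' A, ENNReal.ofReal (volumeDensity Ω c y) := by
  have hT : MeasurableSet (extChartAt (𝓡 (2 * n)) c).target :=
    (isOpen_extChartAt_target c).measurableSet
  have hm : AEMeasurable (extChartAt (𝓡 (2 * n)) c).symm
      ((volume : Measure (Model n)).restrict (extChartAt (𝓡 (2 * n)) c).target) :=
    (continuousOn_extChartAt_symm c).aemeasurable hT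
  rw [chartVolume, Measure.map_apply_of_aemeasurable
    (hm.mono_ac (withDensity_absolutelyContinuous _ _)) hA]
  rw [withDensity_apply', Measure.restrict_restrict' hT, Set.inter_comm]

omit [IsManifold (𝓡 (2 * n)) ∞ M] in
theorem measurableSet_chart_preimage (c : M) {A : Set M} (hA : MeasurableSet A) :
    MeasurableSet ((extChartAt (𝓡 (2 * n)) c).target ∩
      (extChartAt (𝓡 (2 * n)) c).symm ⁻¹' A) := by
  have hT : MeasurableSet (extChartAt (𝓡 (2 * n)) c).target :=
    (isOpen_extChartAt_target c).measurableSet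
  have h := (continuousOn_iff_continuous_domRestrict.1
    (continuousOn_extChartAt_symm (I := 𝓡 (2 * n)) c)).measurable hA
  have h2 := hT.subtype_image h
  convert h2 using 1
  ext y
  simp [and_comm]

/-- The chart volumes are compatible with symplectic diffeomorphisms, by the change of variables
formula. For the identity this compares the volumes of two charts. -/
theorem chartVolume_image (g : M ≃ₘ⟮𝓡 (2 * n), 𝓡 (2 * n)⟯ M) (hs : IsSymplectic Ω g) {c c' : M}
    {A : Set M} (hA : MeasurableSet A) (hAc' : g '' A ⊆ (extChartAt (𝓡 (2 * n)) c').source) :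
    chartVolume Ω c A ≤ chartVolume Ω c' (g '' A) := by
  have hgA : MeasurableSet (g '' A) :=
    g.toHomeomorph.measurableEmbedding.measurableSet_image.2 hA
  rw [chartVolume_apply hA, chartVolume_apply hgA]
  set φ := extChartAt (𝓡 (2 * n)) c with hφ
  set φ' := extChartAt (𝓡 (2 * n)) c' with hφ'
  set B := φ.target ∩ φ.symm ⁻¹' A
  have hB : MeasurableSet B := measurableSet_chart_preimage c hA
  have hsrc : ∀ y ∈ B, g (φ.symm y) ∈ φ'.source := fun y hy => hAc' ⟨_, hy.2, rfl⟩
  have hinj : Set.InjOn (mapInChart g c c') B := by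
    intro y hy z hz hyz
    have h1 := φ'.injOn (hsrc y hy) (hsrc z hz) hyz
    exact φ.symm.injOn hy.1 hz.1 (g.injective h1)
  have hsub : mapInChart g c c' '' B ⊆ φ'.target ∩ φ'.symm ⁻¹' (g '' A) := by
    rintro _ ⟨y, hy, rfl⟩
    refine ⟨φ'.map_source (hsrc y hy), ?_⟩
    change φ'.symm (φ' (g (φ.symm y))) ∈ g '' A
    rw [φ'.left_inv (hsrc y hy)]
    exact ⟨_, hy.2, rfl⟩
  refine le_trans (le_of_eq ?_) (lintegral_mono_set hsub)
  rw [lintegral_image_eq_lintegral_abs_det_fderiv_mul volume hB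
    (fun y hy => (mapInChart_differentiableAt g.contMDiff hy.1
      (hsrc y hy)).hasFDerivAt.hasFDerivWithinAt) hinj]
  refine setLIntegral_congr_fun hB fun y hy => ?_
  rw [volumeDensity_mapInChart g.contMDiff hs hy.1 (hsrc y hy), ENNReal.ofReal_mul (abs_nonneg _)]

omit [IsManifold (𝓡 (2 * n)) ∞ M] [TopologicalSpace M] [ChartedSpace (Model n) M] [BorelSpace M] in
/-- An inequality between measures may be checked on the members of a countable cover. -/
theorem measure_le_of_cover {ι : Type*} [Countable ι] {μ ν : Measure M} {V : ι → Set M}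
    (hV : ∀ i, MeasurableSet (V i)) (hcov : ⋃ i, V i = Set.univ)
    (h : ∀ i, ∀ A ⊆ V i, MeasurableSet A → μ A ≤ ν A) : μ ≤ ν := by
  classical
  cases isEmpty_or_nonempty ι
  · have : (Set.univ : Set M) = ∅ := by simpa using hcov.symm
    refine Measure.le_iff.2 fun A _ => ?_
    have hA : A = ∅ := Set.subset_empty_iff.1 (this ▸ Set.subset_univ A)
    simp [hA]
  obtain ⟨e, he⟩ := exists_surjective_nat ι
  refine Measure.le_iff.2 fun A hA => ?_
  set W := disjointed fun j => V (e j) with hW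
  have hWm : ∀ j, MeasurableSet (W j) := MeasurableSet.disjointed fun j => hV (e j)
  have hWu : ⋃ j, W j = Set.univ := by
    rw [hW, iUnion_disjointed, he.iUnion_comp, hcov]
  have hsum : ∀ ρ : Measure M, ρ A = ∑' j, ρ (A ∩ W j) := by
    intro ρ
    rw [← measure_iUnion (fun i j hij => ((disjoint_disjointed _ hij).mono Set.inter_subset_right
      Set.inter_subset_right)) (fun j => hA.inter (hWm j)), ← Set.inter_iUnion, hWu, Set.inter_univ]
  rw [hsum μ, hsum ν]
  exact ENNReal.tsum_le_tsum fun j => h (e j) _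
    (Set.inter_subset_right.trans (disjointed_subset _ _)) (hA.inter (hWm j))

theorem canonicalVolume_le_map [SecondCountableTopology M] (g : M ≃ₘ⟮𝓡 (2 * n), 𝓡 (2 * n)⟯ M)
    (hs : IsSymplectic Ω g) : canonicalVolume Ω ≤ (canonicalVolume Ω).map g.symm := by
  refine iSup_le fun c => ?_
  obtain ⟨s, hs1, hs2⟩ := TopologicalSpace.countable_cover_nhds
    (f := fun x : M => g ⁻¹' (extChartAt (𝓡 (2 * n)) (g x)).source)
    fun x => g.continuous.continuousAt.preimage_mem_nhds
      ((isOpen_extChartAt_source _).mem_nhds (mem_extChartAt_source _))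
  have := hs1.to_subtype
  refine measure_le_of_cover (V := fun x : s => g ⁻¹' (extChartAt (𝓡 (2 * n)) (g x)).source)
    (fun x => (((isOpen_extChartAt_source _).preimage g.continuous).measurableSet)) ?_ ?_
  · rw [← hs2, Set.biUnion_eq_iUnion]
  · intro x A hAx hA
    have himg : g '' A = g.symm ⁻¹' A := g.toEquiv.image_eq_preimage_symm A
    rw [Measure.map_apply g.symm.continuous.measurable hA, ← himg]
    exact (chartVolume_image g hs hA (Set.image_subset_iff.2 hAx)).trans
      (Measure.le_iff'.1 (le_iSup (fun c => chartVolume Ω c) (g x)) _)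

omit [IsManifold (𝓡 (2 * n)) ∞ M] [MeasurableSpace M] [BorelSpace M] in
theorem isSymplectic_id : IsSymplectic Ω (id : M → M) := by
  intro x u v
  have h : pushVec (n := n) (id : M → M) x = ContinuousLinearMap.id ℝ (Model n) :=
    (hasMFDerivAt_id (I := 𝓡 (2 * n)) x).mfderiv
  rw [h]
  rfl

theorem measurePreserving_of_isSymplectic [SecondCountableTopology M]
    (g : M ≃ₘ⟮𝓡 (2 * n), 𝓡 (2 * n)⟯ M)
    (hs : IsSymplectic Ω g) (hs' : IsSymplectic Ω g.symm) :
    MeasurePreserving g (canonicalVolume Ω) (canonicalVolume Ω) := by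
  have hm : Measurable g := g.continuous.measurable
  have hm' : Measurable g.symm := g.symm.continuous.measurable
  refine ⟨hm, le_antisymm ?_ (canonicalVolume_le_map g.symm hs')⟩
  calc (canonicalVolume Ω).map g ≤ ((canonicalVolume Ω).map g.symm).map g :=
        Measure.map_mono (canonicalVolume_le_map g hs) hm
    _ = canonicalVolume Ω := by
        rw [Measure.map_map hm hm']
        have : (g ∘ g.symm : M → M) = id := funext fun x => g.apply_symm_apply x
        rw [this, Measure.map_id]

omit [IsManifold (𝓡 (2 * n)) ∞ M] in
/-- The density of the volume is continuous, so that the chart volume is locally finite. -/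
theorem exists_chartVolume_lt_top (x : M) :
    ∃ U, IsOpen U ∧ x ∈ U ∧ U ⊆ (extChartAt (𝓡 (2 * n)) x).source ∧ chartVolume Ω x U < ⊤ := by
  set φ := extChartAt (𝓡 (2 * n)) x with hφ
  have hx : φ x ∈ φ.target := mem_extChartAt_target x
  have hcont : ContinuousAt (volumeDensity Ω x) (φ x) := by
    have h1 : ContinuousAt (formInChart Ω.toForm x) (φ x) :=
      ((Ω.smooth x).contDiffAt (mem_extChartAt_target_nhds hx)).continuousAt
    have h2 : ∀ u v, ContinuousAt (fun y => formInChart Ω.toForm x y ![u, v]) (φ x) := fun u v =>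
      ((ContinuousAlternatingMap.apply ℝ (Model n) ℝ ![u, v]).continuous.continuousAt.comp h1 :)
    refine (Real.continuous_sqrt.continuousAt.comp (continuous_abs.continuousAt.comp ?_))
    have h3 : ContinuousAt (fun y => Matrix.of fun i j : Fin (2 * n) => formInChart Ω.toForm x y
        ![EuclideanSpace.single i (1 : ℝ), EuclideanSpace.single j (1 : ℝ)]) (φ x) :=
      continuousAt_pi.2 fun i => continuousAt_pi.2 fun j => h2 _ _
    exact (Continuous.matrix_det continuous_id).continuousAt.comp h3
  set D := volumeDensity Ω x (φ x) + 1
  have hev := hcont.eventually (gt_mem_nhds (lt_add_one (volumeDensity Ω x (φ x))))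
  obtain ⟨r, hr, hball⟩ := Metric.mem_nhds_iff.1 (Filter.inter_mem hev (mem_extChartAt_target_nhds hx))
  have hUo : IsOpen (φ.source ∩ φ ⁻¹' Metric.ball (φ x) r) :=
    (continuousOn_extChartAt x).isOpen_inter_preimage (isOpen_extChartAt_source x) Metric.isOpen_ball
  refine ⟨_, hUo, ⟨mem_extChartAt_source x, Metric.mem_ball_self hr⟩, Set.inter_subset_left, ?_⟩
  rw [chartVolume_apply hUo.measurableSet]
  have hsub : φ.target ∩ φ.symm ⁻¹' (φ.source ∩ φ ⁻¹' Metric.ball (φ x) r) ⊆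
      Metric.ball (φ x) r := by
    rintro y ⟨hy, hy'⟩
    have := hy'.2
    rwa [Set.mem_preimage, φ.right_inv hy] at this
  refine (lintegral_mono_set hsub).trans_lt ?_
  calc _ ≤ ∫⁻ _ in Metric.ball (φ x) r, ENNReal.ofReal D :=
        setLIntegral_mono measurable_const fun y hy =>
          ENNReal.ofReal_le_ofReal (hball hy).1.le
    _ < ⊤ := by
        rw [setLIntegral_const]
        exact ENNReal.mul_lt_top ENNReal.ofReal_lt_top measure_ball_lt_top

/-- Finitely many sets of finite chart volume cover `M`, and on each of them the volumes computed in
the other charts are no larger. -/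
theorem isFiniteMeasure_canonicalVolume [CompactSpace M] :
    IsFiniteMeasure (canonicalVolume Ω) := by
  choose U hUo hxU hUs hUf using exists_chartVolume_lt_top (Ω := Ω)
  obtain ⟨s, hs⟩ := isCompact_univ.elim_nhds_subcover U fun x _ => (hUo x).mem_nhds (hxU x)
  have hle : canonicalVolume Ω ≤ ∑ x ∈ s, (chartVolume Ω x).restrict (U x) := by
    refine iSup_le fun c => ?_
    refine measure_le_of_cover (V := fun x : s => U x) (fun x => (hUo x).measurableSet) ?_ ?_
    · refine Set.eq_univ_of_univ_subset (hs.2.trans (le_of_eq ?_))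
      exact Set.biUnion_eq_iUnion (s := (s : Set M)) _
    · intro x A hAx hA
      have h1 := chartVolume_image (Ω := Ω) (c := c) (c' := x) (Diffeomorph.refl (𝓡 (2 * n)) M ∞)
        isSymplectic_id hA (by
          rintro _ ⟨z, hz, rfl⟩
          exact hUs _ (hAx hz))
      have h2 : (Diffeomorph.refl (𝓡 (2 * n)) M ∞) '' A = A := Set.image_id A
      rw [h2] at h1
      refine h1.trans ?_
      rw [Measure.finsetSum_apply]
      refine le_trans (le_of_eq ?_) (Finset.single_le_sum
        (f := fun x => (chartVolume Ω x).restrict (U x) A) (fun _ _ => zero_le) x.2)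
      rw [Measure.restrict_apply hA, Set.inter_eq_left.2 hAx]
  refine ⟨(Measure.le_iff'.1 hle _).trans_lt ?_⟩
  rw [Measure.finsetSum_apply]
  refine ENNReal.sum_lt_top.2 fun x _ => ?_
  rw [Measure.restrict_apply MeasurableSet.univ, Set.univ_inter]
  exact hUf x

end

/-! ### Composition of a family with a Hamiltonian flow -/

section

variable {n : ℕ} {M : Type*} [TopologicalSpace M] [ChartedSpace (Model n) M]
  [MeasurableSpace M] {Ω : SymplecticForm n M}
  {ψ : ℝ → M ≃ₘ⟮𝓡 (2 * n), 𝓡 (2 * n)⟯ M} {k : ℝ → M → ℝ}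
  {P : Type*} [NormedAddCommGroup P] [NormedSpace ℝ P] {S : Set P}

theorem IsHamiltonianFlow.neg' (hψ : IsHamiltonianFlow Ω ψ k) (τ : ℝ) (x : M) :
    ψ τ (ψ (-τ) x) = x := by
  simpa using hψ.neg (-τ) x

theorem IsHamiltonianFlow.symm_apply (hψ : IsHamiltonianFlow Ω ψ k) (τ : ℝ) :
    ⇑(ψ τ).symm = ψ (-τ) := by
  funext x
  apply (ψ τ).injective
  exact ((ψ τ).apply_symm_apply x).trans (hψ.neg' τ x).symm

/-- The family `ψ_{θ(p)} ∘ g_p`. -/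
def leftComp (ψ : ℝ → M ≃ₘ⟮𝓡 (2 * n), 𝓡 (2 * n)⟯ M) (θ : P → ℝ)
    (g : P → M ≃ₘ⟮𝓡 (2 * n), 𝓡 (2 * n)⟯ M) (p : P) : M ≃ₘ⟮𝓡 (2 * n), 𝓡 (2 * n)⟯ M :=
  (g p).trans (ψ (θ p))

/-- The Hamiltonian `η k_θ + G ∘ ψ_θ⁻¹` of the family `ψ_θ ∘ g`, where `η` is the time derivative of
`θ` and `G` is the Hamiltonian of `g`. -/
def leftHamiltonian (ψ : ℝ → M ≃ₘ⟮𝓡 (2 * n), 𝓡 (2 * n)⟯ M) (k : ℝ → M → ℝ) (θ η : P → ℝ)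
    (G : P → M → ℝ) (p : P) (x : M) : ℝ :=
  η p * k (θ p) x + G p (ψ (-θ p) x)

variable {θ η : P → ℝ} {g : P → M ≃ₘ⟮𝓡 (2 * n), 𝓡 (2 * n)⟯ M} {G : P → M → ℝ}

theorem IsHamiltonianFlow.leftComp_smooth (hψ : IsHamiltonianFlow Ω ψ k) (hθ : ContDiff ℝ ∞ θ)
    [T2Space M] (hg : IsSmoothFamily S g) : IsSmoothFamily S (leftComp ψ θ g) where
  smooth := by
    have h1 : ContMDiff (𝓘(ℝ, P).prod (𝓡 (2 * n))) 𝓘(ℝ, ℝ) ∞ (fun q : P × M => θ q.1) :=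
      hθ.contMDiff.comp contMDiff_fst
    exact hψ.smooth.comp_contMDiffOn (h1.contMDiffOn.prodMk hg.smooth)
  compact_support := by
    obtain ⟨K, hK, hKg⟩ := hg.compact_support
    obtain ⟨L, hL, hLψ⟩ := hψ.compact_support
    refine ⟨K ∪ L, hK.union hL, fun p hp => closure_minimal (fun x hx => ?_)
      (hK.union hL).isClosed⟩
    by_contra hn
    rw [Set.mem_union, not_or] at hn
    have h1 : g p x = x := by
      by_contra h
      exact hn.1 (hKg p hp (subset_closure h))
    have h2 : ψ (θ p) x = x := by
      by_contra h
      exact hn.2 (hLψ _ (subset_closure h))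
    exact hx (by change ψ (θ p) (g p x) = x; rw [h1, h2])

variable [IsManifold (𝓡 (2 * n)) ∞ M] [BorelSpace M] [SecondCountableTopology M]

theorem IsHamiltonianFlow.measurePreserving (hψ : IsHamiltonianFlow Ω ψ k) (τ : ℝ) :
    MeasurePreserving (ψ τ) (canonicalVolume Ω) (canonicalVolume Ω) :=
  measurePreserving_of_isSymplectic (ψ τ) (hψ.isSymplectic τ)
    (by rw [hψ.symm_apply]; exact hψ.isSymplectic (-τ))

theorem IsHamiltonianFlow.leftHamiltonian_normalized [T2Space M] (hψ : IsHamiltonianFlow Ω ψ k)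
    (hθ : ContDiff ℝ ∞ θ) (hη : ContDiff ℝ ∞ η) (hG : IsNormalizedHamiltonian Ω S G) :
    IsNormalizedHamiltonian Ω S (leftHamiltonian ψ k θ η G) where
  smooth := by
    have h1 : ContMDiff (𝓘(ℝ, P).prod (𝓡 (2 * n))) 𝓘(ℝ, ℝ) ∞ (fun q : P × M => θ q.1) :=
      hθ.contMDiff.comp contMDiff_fst
    have h2 : ContMDiff (𝓘(ℝ, P).prod (𝓡 (2 * n))) 𝓘(ℝ, ℝ) ∞ (fun q : P × M => η q.1) :=
      hη.contMDiff.comp contMDiff_fst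
    have h3 : ContMDiff (𝓘(ℝ, P).prod (𝓡 (2 * n))) 𝓘(ℝ, ℝ) ∞ (fun q : P × M => -θ q.1) :=
      hθ.neg.contMDiff.comp contMDiff_fst
    have hk : ContMDiff (𝓘(ℝ, ℝ).prod (𝓡 (2 * n))) 𝓘(ℝ, ℝ) ∞ (fun q : ℝ × M => k q.1 q.2) := by
      rw [← contMDiffOn_univ, ← Set.univ_prod_univ]
      exact hψ.normalized.smooth
    have h4 : ContMDiff (𝓘(ℝ, P).prod (𝓡 (2 * n))) 𝓘(ℝ, ℝ) ∞
        (fun q : P × M => k (θ q.1) q.2) := hk.comp (h1.prodMk contMDiff_snd)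
    have h5 : ContMDiff (𝓘(ℝ, P).prod (𝓡 (2 * n))) (𝓡 (2 * n)) ∞
        (fun q : P × M => ψ (-θ q.1) q.2) := hψ.smooth.comp (h3.prodMk contMDiff_snd)
    have h6 : ContMDiffOn (𝓘(ℝ, P).prod (𝓡 (2 * n))) 𝓘(ℝ, ℝ) ∞
        (fun q : P × M => G q.1 (ψ (-θ q.1) q.2)) (S ×ˢ Set.univ) :=
      hG.smooth.comp (contMDiff_fst.prodMk h5).contMDiffOn fun q hq => ⟨hq.1, trivial⟩
    exact (h2.mul h4).contMDiffOn.add h6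
  mean_zero := by
    intro hM p hp
    have hfin : IsFiniteMeasure (canonicalVolume Ω) := isFiniteMeasure_canonicalVolume
    have hint : ∀ f : M → ℝ, Continuous f → Integrable f (canonicalVolume Ω) := fun f hf =>
      hf.integrable_of_hasCompactSupport (HasCompactSupport.of_compactSpace f)
    have hkc : Continuous (k (θ p)) :=
      (family_contMDiff hψ.normalized.smooth (Set.mem_univ _)).continuous
    have hGc : Continuous (G p) := (family_contMDiff hG.smooth hp).continuous
    have e1 : ∫ x, G p (ψ (-θ p) x) ∂(canonicalVolume Ω) = ∫ x, G p x ∂(canonicalVolume Ω) :=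
      (hψ.measurePreserving (-θ p)).integral_comp
        (ψ (-θ p)).toHomeomorph.measurableEmbedding (G p)
    change ∫ x, (η p * k (θ p) x + G p (ψ (-θ p) x)) ∂(canonicalVolume Ω) = 0
    rw [integral_add (hint (fun x => η p * k (θ p) x) (continuous_const.mul hkc))
      (hint (fun x => G p (ψ (-θ p) x)) (hGc.comp (ψ _).continuous)),
      integral_const_mul, e1, hG.mean_zero hM p hp, hψ.normalized.mean_zero hM _ trivial]
    simp
  compact_support := by
    intro hM
    obtain ⟨K, hK, hKG⟩ := hG.compact_support hM
    obtain ⟨L, hL, hLk⟩ := hψ.normalized.compact_support hM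
    obtain ⟨L', hL', hLψ⟩ := hψ.compact_support
    have hc := (hK.union hL).union hL'
    refine ⟨_, hc, fun p hp => closure_minimal (fun x hx => ?_) hc.isClosed⟩
    by_contra hn
    rw [Set.mem_union, Set.mem_union, not_or, not_or] at hn
    have h1 : ψ (-θ p) x = x := by
      by_contra h
      exact hn.2 (hLψ _ (subset_closure h))
    have h2 : G p x = 0 := image_eq_zero_of_notMem_tsupport fun h => hn.1.1 (hKG p hp h)
    have h3 : k (θ p) x = 0 :=
      image_eq_zero_of_notMem_tsupport fun h => hn.1.2 (hLk _ trivial h)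
    exact hx (by change η p * k (θ p) x + G p (ψ (-θ p) x) = 0; rw [h1, h2, h3]; ring)

end

/-! ### The generator of a composition -/

section

variable {n : ℕ} {M : Type*} [TopologicalSpace M] [ChartedSpace (Model n) M]
  [MeasurableSpace M] {Ω : SymplecticForm n M}
  {ψ : ℝ → M ≃ₘ⟮𝓡 (2 * n), 𝓡 (2 * n)⟯ M} {k : ℝ → M → ℝ}
  {a b : ℝ}

omit [MeasurableSpace M] in
theorem pushVec_comp {g h : M → M} (hg : ContMDiff (𝓡 (2 * n)) (𝓡 (2 * n)) ∞ g)
    (hh : ContMDiff (𝓡 (2 * n)) (𝓡 (2 * n)) ∞ h) (x : M) (w : Model n) :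
    pushVec (n := n) (g ∘ h) x w = pushVec g (h x) (pushVec h x w) :=
  congrArg (fun A : Model n →L[ℝ] Model n => A w)
    (mfderiv_comp x (hg.mdifferentiable (by simp) (h x)) (hh.mdifferentiable (by simp) x))

theorem IsHamiltonianFlow.pushVec_neg (hψ : IsHamiltonianFlow Ω ψ k) (τ : ℝ) (x : M)
    (w : Model n) : pushVec (ψ τ) (ψ (-τ) x) (pushVec (ψ (-τ)) x w) = w := by
  rw [← pushVec_comp (ψ τ).contMDiff (ψ (-τ)).contMDiff]
  have e : (ψ τ ∘ ψ (-τ) : M → M) = id := funext (hψ.neg' τ)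
  rw [e]
  have h : pushVec (n := n) (id : M → M) x = ContinuousLinearMap.id ℝ (Model n) :=
    (hasMFDerivAt_id (I := 𝓡 (2 * n)) x).mfderiv
  rw [h]
  rfl

omit [MeasurableSpace M] in
/-- The generating field of a path, taken with values in the model space. -/
theorem Generates.exists_field {G : ℝ → M → ℝ} {g : ℝ → M ≃ₘ⟮𝓡 (2 * n), 𝓡 (2 * n)⟯ M}
    (hg : Generates Ω a b G g) : ∃ X : ℝ → M → Model n, ∀ t ∈ Set.Icc a b,
      (∀ (x : M) (w : Model n), formAt Ω x ![X t x, w] = -differential (G t) x w) ∧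
      ∀ x : M, HasMFDerivWithinAt 𝓘(ℝ, ℝ) (𝓡 (2 * n)) (fun s => g s x) (Set.Icc a b) t
        ((1 : ℝ →L[ℝ] ℝ).smulRight (X t (g t x))) := hg

theorem IsHamiltonianFlow.exists_field (hψ : IsHamiltonianFlow Ω ψ k) :
    ∃ Y : ℝ → M → Model n, ∀ τ,
      (∀ (x : M) (w : Model n), formAt Ω x ![Y τ x, w] = -differential (k τ) x w) ∧
      ∀ x : M, HasMFDerivAt 𝓘(ℝ, ℝ) (𝓡 (2 * n)) (fun s => ψ s x) τ
        ((1 : ℝ →L[ℝ] ℝ).smulRight (Y τ (ψ τ x))) := by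
  choose Y hY using hψ.generates
  exact ⟨Y, hY⟩

variable [IsManifold (𝓡 (2 * n)) ∞ M]

/-- The path `ψ_θ ∘ g` has the velocity `η Y + ψ_* X`, where `Y` and `X` are the fields of `ψ` and
`g`. As `ψ` is symplectic, `ψ_* X` is the symplectic gradient of `G ∘ ψ⁻¹`. -/
theorem IsHamiltonianFlow.leftComp_generates (hψ : IsHamiltonianFlow Ω ψ k)
    {θ η : ℝ → ℝ} (hθ : ∀ t, HasDerivAt θ (η t) t)
    {g : ℝ → M ≃ₘ⟮𝓡 (2 * n), 𝓡 (2 * n)⟯ M} {G : ℝ → M → ℝ}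
    (hG : ∀ t ∈ Set.Icc a b, ContMDiff (𝓡 (2 * n)) 𝓘(ℝ, ℝ) ∞ (G t))
    (hg : Generates Ω a b G g) :
    Generates Ω a b (leftHamiltonian ψ k θ η G) (leftComp ψ θ g) := by
  obtain ⟨X, hX⟩ := hg.exists_field
  obtain ⟨Y, hY⟩ := hψ.exists_field
  have hk : ∀ τ, ContMDiff (𝓡 (2 * n)) 𝓘(ℝ, ℝ) ∞ (k τ) := fun τ =>
    family_contMDiff hψ.normalized.smooth (Set.mem_univ τ)
  let X' : ℝ → M → Model n := fun t x => η t • Y (θ t) x +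
    pushVec (ψ (θ t)) (ψ (-θ t) x) (X t (ψ (-θ t) x))
  have hXX : ∀ t ∈ Set.Icc a b, (∀ (x : M) (w : Model n), formAt Ω x ![X' t x, w] =
      -differential (leftHamiltonian ψ k θ η G t) x w) ∧
      ∀ x : M, HasMFDerivWithinAt 𝓘(ℝ, ℝ) (𝓡 (2 * n)) (fun s => leftComp ψ θ g s x)
        (Set.Icc a b) t ((1 : ℝ →L[ℝ] ℝ).smulRight (X' t (leftComp ψ θ g t x))) := by
    refine fun t ht => ⟨fun x w => ?_, fun x => ?_⟩
    · have hd : differential (leftHamiltonian ψ k θ η G t) x w = η t * differential (k (θ t)) x w +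
          differential (G t) (ψ (-θ t) x) (pushVec (ψ (-θ t)) x w) := by
        have e1 := ((hk (θ t)).mdifferentiable (by simp) x).hasMFDerivAt
        have e2 := HasMFDerivAt.comp x
          ((hG t ht).mdifferentiable (by simp) (ψ (-θ t) x)).hasMFDerivAt
          ((ψ (-θ t)).contMDiff.mdifferentiable (by simp) x).hasMFDerivAt
        have e3 := (e1.const_smul (η t)).add e2
        exact congrArg (fun A : Model n →L[ℝ] ℝ => A w) e3.mfderiv
      have h1 : formAt Ω x ![Y (θ t) x, w] = -differential (k (θ t)) x w := (hY (θ t)).1 x w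
      have h2 : formAt Ω x ![pushVec (ψ (θ t)) (ψ (-θ t) x) (X t (ψ (-θ t) x)), w] =
          -differential (G t) (ψ (-θ t) x) (pushVec (ψ (-θ t)) x w) := by
        have h3 := hψ.isSymplectic (θ t) (ψ (-θ t) x) (X t (ψ (-θ t) x)) (pushVec (ψ (-θ t)) x w)
        rw [hψ.pushVec_neg, hψ.neg'] at h3
        exact h3.trans ((hX t ht).1 _ _)
      have h4 : formAt Ω x ![X' t x, w] = η t * formAt Ω x ![Y (θ t) x, w] +
          formAt Ω x ![pushVec (ψ (θ t)) (ψ (-θ t) x) (X t (ψ (-θ t) x)), w] := by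
        have h5 : bilinOfForm (Model n) (formAt Ω x) (X' t x) =
            η t • bilinOfForm (Model n) (formAt Ω x) (Y (θ t) x) +
            bilinOfForm (Model n) (formAt Ω x)
              (pushVec (ψ (θ t)) (ψ (-θ t) x) (X t (ψ (-θ t) x))) := by
          rw [← map_smul, ← map_add]
        exact congrArg (fun A : Model n →L[ℝ] ℝ => A w) h5
      rw [h4, h1, h2, hd]
      ring
    · have e1 : MDifferentiableAt (𝓘(ℝ, ℝ).prod (𝓡 (2 * n))) (𝓡 (2 * n))
          (fun q : ℝ × M => ψ q.1 q.2) (θ t, g t x) := hψ.smooth.mdifferentiable (by simp) _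
      have e2 := HasMFDerivWithinAt.prodMk
        ((hθ t).hasFDerivAt.hasMFDerivAt.hasMFDerivWithinAt (s := Set.Icc a b)) ((hX t ht).2 x)
      have e3 := HasMFDerivAt.comp_hasMFDerivWithinAt t e1.hasMFDerivAt e2
      refine e3.congr_mfderiv ?_
      refine ContinuousLinearMap.ext fun (s : ℝ) => ?_
      have e4 := mfderiv_prod_eq_add_apply (v := (s • η t, s • X t (g t x))) e1
      refine e4.trans ?_
      let A : ℝ →L[ℝ] Model n := mfderiv 𝓘(ℝ, ℝ) (𝓡 (2 * n)) (fun s => ψ s (g t x)) (θ t)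
      have e5 : A (s • η t) = (s • η t) • Y (θ t) (ψ (θ t) (g t x)) :=
        congrArg (fun A : ℝ →L[ℝ] Model n => A (s • η t)) ((hY (θ t)).2 (g t x)).mfderiv
      have e6 : ψ (-θ t) (ψ (θ t) (g t x)) = g t x := hψ.neg _ _
      change A (s • η t) + pushVec (ψ (θ t)) (g t x) (s • X t (g t x)) =
          s • (η t • Y (θ t) (ψ (θ t) (g t x)) + pushVec (ψ (θ t))
            (ψ (-θ t) (ψ (θ t) (g t x))) (X t (ψ (-θ t) (ψ (θ t) (g t x)))))
      rw [e5, e6, map_smul, smul_add, smul_assoc]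
  exact ⟨X', hXX⟩

/-- The Hamiltonian group is stable under composition with the flow. -/
theorem IsHamiltonianFlow.trans_mem_Ham [BorelSpace M] [SecondCountableTopology M] [T2Space M]
    (hψ : IsHamiltonianFlow Ω ψ k) (τ : ℝ) {φ : M ≃ₘ⟮𝓡 (2 * n), 𝓡 (2 * n)⟯ M} (hφ : φ ∈ Ham Ω) :
    φ.trans (ψ τ) ∈ Ham Ω := by
  obtain ⟨F, f, hF, hf, hgen, h0, h1⟩ := hφ
  have hθ : ContDiff ℝ ∞ (fun s : ℝ => s * τ) := contDiff_id.mul contDiff_const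
  refine ⟨leftHamiltonian ψ k (fun s => s * τ) (fun _ => τ) F, leftComp ψ (fun s => s * τ) f,
    hψ.leftHamiltonian_normalized hθ contDiff_const hF, hψ.leftComp_smooth hθ hf,
    hψ.leftComp_generates (fun t => by simpa using (hasDerivAt_id t).mul_const τ)
      (fun t ht => family_contMDiff hF.smooth ht) hgen, ?_, ?_⟩
  · refine Diffeomorph.ext fun x => ?_
    change ψ (0 * τ) (f 0 x) = x
    rw [zero_mul, hψ.zero, h0]
    rfl
  · refine Diffeomorph.ext fun x => ?_
    change ψ (1 * τ) (f 1 x) = ψ τ (φ x)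
    rw [one_mul, h1]

end

/-! ### The oscillation of continuous functions -/

section

theorem osc_le {X : Type*} [Nonempty X] {f : X → ℝ} {c : ℝ} (h : ∀ x y, f x - f y ≤ c) :
    osc f ≤ c := by
  have h1 : ⨆ x, f x ≤ c + ⨅ y, f y := by
    refine ciSup_le fun x => ?_
    have : f x - c ≤ ⨅ y, f y := le_ciInf fun y => by linarith [h x y]
    linarith
  rw [osc]
  linarith

theorem osc_comp_equiv {X Y : Type*} (e : X ≃ Y) (f : Y → ℝ) : osc (fun x => f (e x)) = osc f := by
  rw [osc, osc, e.iSup_comp (g := f), e.iInf_comp (g := f)]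

section

variable {Z : Type*} [TopologicalSpace Z] [CompactSpace Z] [Nonempty Z]

omit [Nonempty Z] in
theorem sub_le_osc (f : C(Z, ℝ)) (x y : Z) : f x - f y ≤ osc f := by
  have h1 : f x ≤ ⨆ x, f x := le_ciSup (isCompact_range f.continuous).bddAbove x
  have h2 : ⨅ x, f x ≤ f y := ciInf_le (isCompact_range f.continuous).bddBelow y
  rw [osc]
  linarith

theorem exists_osc_eq (f : C(Z, ℝ)) :
    ∃ x y, (∀ z, f z ≤ f x) ∧ (∀ z, f y ≤ f z) ∧ osc f = f x - f y := by
  obtain ⟨x, -, hx⟩ := isCompact_univ.exists_isMaxOn Set.univ_nonempty f.continuous.continuousOn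
  obtain ⟨y, -, hy⟩ := isCompact_univ.exists_isMinOn Set.univ_nonempty f.continuous.continuousOn
  have hx' : ∀ z, f z ≤ f x := fun z => hx (Set.mem_univ z)
  have hy' : ∀ z, f y ≤ f z := fun z => hy (Set.mem_univ z)
  exact ⟨x, y, hx', hy', le_antisymm (osc_le fun z w => by linarith [hx' z, hy' w])
    (sub_le_osc f x y)⟩

theorem osc_le_add (f g : C(Z, ℝ)) : osc f ≤ osc g + 2 * ‖f - g‖ := by
  refine osc_le fun x y => ?_
  have h1 := sub_le_osc g x y
  have h2 := abs_le.1 ((f - g).norm_coe_le_norm x)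
  have h3 := abs_le.1 ((f - g).norm_coe_le_norm y)
  simp only [ContinuousMap.sub_apply] at h2 h3
  linarith [h2.2, h3.1]

theorem continuous_osc : Continuous fun f : C(Z, ℝ) => osc f := by
  refine (LipschitzWith.of_le_add_mul 2 fun f g => ?_).continuous
  rw [dist_eq_norm]
  exact_mod_cast osc_le_add f g

/-- A convex combination of functions has at most the convex combination of the oscillations. -/
theorem osc_sum_le {ι : Type*} (s : Finset ι) (w : ι → ℝ) (hw : ∀ i ∈ s, 0 ≤ w i) (f : ι → C(Z, ℝ)) :
    osc ⇑(∑ i ∈ s, w i • f i) ≤ ∑ i ∈ s, w i * osc (f i) := by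
  refine osc_le fun x y => ?_
  simp only [ContinuousMap.coe_sum, Finset.sum_apply, ContinuousMap.smul_apply, smul_eq_mul]
  rw [← Finset.sum_sub_distrib]
  refine Finset.sum_le_sum fun i hi => ?_
  rw [← mul_sub]
  exact mul_le_mul_of_nonneg_left (sub_le_osc (f i) x y) (hw i hi)

theorem osc_add_const (f : C(Z, ℝ)) (c : ℝ) : osc ⇑(f + ContinuousMap.const Z c) = osc f := by
  refine le_antisymm (osc_le fun x y => ?_) (osc_le fun x y => ?_)
  · simpa using sub_le_osc f x y
  · simpa using sub_le_osc (f + ContinuousMap.const Z c) x y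

/-- If `h` is smaller at the maxima of `F₀` than at its minima, adding a small positive multiple of
`h` to a function near `F₀` decreases the oscillation at a definite rate. -/
theorem exists_osc_add_smul_le (F₀ h : C(Z, ℝ))
    (hh : ∀ x y, (∀ z, F₀ z ≤ F₀ x) → (∀ z, F₀ y ≤ F₀ z) → h x < h y) :
    ∃ κ > 0, ∃ r > 0, ∃ e₀ > 0, ∀ F : C(Z, ℝ), ‖F - F₀‖ ≤ r → ∀ e, 0 ≤ e → e ≤ e₀ →
      osc ⇑(F + e • h) ≤ osc F - κ * e := by
  obtain ⟨xM, ym, hxM, hym, -⟩ := exists_osc_eq F₀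
  -- the sets of maxima and minima are compact, so `h` is separated on them
  have hA : IsCompact {x | F₀ x = F₀ xM} := (isClosed_eq F₀.continuous continuous_const).isCompact
  have hB : IsCompact {x | F₀ x = F₀ ym} := (isClosed_eq F₀.continuous continuous_const).isCompact
  obtain ⟨x₁, hx₁, hx₁'⟩ := hA.exists_isMaxOn ⟨xM, rfl⟩ h.continuous.continuousOn
  obtain ⟨y₁, hy₁, hy₁'⟩ := hB.exists_isMinOn ⟨ym, rfl⟩ h.continuous.continuousOn
  have hlt : h x₁ < h y₁ := hh x₁ y₁ (fun z => (hxM z).trans_eq hx₁.symm)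
    fun z => (le_of_eq hy₁).trans (hym z)
  obtain ⟨α, hα1, hα2⟩ := exists_between hlt
  obtain ⟨β, hβ1, hβ2⟩ := exists_between hα2
  -- where `α ≤ h` there is no maximum of `F₀`, and where `h ≤ β` no minimum, so `F₀` keeps a
  -- positive distance `γ` from its extreme values there
  have gap : ∀ (f : C(Z, ℝ)) (W : Set Z), IsClosed W → (∀ z ∈ W, 0 < f z) →
      ∃ γ > 0, ∀ z ∈ W, γ ≤ f z := by
    intro f W hW hpos
    rcases W.eq_empty_or_nonempty with rfl | hne
    · exact ⟨1, one_pos, by simp⟩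
    · obtain ⟨z, hz, hz'⟩ := hW.isCompact.exists_isMinOn hne f.continuous.continuousOn
      exact ⟨f z, hpos z hz, fun w hw => hz' hw⟩
  obtain ⟨γ₁, hγ₁, hg₁⟩ := gap (ContinuousMap.const Z (F₀ xM) - F₀) {z | α ≤ h z}
    (isClosed_le continuous_const h.continuous) (by
      intro z hz
      simp only [ContinuousMap.sub_apply, ContinuousMap.const_apply, sub_pos]
      refine lt_of_le_of_ne (hxM z) fun heq => ?_
      have : h z ≤ h x₁ := hx₁' heq
      exact absurd (lt_of_lt_of_le hα1 hz) (not_lt.2 this))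
  obtain ⟨γ₂, hγ₂, hg₂⟩ := gap (F₀ - ContinuousMap.const Z (F₀ ym)) {z | h z ≤ β}
    (isClosed_le h.continuous continuous_const) (by
      intro z hz
      simp only [ContinuousMap.sub_apply, ContinuousMap.const_apply, sub_pos]
      refine lt_of_le_of_ne (hym z) fun heq => ?_
      have : h y₁ ≤ h z := hy₁' heq.symm
      exact absurd (lt_of_le_of_lt hz hβ2) (not_lt.2 this))
  simp only [ContinuousMap.sub_apply, ContinuousMap.const_apply] at hg₁ hg₂
  set γ := min γ₁ γ₂ with hγ
  have hγpos : 0 < γ := lt_min hγ₁ hγ₂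
  set N := ‖h‖ + |α| + |β| + 1 with hN
  have hNpos : 0 < N := by positivity
  refine ⟨β - α, sub_pos.2 hβ1, γ / 4, by positivity, γ / (2 * N), by positivity, ?_⟩
  intro F hF e he he'
  have heN : e * N ≤ γ / 2 := by
    calc e * N ≤ γ / (2 * N) * N := by gcongr
      _ = γ / 2 := by field_simp
  have hclose : ∀ z, |F z - F₀ z| ≤ γ / 4 := fun z => ((F - F₀).norm_coe_le_norm z).trans hF
  have hhz : ∀ z, |h z| ≤ ‖h‖ := fun z => h.norm_coe_le_norm z
  obtain ⟨x, y, hx, hy, hxy⟩ := exists_osc_eq F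
  -- a point with `α ≤ h` cannot catch up with the maximum while `e N ≤ γ / 2`
  have hup : ∀ z, F z + e * h z ≤ F x + e * α := by
    intro z
    by_cases hz : α ≤ h z
    · have h1 := hg₁ z hz
      have h2 := abs_le.1 (hclose z)
      have h3 := abs_le.1 (hclose xM)
      have h4 := hx xM
      have h5 : γ ≤ γ₁ := min_le_left _ _
      have h6 : e * (h z - α) ≤ e * N := by
        refine mul_le_mul_of_nonneg_left ?_ he
        have := abs_le.1 (hhz z)
        have := neg_abs_le α
        have := abs_nonneg β
        linarith
      linarith [h2.2, h3.1]
    · have : e * h z ≤ e * α := mul_le_mul_of_nonneg_left (not_le.1 hz).le he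
      linarith [hx z]
  have hlo : ∀ z, F y + e * β ≤ F z + e * h z := by
    intro z
    by_cases hz : h z ≤ β
    · have h1 := hg₂ z hz
      have h2 := abs_le.1 (hclose z)
      have h3 := abs_le.1 (hclose ym)
      have h4 := hy ym
      have h5 : γ ≤ γ₂ := min_le_right _ _
      have h6 : e * (β - h z) ≤ e * N := by
        refine mul_le_mul_of_nonneg_left ?_ he
        have := abs_le.1 (hhz z)
        have := le_abs_self β
        have := abs_nonneg α
        linarith
      linarith [h2.1, h3.2]
    · have : e * β ≤ e * h z := mul_le_mul_of_nonneg_left (not_le.1 hz).le he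
      linarith [hy z]
  refine osc_le fun z w => ?_
  change F z + e * h z - (F w + e * h w) ≤ _
  linarith [hup z, hlo w]

end
end

/-! ### Decreasing the length to first order -/

section

/-- A smooth monotone transition from `0` to `1` whose derivative is supported near `t₀`. -/
theorem exists_transition {a b : ℝ} (hab : a < b) {t₀ : ℝ} (ht₀ : t₀ ∈ Set.Icc a b) {δ : ℝ}
    (hδ : 0 < δ) : ∃ χ : ℝ → ℝ, ContDiff ℝ ∞ χ ∧ χ a = 0 ∧ χ b = 1 ∧ (∀ t, 0 ≤ deriv χ t) ∧
      ∀ t, deriv χ t ≠ 0 → |t - t₀| ≤ δ := by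
  obtain ⟨s, d, hd, hs1, hs2, hs3, hs4⟩ : ∃ s d : ℝ, 0 < d ∧ a ≤ s ∧ s + d ≤ b ∧ t₀ - δ ≤ s ∧
      s + d ≤ t₀ + δ := by
    rcases le_total t₀ ((a + b) / 2) with h | h
    · refine ⟨t₀, min δ ((b - a) / 2), lt_min hδ (by linarith), ht₀.1, ?_, by linarith, ?_⟩
      · linarith [min_le_right δ ((b - a) / 2)]
      · linarith [min_le_left δ ((b - a) / 2)]
    · refine ⟨t₀ - min δ ((b - a) / 2), min δ ((b - a) / 2), lt_min hδ (by linarith), ?_, ?_, ?_, ?_⟩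
      · linarith [min_le_right δ ((b - a) / 2)]
      · linarith [ht₀.2]
      · linarith [min_le_left δ ((b - a) / 2)]
      · linarith
  have hmono : Monotone fun t => Real.smoothTransition ((t - s) / d) := fun x y hxy =>
    Real.smoothTransition.monotone (by gcongr)
  refine ⟨fun t => Real.smoothTransition ((t - s) / d), ?_, ?_, ?_, fun t => hmono.deriv_nonneg, ?_⟩
  · exact Real.smoothTransition.contDiff.comp ((contDiff_id.sub contDiff_const).div_const d)
  · exact Real.smoothTransition.zero_of_nonpos (div_nonpos_of_nonpos_of_nonneg (by linarith) hd.le)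
  · exact Real.smoothTransition.one_of_one_le ((one_le_div hd).2 (by linarith))
  · intro t ht
    by_contra hfar
    apply ht
    rw [not_le, lt_abs] at hfar
    rcases hfar with h | h
    · have e : (fun t => Real.smoothTransition ((t - s) / d)) =ᶠ[nhds t] fun _ => 1 := by
        filter_upwards [lt_mem_nhds (show s + d < t by linarith)] with z hz
        exact Real.smoothTransition.one_of_one_le ((one_le_div hd).2 (by linarith))
      rw [e.deriv_eq, deriv_const]
    · have e : (fun t => Real.smoothTransition ((t - s) / d)) =ᶠ[nhds t] fun _ => 0 := by
        filter_upwards [gt_mem_nhds (show t < s by linarith)] with z hz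
        exact Real.smoothTransition.zero_of_nonpos
          (div_nonpos_of_nonpos_of_nonneg (by linarith) hd.le)
      rw [e.deriv_eq, deriv_const]

variable {Z : Type*} [TopologicalSpace Z] [CompactSpace Z] [Nonempty Z]

/-- Suitable time-dependent combinations of the functions `h i` decrease the length to first order:
the weight `χ i'` of `h i` has integral `1` and is supported near the time `t i`, where adding a
multiple of `h i` decreases the oscillation. -/
theorem exists_length_decrease {a b : ℝ} (hab : a < b) {F : ℝ → C(Z, ℝ)} (hF : Continuous F)
    {ι : Type*} [Fintype ι] [Nonempty ι] (t : ι → ℝ) (ht : ∀ i, t i ∈ Set.Icc a b) (h : ι → C(Z, ℝ))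
    (hh : ∀ i x y, (∀ z, F (t i) z ≤ F (t i) x) → (∀ z, F (t i) y ≤ F (t i) z) → h i x < h i y) :
    ∃ χ : ι → ℝ → ℝ, (∀ i, ContDiff ℝ ∞ (χ i)) ∧ (∀ i, χ i a = 0) ∧ (∀ i, χ i b = 1) ∧
      ∃ κ > 0, ∃ e₀ > 0, ∀ e, 0 ≤ e → e ≤ e₀ →
        ∫ s in a..b, osc ⇑(F s + e • ∑ i, deriv (χ i) s • h i) ≤
          (∫ s in a..b, osc (F s)) - κ * e := by
  choose κ hκ r hr c hc hosc using fun i => exists_osc_add_smul_le (F (t i)) (h i) (hh i)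
  have hδ : ∀ i, ∃ δ > 0, ∀ s, |s - t i| ≤ δ → ‖F s - F (t i)‖ ≤ r i := by
    intro i
    obtain ⟨δ, hδ, hδ'⟩ := Metric.continuousAt_iff.1 hF.continuousAt (r i) (hr i)
    refine ⟨δ / 2, by positivity, fun s hs => ?_⟩
    rw [← dist_eq_norm]
    exact (hδ' (lt_of_le_of_lt (by rwa [Real.dist_eq]) (half_lt_self hδ))).le
  choose δ hδ hFδ using hδ
  choose χ hχ hχa hχb hχd hχs using fun i => exists_transition hab (ht i) (hδ i)
  have hdc : ∀ i, Continuous (deriv (χ i)) := fun i => (hχ i).continuous_deriv (by simp)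
  -- bounds for the weights
  have hB : ∀ i, ∃ B > 0, ∀ s ∈ Set.Icc a b, deriv (χ i) s ≤ B := by
    intro i
    obtain ⟨B, hB⟩ := (isCompact_Icc.image (hdc i)).bddAbove
    exact ⟨max B 1, by positivity, fun s hs => (hB ⟨s, hs, rfl⟩).trans (le_max_left _ _)⟩
  choose B hBpos hB using hB
  set N : ℝ := (Fintype.card ι : ℝ) with hN
  have hNpos : 0 < N := Nat.cast_pos.2 Fintype.card_pos
  obtain ⟨i₀, -, hi₀⟩ := Finset.exists_min_image Finset.univ (fun i => c i / (N * B i))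
    Finset.univ_nonempty
  refine ⟨χ, hχ, hχa, hχb, ∑ i, κ i, Finset.sum_pos (fun i _ => hκ i) Finset.univ_nonempty,
    c i₀ / (N * B i₀), div_pos (hc i₀) (mul_pos hNpos (hBpos i₀)), fun e he he' => ?_⟩
  have hpt : ∀ s ∈ Set.Icc a b, osc ⇑(F s + e • ∑ i, deriv (χ i) s • h i) ≤
      osc (F s) - e * ∑ i, κ i * deriv (χ i) s := by
    intro s hs
    -- by convexity of the oscillation, the functions `h i` may be added one at a time
    have e1 : F s + e • ∑ i, deriv (χ i) s • h i =
        ∑ i : ι, N⁻¹ • (F s + (e * N * deriv (χ i) s) • h i) := by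
      simp only [smul_add, Finset.sum_add_distrib, Finset.sum_const, Finset.card_univ, smul_smul]
      congr 1
      · rw [← Nat.cast_smul_eq_nsmul ℝ, smul_smul, mul_inv_cancel₀ hNpos.ne', one_smul]
      · rw [Finset.smul_sum]
        refine Finset.sum_congr rfl fun i _ => ?_
        rw [smul_smul]
        congr 1
        field_simp
    have e2 : ∀ i, osc ⇑(F s + (e * N * deriv (χ i) s) • h i) ≤
        osc (F s) - κ i * (e * N * deriv (χ i) s) := by
      intro i
      by_cases hi : deriv (χ i) s = 0
      · simp [hi]
      · refine hosc i (F s) (hFδ i s (hχs i s hi)) _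
          (mul_nonneg (mul_nonneg he hNpos.le) (hχd i s)) ?_
        calc e * N * deriv (χ i) s ≤ c i / (N * B i) * N * B i := by
              gcongr
              · exact hχd i s
              · have := hc i
                have := hBpos i
                positivity
              · exact he'.trans (hi₀ i (Finset.mem_univ i))
              · exact hB i s hs
          _ = c i := by
              have := (hBpos i).ne'
              field_simp
    rw [e1]
    refine (osc_sum_le _ _ (fun _ _ => by positivity) _).trans ?_
    calc ∑ i : ι, N⁻¹ * osc ⇑(F s + (e * N * deriv (χ i) s) • h i)
        ≤ ∑ i : ι, N⁻¹ * (osc (F s) - κ i * (e * N * deriv (χ i) s)) :=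
          Finset.sum_le_sum fun i _ => mul_le_mul_of_nonneg_left (e2 i) (by positivity)
      _ = ∑ i : ι, (N⁻¹ * osc (F s) - e * (κ i * deriv (χ i) s)) := by
          refine Finset.sum_congr rfl fun i _ => ?_
          field_simp
      _ = _ := by
          rw [Finset.sum_sub_distrib, ← Finset.mul_sum, Finset.sum_const, Finset.card_univ,
            nsmul_eq_mul, ← mul_assoc, ← hN, inv_mul_cancel₀ hNpos.ne', one_mul, ← Finset.mul_sum]
  have hc1 : Continuous fun s => osc (F s) := continuous_osc.comp hF
  have hc2 : Continuous fun s => e * ∑ i, κ i * deriv (χ i) s :=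
    continuous_const.mul (continuous_finsetSum _ fun i _ => continuous_const.mul (hdc i))
  have hc3 : Continuous fun s => osc ⇑(F s + e • ∑ i, deriv (χ i) s • h i) :=
    continuous_osc.comp (hF.add ((continuous_finsetSum Finset.univ fun i _ =>
      (hdc i).smul (continuous_const (y := h i))).const_smul e))
  have hint : ∀ i, ∫ s in a..b, deriv (χ i) s = 1 := by
    intro i
    rw [intervalIntegral.integral_deriv_eq_sub
      (fun s _ => ((hχ i).differentiable (by simp)).differentiableAt) ((hdc i).intervalIntegrable _ _),
      hχa, hχb, sub_zero]
  calc ∫ s in a..b, osc ⇑(F s + e • ∑ i, deriv (χ i) s • h i)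
      ≤ ∫ s in a..b, (osc (F s) - e * ∑ i, κ i * deriv (χ i) s) :=
        intervalIntegral.integral_mono_on hab.le (hc3.intervalIntegrable _ _)
          ((hc1.sub hc2).intervalIntegrable _ _) hpt
    _ = (∫ s in a..b, osc (F s)) - (∑ i, κ i) * e := by
        rw [intervalIntegral.integral_sub (hc1.intervalIntegrable _ _) (hc2.intervalIntegrable _ _),
          intervalIntegral.integral_const_mul, intervalIntegral.integral_finsetSum
            (f := fun i s => κ i * deriv (χ i) s)
            (fun i _ => (continuous_const.mul (hdc i)).intervalIntegrable _ _)]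
        simp only [intervalIntegral.integral_const_mul, hint, mul_one]
        ring

end

/-! ### Deformations with a given first variation -/

section

variable {n : ℕ} {M : Type*} [TopologicalSpace M] [ChartedSpace (Model n) M]
  [MeasurableSpace M] {Ω : SymplecticForm n M} {a b : ℝ}

theorem IsNormalizedHamiltonian.exists_compact {P : Type*} [NormedAddCommGroup P] [NormedSpace ℝ P]
    {S : Set P} {F : P → M → ℝ} (hF : IsNormalizedHamiltonian Ω S F) :
    ∃ K : Set M, IsCompact K ∧ ∀ p ∈ S, ∀ x ∉ K, F p x = 0 := by
  by_cases hM : CompactSpace M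
  · exact ⟨Set.univ, isCompact_univ, fun p _ x hx => absurd (Set.mem_univ x) hx⟩
  · obtain ⟨K, hK, hKF⟩ := hF.compact_support hM
    exact ⟨K, hK, fun p hp x hx => image_eq_zero_of_notMem_tsupport fun h => hx (hKF p hp h)⟩

omit [MeasurableSpace M] in
theorem IsSmoothFamily.exists_compact {P : Type*} [NormedAddCommGroup P] [NormedSpace ℝ P]
    {S : Set P} {g : P → M ≃ₘ⟮𝓡 (2 * n), 𝓡 (2 * n)⟯ M} (hg : IsSmoothFamily S g) :
    ∃ K : Set M, IsCompact K ∧ ∀ p ∈ S, ∀ x ∉ K, g p x = x := by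
  obtain ⟨K, hK, hKg⟩ := hg.compact_support
  refine ⟨K, hK, fun p hp x hx => ?_⟩
  by_contra h
  exact hx (hKg p hp (subset_closure h))

/-- A family `g_{t,ε}` of Hamiltonian paths with Hamiltonians `G_{t,ε}`, deforming the path `f` with
Hamiltonian `F`, whose first variation is `A`: in the moving frame,
`G_{t,ε} ∘ g_{t,ε} = F_t ∘ f_t + ε (A_t ∘ f_t + o(1))`. -/
structure IsDeformation (Ω : SymplecticForm n M) (a b : ℝ)
    (f : ℝ → M ≃ₘ⟮𝓡 (2 * n), 𝓡 (2 * n)⟯ M) (F A : ℝ → M → ℝ)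
    (g : ℝ × ℝ → M ≃ₘ⟮𝓡 (2 * n), 𝓡 (2 * n)⟯ M) (G : ℝ × ℝ → M → ℝ) : Prop where
  smooth : IsSmoothFamily (Set.Icc a b ×ˢ Set.Ioo (-1) 1) g
  mem_Ham : ∀ p ∈ Set.Icc a b ×ˢ Set.Ioo (-1 : ℝ) 1, g p ∈ Ham Ω
  center : ∀ t ∈ Set.Icc a b, g (t, 0) = f t
  hamiltonian : IsHamiltonianOfVariation Ω a b 1 G g
  expansion : ∃ (H : ℝ × ℝ → M → ℝ) (K : Set M), IsCompact K ∧
    ContinuousOn (fun q : (ℝ × ℝ) × M => H q.1 q.2)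
      ((Set.Icc a b ×ˢ Set.Ioo (-1) 1) ×ˢ Set.univ) ∧
    (∀ p ∈ Set.Icc a b ×ˢ Set.Ioo (-1 : ℝ) 1, ∀ x,
      G p (g p x) = F p.1 (f p.1 x) + p.2 * H p x) ∧
    (∀ t ∈ Set.Icc a b, ∀ x, H (t, 0) x = A t (f t x)) ∧
    ∀ p ∈ Set.Icc a b ×ˢ Set.Ioo (-1 : ℝ) 1, ∀ x ∉ K, H p x = 0

variable {f : ℝ → M ≃ₘ⟮𝓡 (2 * n), 𝓡 (2 * n)⟯ M} {F A : ℝ → M → ℝ}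
    {g : ℝ × ℝ → M ≃ₘ⟮𝓡 (2 * n), 𝓡 (2 * n)⟯ M} {G : ℝ × ℝ → M → ℝ}

/-- The constant deformation. -/
theorem isDeformation_const (hf : IsHamiltonianPath Ω a b f) (hF : IsHamiltonianOf Ω a b F f) :
    IsDeformation Ω a b f F 0 (fun p => f p.1) (fun p => F p.1) where
  smooth := by
    refine ⟨?_, ?_⟩
    · have h1 : ContMDiff (𝓘(ℝ, ℝ × ℝ).prod (𝓡 (2 * n))) 𝓘(ℝ, ℝ) ∞
          (fun q : (ℝ × ℝ) × M => q.1.1) := contDiff_fst.contMDiff.comp contMDiff_fst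
      exact hf.smooth.smooth.comp (h1.prodMk contMDiff_snd).contMDiffOn
        fun q hq => ⟨hq.1.1, trivial⟩
    · obtain ⟨K, hK, h⟩ := hf.smooth.compact_support
      exact ⟨K, hK, fun p hp => h _ hp.1⟩
  mem_Ham := fun p hp => hf.mem_Ham _ hp.1
  center := fun t _ => rfl
  hamiltonian := by
    refine ⟨⟨?_, fun hM p hp => hF.normalized.mean_zero hM _ hp.1, fun hM => ?_⟩,
      fun ε _ => hF.generates⟩
    · have h1 : ContMDiff (𝓘(ℝ, ℝ × ℝ).prod (𝓡 (2 * n))) 𝓘(ℝ, ℝ) ∞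
          (fun q : (ℝ × ℝ) × M => q.1.1) := contDiff_fst.contMDiff.comp contMDiff_fst
      exact hF.normalized.smooth.comp (h1.prodMk contMDiff_snd).contMDiffOn
        fun q hq => ⟨hq.1.1, trivial⟩
    · obtain ⟨K, hK, h⟩ := hF.normalized.compact_support hM
      exact ⟨K, hK, fun p hp => h _ hp.1⟩
  expansion := ⟨fun _ _ => 0, ∅, isCompact_empty, continuousOn_const, by simp, by simp, by simp⟩

variable [IsManifold (𝓡 (2 * n)) ∞ M] [BorelSpace M] [SecondCountableTopology M] [T2Space M]

/-- Composing a deformation with the flow `ψ` at time `ε χ(t)` adds `χ' k₀` to the first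
variation. -/
theorem IsDeformation.leftComp {ψ : ℝ → M ≃ₘ⟮𝓡 (2 * n), 𝓡 (2 * n)⟯ M} {k : ℝ → M → ℝ}
    (hg : IsDeformation Ω a b f F A g G) (hψ : IsHamiltonianFlow Ω ψ k) {χ : ℝ → ℝ}
    (hχ : ContDiff ℝ ∞ χ) :
    IsDeformation Ω a b f F (fun t x => A t x + deriv χ t * k 0 x)
      (leftComp ψ (fun p => p.2 * χ p.1) g)
      (leftHamiltonian ψ k (fun p => p.2 * χ p.1) (fun p => p.2 * deriv χ p.1) G) := by
  have hθ : ContDiff ℝ ∞ (fun p : ℝ × ℝ => p.2 * χ p.1) := contDiff_snd.mul (hχ.comp contDiff_fst)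
  have hχ' : ContDiff ℝ ∞ (deriv χ) := hχ.deriv'
  have hη : ContDiff ℝ ∞ (fun p : ℝ × ℝ => p.2 * deriv χ p.1) :=
    contDiff_snd.mul (hχ'.comp contDiff_fst)
  have hsm := hψ.leftComp_smooth hθ hg.smooth
  refine ⟨hsm, fun p hp => hψ.trans_mem_Ham _ (hg.mem_Ham p hp), fun t ht => ?_, ⟨?_, ?_⟩, ?_⟩
  · rw [← hg.center t ht]
    refine Diffeomorph.ext fun x => ?_
    change ψ (0 * χ t) (g (t, 0) x) = g (t, 0) x
    rw [zero_mul, hψ.zero]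
  · exact hψ.leftHamiltonian_normalized hθ hη hg.hamiltonian.normalized
  · intro ε hε
    exact hψ.leftComp_generates (θ := fun t => ε * χ t) (η := fun t => ε * deriv χ t)
      (fun t => ((hχ.differentiable (by simp)) t).hasDerivAt.const_mul ε)
      (fun t ht => family_contMDiff hg.hamiltonian.normalized.smooth (p := (t, ε)) ⟨ht, hε⟩)
      (hg.hamiltonian.generates ε hε)
  · obtain ⟨H, K, hK, hHc, hHe, hH0, hHK⟩ := hg.expansion
    obtain ⟨K₁, hK₁, hk₁⟩ := hψ.normalized.exists_compact
    obtain ⟨K₂, hK₂, hk₂⟩ := hsm.exists_compact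
    refine ⟨fun p x => deriv χ p.1 * k (p.2 * χ p.1)
      (Hofer.leftComp ψ (fun p => p.2 * χ p.1) g p x) + H p x, K ∪ K₁ ∪ K₂, (hK.union hK₁).union hK₂,
      ?_, ?_, ?_, ?_⟩
    · refine ContinuousOn.add (ContinuousOn.mul ?_ ?_) hHc
      · exact (hχ'.continuous.comp (continuous_fst.comp continuous_fst)).continuousOn
      · have h1 : Continuous (fun q : ℝ × M => k q.1 q.2) := by
          have := hψ.normalized.smooth.continuousOn
          rwa [Set.univ_prod_univ, continuousOn_univ] at this
        exact h1.comp_continuousOn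
          ((hθ.continuous.comp continuous_fst).continuousOn.prodMk hsm.smooth.continuousOn)
    · intro p hp x
      change p.2 * deriv χ p.1 * k (p.2 * χ p.1) (Hofer.leftComp ψ (fun p => p.2 * χ p.1) g p x) +
        G p (ψ (-(p.2 * χ p.1)) (ψ (p.2 * χ p.1) (g p x))) = _
      rw [hψ.neg, hHe p hp]
      ring
    · intro t ht x
      change deriv χ t * k (0 * χ t) (ψ (0 * χ t) (g (t, 0) x)) + H (t, 0) x = _
      rw [zero_mul, hψ.zero, hg.center t ht, hH0 t ht]
      ring
    · intro p hp x hx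
      rw [Set.mem_union, Set.mem_union, not_or, not_or] at hx
      change deriv χ p.1 * k (p.2 * χ p.1) (Hofer.leftComp ψ (fun p => p.2 * χ p.1) g p x) +
        H p x = 0
      rw [hk₂ p hp x hx.2, hk₁ _ trivial x hx.1.2, hHK p hp x hx.1.1]
      ring

/-- Flows inserted one by one, each compensated by its inverse at the final time, change the first
variation by any combination `∑ (χᵢ' - χ₀ᵢ') kᵢ` and do not change the end points. -/
theorem IsDeformation.exists_word {ι : Type*} {ψ : ι → ℝ → M ≃ₘ⟮𝓡 (2 * n), 𝓡 (2 * n)⟯ M}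
    {k : ι → ℝ → M → ℝ} (hψ : ∀ i, IsHamiltonianFlow Ω (ψ i) (k i)) {χ χ₀ : ι → ℝ → ℝ}
    (hχ : ∀ i, ContDiff ℝ ∞ (χ i)) (hχ₀ : ∀ i, ContDiff ℝ ∞ (χ₀ i)) (ha : ∀ i, χ i a = 0)
    (ha₀ : ∀ i, χ₀ i a = 0) (hb : ∀ i, χ i b = χ₀ i b) (s : Finset ι) :
    ∀ {A : ℝ → M → ℝ} {g : ℝ × ℝ → M ≃ₘ⟮𝓡 (2 * n), 𝓡 (2 * n)⟯ M} {G : ℝ × ℝ → M → ℝ},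
      IsDeformation Ω a b f F A g G →
      ∃ (g' : ℝ × ℝ → M ≃ₘ⟮𝓡 (2 * n), 𝓡 (2 * n)⟯ M) (G' : ℝ × ℝ → M → ℝ),
        IsDeformation Ω a b f F
          (fun t x => A t x + ∑ i ∈ s, (deriv (χ i) t - deriv (χ₀ i) t) * k i 0 x) g' G' ∧
        ∀ ε, g' (a, ε) = g (a, ε) ∧ g' (b, ε) = g (b, ε) := by
  classical
  induction s using Finset.induction_on with
  | empty =>
    intro A g G hg
    exact ⟨g, G, by simpa using hg, fun ε => ⟨rfl, rfl⟩⟩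
  | insert i s his ih =>
    intro A g G hg
    obtain ⟨g', G', hg', hends⟩ := ih (hg.leftComp (hψ i) (hχ i))
    have h := hg'.leftComp (hψ i) (χ := fun t => -χ₀ i t) (hχ₀ i).neg
    refine ⟨Hofer.leftComp (ψ i) (fun p => p.2 * -χ₀ i p.1) g',
      leftHamiltonian (ψ i) (k i) (fun p => p.2 * -χ₀ i p.1)
        (fun p => p.2 * deriv (fun t => -χ₀ i t) p.1) G', ?_, fun ε => ⟨?_, ?_⟩⟩
    · convert h using 3 with t x
      rw [Finset.sum_insert his, deriv.fun_neg]
      ring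
    · refine Diffeomorph.ext fun x => ?_
      change ψ i (ε * -χ₀ i a) (g' (a, ε) x) = _
      rw [(hends ε).1, ha₀, neg_zero, mul_zero, (hψ i).zero]
      change ψ i (ε * χ i a) (g (a, ε) x) = _
      rw [ha, mul_zero, (hψ i).zero]
    · refine Diffeomorph.ext fun x => ?_
      change ψ i (ε * -χ₀ i b) (g' (b, ε) x) = _
      rw [(hends ε).2, ← hb, mul_neg]
      change ψ i (-(ε * χ i b)) (ψ i (ε * χ i b) (g (b, ε) x)) = _
      rw [(hψ i).neg]

omit [IsManifold (𝓡 (2 * n)) ∞ M] [BorelSpace M] [SecondCountableTopology M] [T2Space M] in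
/-- The remainder in the expansion of a deformation is uniformly small. -/
theorem IsDeformation.eventually_close (hg : IsDeformation Ω a b f F A g G) {η : ℝ}
    (hη : 0 < η) : ∀ᶠ ε in nhds (0 : ℝ), ∀ t ∈ Set.Icc a b, ∀ x,
      |G (t, ε) (g (t, ε) x) - (F t (f t x) + ε * A t (f t x))| ≤ η * |ε| := by
  obtain ⟨H, K, hK, hHc, hHe, hH0, hHK⟩ := hg.expansion
  have hmem : ∀ᶠ ε in nhds (0 : ℝ), ε ∈ Set.Ioo (-1 : ℝ) 1 := Ioo_mem_nhds (by norm_num) one_pos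
  have hev : ∀ᶠ ε in nhds (0 : ℝ), ∀ y ∈ (Set.univ : Set (Set.Icc a b)) ×ˢ K,
      |H (y.1, ε) y.2 - H (y.1, 0) y.2| < η := by
    refine (isCompact_univ.prod hK).eventually_forall_of_forall_eventually fun y _ => ?_
    have h0 : (0 : ℝ) ∈ Set.Ioo (-1 : ℝ) 1 := ⟨by norm_num, one_pos⟩
    have hc := hHc (((y.1 : ℝ), (0 : ℝ)), y.2) ⟨⟨y.1.2, h0⟩, trivial⟩
    have hmaps : Filter.Tendsto (fun z : ℝ × (Set.Icc a b × M) => (((z.2.1 : ℝ), z.1), z.2.2))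
        (nhds (0, y)) (nhdsWithin (((y.1 : ℝ), (0 : ℝ)), y.2)
          ((Set.Icc a b ×ˢ Set.Ioo (-1) 1) ×ˢ Set.univ)) := by
      refine tendsto_nhdsWithin_iff.2 ⟨Continuous.tendsto' (by fun_prop) _ _ rfl, ?_⟩
      filter_upwards [continuousAt_fst.eventually hmem] with z hz
      exact ⟨⟨z.2.1.2, hz⟩, trivial⟩
    have hmaps' : Filter.Tendsto (fun z : ℝ × (Set.Icc a b × M) => (((z.2.1 : ℝ), (0 : ℝ)), z.2.2))
        (nhds (0, y)) (nhdsWithin (((y.1 : ℝ), (0 : ℝ)), y.2)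
          ((Set.Icc a b ×ˢ Set.Ioo (-1) 1) ×ˢ Set.univ)) := by
      refine tendsto_nhdsWithin_iff.2 ⟨Continuous.tendsto' (by fun_prop) _ _ rfl, ?_⟩
      exact Filter.Eventually.of_forall fun z => ⟨⟨z.2.1.2, h0⟩, trivial⟩
    have hlim := ((hc.tendsto.comp hmaps).sub (hc.tendsto.comp hmaps')).abs
    rw [sub_self, abs_zero] at hlim
    exact hlim.eventually (gt_mem_nhds hη)
  filter_upwards [hmem, hev] with ε hε hev t ht x
  rw [hHe (t, ε) ⟨ht, hε⟩ x, ← hH0 t ht]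
  have e1 : F t (f t x) + ε * H (t, ε) x - (F t (f t x) + ε * H (t, 0) x) =
      (H (t, ε) x - H (t, 0) x) * ε := by ring
  rw [e1, abs_mul]
  refine mul_le_mul_of_nonneg_right ?_ (abs_nonneg ε)
  by_cases hx : x ∈ K
  · exact (hev (⟨t, ht⟩, x) ⟨trivial, hx⟩).le
  · rw [hHK _ ⟨ht, hε⟩ x hx, hHK (t, 0) ⟨ht, by norm_num, one_pos⟩ x hx]
    simpa using hη.le

end

/-! ### Partitions of unity, normalization and restriction to compact sets -/

section

variable {n : ℕ} {M : Type*} [TopologicalSpace M] [ChartedSpace (Model n) M]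

/-- Finitely many bump functions supported in chart domains sum to `1` on a compact set. -/
theorem exists_finite_partition [IsManifold (𝓡 (2 * n)) ∞ M] [T2Space M]
    [SecondCountableTopology M] {K : Set M} (hK : IsCompact K) :
    ∃ (s : Finset M) (ρ : M → M → ℝ), (∀ c, ContMDiff (𝓡 (2 * n)) 𝓘(ℝ, ℝ) ∞ (ρ c)) ∧
      (∀ c, tsupport (ρ c) ⊆ (extChartAt (𝓡 (2 * n)) c).source) ∧ ∀ x ∈ K, ∑ c ∈ s, ρ c x = 1 := by
  have hl : LocallyCompactSpace M := ChartedSpace.locallyCompactSpace (Model n) M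
  obtain ⟨ρ, hρ⟩ := SmoothPartitionOfUnity.exists_isSubordinate (𝓡 (2 * n)) hK.isClosed
    (fun c : M => (extChartAt (𝓡 (2 * n)) c).source) (fun c => isOpen_extChartAt_source c)
    (fun x _ => Set.mem_iUnion.2 ⟨x, mem_extChartAt_source x⟩)
  have hfin := ρ.locallyFinite.finite_nonempty_inter_compact hK
  refine ⟨hfin.toFinset, fun c => ρ c, fun c => (ρ c).contMDiff, hρ, fun x hx => ?_⟩
  rw [← ρ.sum_eq_one hx, finsum_eq_sum_of_support_subset]
  intro c hc
  simp only [Set.Finite.coe_toFinset, Set.mem_ofPred_eq]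
  exact ⟨x, hc, hx⟩

/-- A function on `M` can be normalized by subtracting a constant. -/
theorem exists_normalization [IsManifold (𝓡 (2 * n)) ∞ M] [MeasurableSpace M] [BorelSpace M]
    (Ω : SymplecticForm n M) (h : M → ℝ) :
    ∃ m : ℝ, (CompactSpace M → ∫ x, (h x - m) ∂(canonicalVolume Ω) = 0) ∧
      (¬ CompactSpace M → m = 0) := by
  by_cases hM : CompactSpace M
  · have hfin : IsFiniteMeasure (canonicalVolume Ω) := isFiniteMeasure_canonicalVolume
    refine ⟨⨍ x, h x ∂(canonicalVolume Ω), fun _ => ?_, fun h => absurd hM h⟩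
    exact integral_sub_average _ _
  · exact ⟨0, fun h => absurd h hM, fun _ => rfl⟩

omit [ChartedSpace (Model n) M] in
/-- A continuous family of functions on `M`, restricted to a compact set, as a path of continuous
functions. -/
theorem exists_curve {a b : ℝ} (hab : a ≤ b) {Z : Set M} {F : ℝ → M → ℝ}
    (hF : ContinuousOn (fun q : ℝ × M => F q.1 q.2) (Set.Icc a b ×ˢ Set.univ)) :
    ∃ F' : ℝ → C(Z, ℝ), Continuous F' ∧ ∀ t ∈ Set.Icc a b, ∀ z : Z, F' t z = F t z := by
  have hc : Continuous fun q : ℝ × Z => F (Set.projIcc a b hab q.1) q.2 :=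
    hF.comp_continuous (f := fun q : ℝ × Z => ((Set.projIcc a b hab q.1 : ℝ), (q.2 : M)))
      ((continuous_subtype_val.comp (continuous_projIcc.comp continuous_fst)).prodMk
        (continuous_subtype_val.comp continuous_snd)) fun q => ⟨(Set.projIcc a b hab q.1).2, trivial⟩
  refine ⟨fun t => (ContinuousMap.curry ⟨_, hc⟩) t, (ContinuousMap.curry ⟨_, hc⟩).continuous,
    fun t ht z => ?_⟩
  change F (Set.projIcc a b hab t) z = F t z
  rw [Set.projIcc_of_mem hab ht]

omit [TopologicalSpace M] [ChartedSpace (Model n) M] in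
theorem osc_eq_of_attained {Z : Set M} {u : M → ℝ} (h : ∀ x, ∃ z ∈ Z, u z = u x) :
    osc u = osc fun z : Z => u z := by
  have hr : Set.range u = Set.range fun z : Z => u z := by
    ext r
    constructor
    · rintro ⟨x, rfl⟩
      obtain ⟨z, hz, hzx⟩ := h x
      exact ⟨⟨z, hz⟩, hzx⟩
    · rintro ⟨z, rfl⟩
      exact ⟨z, rfl⟩
  simp only [osc, iSup, iInf, hr]

omit [TopologicalSpace M] [ChartedSpace (Model n) M] in
/-- A point outside `K`, if there is one. Added to `K`, it represents the value outside `K` of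
functions that are constant there. -/
theorem exists_base_point [Nonempty M] (K : Set M) : ∃ p, ∀ x ∉ K, p ∉ K := by
  by_cases h : ∃ x, x ∉ K
  · obtain ⟨p, hp⟩ := h
    exact ⟨p, fun _ _ => hp⟩
  · exact ⟨Classical.arbitrary M, fun x hx => absurd ⟨x, hx⟩ h⟩

omit [TopologicalSpace M] [ChartedSpace (Model n) M] in
theorem exists_mem_insert_eq {K : Set M} {p : M} (hp : ∀ x ∉ K, p ∉ K) {u : M → ℝ}
    (hu : ∀ x ∉ K, ∀ y ∉ K, u x = u y) (x : M) : ∃ z ∈ insert p K, u z = u x := by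
  by_cases hx : x ∈ K
  · exact ⟨x, Set.mem_insert_of_mem p hx, rfl⟩
  · exact ⟨p, Set.mem_insert p K, hu p (hp x hx) x hx⟩

/-- A function whose differential vanishes in all charts is constant. -/
theorem eq_of_fderiv_inChart_eq_zero [ConnectedSpace M] {u : M → ℝ}
    (hu : ∀ c : M, ∀ y ∈ (extChartAt (𝓡 (2 * n)) c).target,
      HasFDerivAt (inChart u c) (0 : Model n →L[ℝ] ℝ) y) (x y : M) : u x = u y := by
  refine IsLocallyConstant.apply_eq_of_isPreconnected ?_ isPreconnected_univ trivial trivial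
  rw [IsLocallyConstant.iff_eventually_eq]
  intro x
  set φ := extChartAt (𝓡 (2 * n)) x with hφ
  obtain ⟨r, hr, hball⟩ := Metric.mem_nhds_iff.1
    (mem_extChartAt_target_nhds (mem_extChartAt_target (I := 𝓡 (2 * n)) x))
  filter_upwards [(continuousAt_extChartAt (I := 𝓡 (2 * n)) x).preimage_mem_nhds
    (Metric.ball_mem_nhds _ hr), extChartAt_source_mem_nhds (I := 𝓡 (2 * n)) x] with z hz hzs
  have h1 := (convex_ball (φ x) r).is_const_of_fderivWithin_eq_zero (𝕜 := ℝ) (f := inChart u x)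
    (fun w hw => (hu x w (hball hw)).differentiableAt.differentiableWithinAt)
    (fun w hw => by
      rw [fderivWithin_of_isOpen Metric.isOpen_ball hw]
      exact (hu x w (hball hw)).fderiv) hz (Metric.mem_ball_self hr)
  rwa [inChart, inChart, φ.left_inv hzs, extChartAt_to_inv] at h1

end

/-! ### Existence of variations -/

section

/-- Finitely many of a family of nonnegative functions without common zero have positive sum. -/
theorem exists_finset_sum_pos {Z : Type*} [TopologicalSpace Z] [CompactSpace Z] [Nonempty Z]
    {I : Set ℝ} (u : ℝ → C(Z, ℝ)) (hu : ∀ t z, 0 ≤ u t z) (h : ∀ z, ∃ t ∈ I, u t z ≠ 0) :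
    ∃ T : Finset ℝ, T.Nonempty ∧ (∀ t ∈ T, t ∈ I) ∧ ∀ z, 0 < ∑ t ∈ T, u t z := by
  classical
  choose τ hτI hτ using h
  obtain ⟨s, hs⟩ := isCompact_univ.elim_nhds_subcover (fun z : Z => {w | u (τ z) w ≠ 0})
    fun z _ => (isOpen_ne_fun (u (τ z)).continuous continuous_const).mem_nhds (hτ z)
  have hpos : ∀ z, 0 < ∑ t ∈ s.image τ, u t z := by
    intro z
    obtain ⟨w, hw, hwz⟩ := Set.mem_iUnion₂.1 (hs.2 (Set.mem_univ z))
    exact Finset.sum_pos' (fun t _ => hu t z)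
      ⟨τ w, Finset.mem_image_of_mem τ hw, lt_of_le_of_ne (hu _ z) (Ne.symm hwz)⟩
  refine ⟨s.image τ, ?_, ?_, hpos⟩
  · by_contra hne
    rw [Finset.not_nonempty_iff_eq_empty] at hne
    have := hpos (Classical.arbitrary Z)
    rw [hne, Finset.sum_empty] at this
    exact lt_irrefl _ this
  · intro t ht
    obtain ⟨w, -, rfl⟩ := Finset.mem_image.1 ht
    exact hτI w

variable {n : ℕ} {M : Type*} [TopologicalSpace M] [ChartedSpace (Model n) M]
  [MeasurableSpace M] {Ω : SymplecticForm n M} {a b : ℝ}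
  {f : ℝ → M ≃ₘ⟮𝓡 (2 * n), 𝓡 (2 * n)⟯ M} [IsManifold (𝓡 (2 * n)) ∞ M]

/-- Two Hamiltonians of a path have the same differential, so they differ by functions of time. -/
theorem IsHamiltonianOf.sub_eq_sub [ConnectedSpace M] (hab : a < b) {F F' : ℝ → M → ℝ}
    (hF : IsHamiltonianOf Ω a b F f)
    (hF' : IsHamiltonianOf Ω a b F' f) {t : ℝ} (ht : t ∈ Set.Icc a b) (x y : M) :
    F t x - F' t x = F t y - F' t y := by
  obtain ⟨X, hX⟩ := hF.generates.exists_field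
  obtain ⟨X', hX'⟩ := hF'.generates.exists_field
  have hs : ContMDiff (𝓡 (2 * n)) 𝓘(ℝ, ℝ) ∞ (F t) := family_contMDiff hF.normalized.smooth ht
  have hs' : ContMDiff (𝓡 (2 * n)) 𝓘(ℝ, ℝ) ∞ (F' t) := family_contMDiff hF'.normalized.smooth ht
  have hd : ∀ (z : M) (w : Model n), differential (F t) z w = differential (F' t) z w := by
    intro z w
    obtain ⟨x, rfl⟩ := (f t).surjective z
    have hu : UniqueMDiffWithinAt 𝓘(ℝ, ℝ) (Set.Icc a b) t :=
      uniqueMDiffWithinAt_iff_uniqueDiffWithinAt.2 (uniqueDiffOn_Icc hab t ht)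
    have h1 := hu.eq ((hX t ht).2 x) ((hX' t ht).2 x)
    have h2 : X t (f t x) = X' t (f t x) := by
      have h := congrArg (fun A : ℝ →L[ℝ] Model n => A 1) h1
      exact (one_smul ℝ (X t (f t x))).symm.trans (h.trans (one_smul ℝ (X' t (f t x))))
    have h3 := (hX t ht).1 (f t x) w
    have h4 := (hX' t ht).1 (f t x) w
    change formAt Ω (f t x) ![X t (f t x), w] = -differential (F t) (f t x) w at h3
    rw [h2] at h3
    have h5 := h3.symm.trans h4
    exact neg_injective h5
  refine eq_of_fderiv_inChart_eq_zero (n := n) (u := fun x => F t x - F' t x) (fun c y hy => ?_) x y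
  have h1 := ((contDiffOn_inChart hs c).contDiffAt
    (mem_extChartAt_target_nhds hy)).differentiableAt (by simp)
  have h2 := ((contDiffOn_inChart hs' c).contDiffAt
    (mem_extChartAt_target_nhds hy)).differentiableAt (by simp)
  refine (h1.hasFDerivAt.sub h2.hasFDerivAt).congr_fderiv ?_
  ext w
  rw [sub_apply, fderiv_inChart hs hy, fderiv_inChart hs' hy, hd]
  simp

theorem IsHamiltonianOf.osc_eq [ConnectedSpace M] (hab : a < b) {F F' : ℝ → M → ℝ}
    (hF : IsHamiltonianOf Ω a b F f)
    (hF' : IsHamiltonianOf Ω a b F' f) {t : ℝ} (ht : t ∈ Set.Icc a b) : osc (F t) = osc (F' t) := by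
  have hs' : ContMDiff (𝓡 (2 * n)) 𝓘(ℝ, ℝ) ∞ (F' t) := family_contMDiff hF'.normalized.smooth ht
  have hconst := hF.sub_eq_sub hab hF' ht
  have x₀ : M := Classical.arbitrary M
  have e : F t = fun x => F' t x + (F t x₀ - F' t x₀) := by
    funext x
    linarith [hconst x x₀]
  obtain ⟨K, hK, hKF⟩ := hF'.normalized.exists_compact
  obtain ⟨p, hp⟩ := exists_base_point K
  have hval : ∀ x, ∃ z ∈ insert p K, F' t z = F' t x := exists_mem_insert_eq hp fun x hx y hy => by
    rw [hKF t ht x hx, hKF t ht y hy]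
  have hZ : CompactSpace ↥(insert p K) := isCompact_iff_compactSpace.1 (hK.insert p)
  have hne : Nonempty ↥(insert p K) := ⟨⟨p, Set.mem_insert p K⟩⟩
  rw [osc_eq_of_attained hval, e, osc_eq_of_attained (Z := insert p K) fun x => by
    obtain ⟨z, hz, hzx⟩ := hval x
    exact ⟨z, hz, by rw [hzx]⟩]
  exact osc_add_const (⟨_, hs'.continuous.comp continuous_subtype_val⟩ : C(↥(insert p K), ℝ)) _

variable [BorelSpace M] [SecondCountableTopology M] [T2Space M]

/-- Compactly supported functions `h i` with vanishing sum are, up to functions of time, the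
coefficients of the first variation of some variation. -/
theorem exists_variation {F : ℝ → M → ℝ} (hf : IsHamiltonianPath Ω a b f)
    (hF : IsHamiltonianOf Ω a b F f) {ι : Type*} [Fintype ι] {K : Set M} (hK : IsCompact K)
    {h : ι → M → ℝ} (hh : ∀ i, ContMDiff (𝓡 (2 * n)) 𝓘(ℝ, ℝ) ∞ (h i)) (hhK : ∀ i, ∀ x ∉ K, h i x = 0)
    (hsum : ∀ x, ∑ i, h i x = 0) {χ : ι → ℝ → ℝ} (hχ : ∀ i, ContDiff ℝ ∞ (χ i))
    (ha : ∀ i, χ i a = 0) (hb : ∀ i, χ i b = 1) {χ₀ : ℝ → ℝ} (hχ₀ : ContDiff ℝ ∞ χ₀)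
    (ha₀ : χ₀ a = 0) (hb₀ : χ₀ b = 1) :
    ∃ (g : ℝ × ℝ → M ≃ₘ⟮𝓡 (2 * n), 𝓡 (2 * n)⟯ M) (G : ℝ × ℝ → M → ℝ) (C : ℝ → ℝ),
      IsDeformation Ω a b f F (fun t x => ∑ i, deriv (χ i) t * h i x + C t) g G ∧
        IsVariation Ω a b f 1 g := by
  classical
  obtain ⟨s, ρ, hρ, hρs, hρ1⟩ := exists_finite_partition (n := n) hK
  have hsm : ∀ p : ι × s, ContMDiff (𝓡 (2 * n)) 𝓘(ℝ, ℝ) ∞ (fun x => ρ p.2 x * h p.1 x) := fun p =>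
    (hρ p.2).mul (hh p.1)
  have hcs : ∀ p : ι × s, HasCompactSupport (fun x => ρ p.2 x * h p.1 x) := fun p =>
    HasCompactSupport.intro hK fun x hx => by rw [hhK p.1 x hx, mul_zero]
  have hts : ∀ p : ι × s, tsupport (fun x => ρ p.2 x * h p.1 x) ⊆
      (extChartAt (𝓡 (2 * n)) (p.2 : M)).source := fun p =>
    (closure_mono (Function.support_mul_subset_left _ _)).trans (hρs p.2)
  -- each `ρ_c h_i` is supported in a chart domain, so it generates a flow, of speed `r` at time `0`
  choose m hm hm' using fun p : ι × s => exists_normalization Ω (fun x => ρ p.2 x * h p.1 x)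
  choose r hr ψ hψ using fun p : ι × s =>
    exists_hamiltonianFlow Ω (hsm p) (hcs p) (hts p) (hm p) (hm' p)
  obtain ⟨g, G, hg, hends⟩ := IsDeformation.exists_word hψ
    (χ := fun p t => χ p.1 t / r p) (χ₀ := fun p t => χ₀ t / r p)
    (fun p => (hχ p.1).div_const _) (fun p => hχ₀.div_const _)
    (fun p => by simp [ha]) (fun p => by simp [ha₀]) (fun p => by simp [hb, hb₀]) Finset.univ
    (isDeformation_const hf hF)
  refine ⟨g, G, fun t => -∑ p : ι × s, (deriv (χ p.1) t - deriv χ₀ t) * m p, ?_, ?_⟩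
  · convert hg using 3 with t x
    have e1 : ∀ p : ι × s, (deriv (fun t => χ p.1 t / r p) t - deriv (fun t => χ₀ t / r p) t) *
        (r p * Real.cos 0 * (ρ p.2 x * h p.1 x - m p)) =
        ρ p.2 x * ((deriv (χ p.1) t - deriv χ₀ t) * h p.1 x) -
          (deriv (χ p.1) t - deriv χ₀ t) * m p := by
      intro p
      have := (hr p).ne'
      rw [deriv_div_const, deriv_div_const, Real.cos_zero]
      field_simp
    rw [Finset.sum_congr rfl fun p _ => e1 p, Finset.sum_sub_distrib]
    have e2 : ∑ p : ι × s, ρ p.2 x * ((deriv (χ p.1) t - deriv χ₀ t) * h p.1 x) =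
        ∑ i, (deriv (χ i) t - deriv χ₀ t) * h i x := by
      rw [Fintype.sum_prod_type]
      refine Finset.sum_congr rfl fun i _ => ?_
      change ∑ c : s, ρ c x * ((deriv (χ i) t - deriv χ₀ t) * h i x) = _
      rw [← Finset.sum_mul, Finset.sum_coe_sort s fun c => ρ c x]
      by_cases hx : x ∈ K
      · rw [hρ1 x hx, one_mul]
      · rw [hhK i x hx]
        ring
    -- the common compensation `χ₀` cancels, since the functions `h i` have sum zero
    have e3 : ∑ i, (deriv (χ i) t - deriv χ₀ t) * h i x = ∑ i, deriv (χ i) t * h i x := by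
      simp only [sub_mul, Finset.sum_sub_distrib, ← Finset.mul_sum, hsum]
      ring
    rw [e2, e3]
    simp only [Pi.zero_apply]
    ring
  · exact ⟨one_pos, hg.smooth, fun t ht ε hε => hg.mem_Ham _ ⟨ht, hε⟩, fun ε _ => (hends ε).1,
      fun ε _ => (hends ε).2, hg.center⟩

end

/-! ### Geodesics have fixed extrema -/

section

variable {n : ℕ} {M : Type*} [TopologicalSpace M] [ChartedSpace (Model n) M]
  [MeasurableSpace M] {Ω : SymplecticForm n M} {a b : ℝ}
  {f : ℝ → M ≃ₘ⟮𝓡 (2 * n), 𝓡 (2 * n)⟯ M}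

/-- The oscillation of a path of normalized Hamiltonians is continuous in time. -/
theorem IsNormalizedHamiltonian.continuousOn_osc [Nonempty M] (hab : a ≤ b) {G : ℝ → M → ℝ}
    (hG : IsNormalizedHamiltonian Ω (Set.Icc a b) G) :
    ContinuousOn (fun t => osc (G t)) (Set.Icc a b) := by
  obtain ⟨K, hK, hKG⟩ := hG.exists_compact
  obtain ⟨p, hp⟩ := exists_base_point K
  have hZ : CompactSpace ↥(insert p K) := isCompact_iff_compactSpace.1 (hK.insert p)
  have hne : Nonempty ↥(insert p K) := ⟨⟨p, Set.mem_insert p K⟩⟩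
  obtain ⟨G', hG'c, hG'⟩ := exists_curve (Z := insert p K) hab hG.smooth.continuousOn
  refine (continuous_osc.comp hG'c).continuousOn.congr fun t ht => ?_
  rw [osc_eq_of_attained (exists_mem_insert_eq hp fun x hx y hy => by
    rw [hKG t ht x hx, hKG t ht y hy])]
  exact congrArg osc (funext fun z => (hG' t ht z).symm)

theorem IsNormalizedHamiltonian.slice {ε₀ ε : ℝ} {G : ℝ × ℝ → M → ℝ}
    (hG : IsNormalizedHamiltonian Ω (Set.Icc a b ×ˢ Set.Ioo (-ε₀) ε₀) G)
    (hε : ε ∈ Set.Ioo (-ε₀) ε₀) :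
    IsNormalizedHamiltonian Ω (Set.Icc a b) fun t => G (t, ε) where
  smooth := by
    have h1 : ContMDiff (𝓘(ℝ, ℝ).prod (𝓡 (2 * n))) 𝓘(ℝ, ℝ × ℝ) ∞
        (fun q : ℝ × M => (q.1, ε)) :=
      (contDiff_id.prodMk contDiff_const).contMDiff.comp contMDiff_fst
    exact hG.smooth.comp (h1.prodMk contMDiff_snd).contMDiffOn fun q hq => ⟨⟨hq.1, hε⟩, trivial⟩
  mean_zero := fun hM t ht => hG.mean_zero hM _ ⟨ht, hε⟩
  compact_support := fun hM => by
    obtain ⟨K, hK, h⟩ := hG.compact_support hM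
    exact ⟨K, hK, fun t ht => h _ ⟨ht, hε⟩⟩

/-- A function that decreases at a definite rate to the right of `0` is not critical at `0`. -/
theorem not_isCriticalAtZero {l : ℝ → ℝ} {κ e₀ : ℝ} (hκ : 0 < κ) (he₀ : 0 < e₀)
    (h : ∀ e, 0 < e → e ≤ e₀ → l e ≤ l 0 - κ * e) : ¬ IsCriticalAtZero l := by
  rintro ⟨u, δ, C, hδ, hC, -, hlu, hu⟩
  set e := min e₀ (min (δ / 2) (κ / (2 * C))) with he
  have hepos : 0 < e := by positivity
  have he1 : e ≤ e₀ := min_le_left _ _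
  have he2 : e ≤ δ / 2 := (min_le_right _ _).trans (min_le_left _ _)
  have he3 : e ≤ κ / (2 * C) := (min_le_right _ _).trans (min_le_right _ _)
  have hmem : e ∈ Set.Ioo (-δ) δ := ⟨by linarith, by linarith⟩
  have h0 := hlu 0 ⟨by linarith, hδ⟩
  have h1 := abs_le.1 (hlu e hmem)
  have h2 := hu e hmem
  have h3 := h e hepos he1
  have h4 : l 0 = u 0 := by
    have : |l 0 - u 0| ≤ 0 := by simpa using h0
    linarith [abs_nonpos_iff.1 this]
  have h5 : C * e ^ 2 ≤ κ * e / 2 := by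
    calc C * e ^ 2 = C * e * e := by ring
      _ ≤ C * (κ / (2 * C)) * e := by gcongr
      _ = κ * e / 2 := by field_simp
  have h6 : 0 < κ * e := mul_pos hκ hepos
  linarith [h1.1]

variable [IsManifold (𝓡 (2 * n)) ∞ M] [BorelSpace M] [SecondCountableTopology M] [T2Space M]
  [ConnectedSpace M]

/-- If the extrema are not fixed, finitely many of the functions `max F_t - F_t`, or of the
functions `F_t - min F_t`, have no common zero. Products of these give functions `h_t` with sum
zero, each smaller at the maxima of `F_t` than at its minima, and the variation with first variation
`∑ χ_t' h_t` shortens the path at a definite rate. -/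
theorem hasFixedExtrema_of_isGeodesic (hab : a < b) (hf : IsHamiltonianPath Ω a b f)
    {F : ℝ → M → ℝ} (hF : IsHamiltonianOf Ω a b F f) (hgeo : IsGeodesic Ω a b f) :
    HasFixedExtrema a b F := by
  classical
  obtain ⟨F₁, hF₁, c, hc₁⟩ := hgeo.constant_speed
  have hc : ∀ t ∈ Set.Icc a b, osc (F t) = c := fun t ht => (hF.osc_eq hab hF₁ ht).trans (hc₁ t ht)
  obtain ⟨K, hK, hKF⟩ := hF.normalized.exists_compact
  obtain ⟨p, hp⟩ := exists_base_point K
  set Z : Set M := insert p K with hZdef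
  have hZ : CompactSpace Z := isCompact_iff_compactSpace.1 (hK.insert p)
  have hne : Nonempty Z := ⟨⟨p, Set.mem_insert p K⟩⟩
  obtain ⟨F', hF'c, hF'⟩ := exists_curve (Z := Z) hab.le hF.normalized.smooth.continuousOn
  have hattained : ∀ {u : M → ℝ}, (∀ x ∉ K, ∀ y ∉ K, u x = u y) → ∀ x, ∃ z : Z, u z = u x := by
    intro u hu x
    obtain ⟨z, hz, hzx⟩ := exists_mem_insert_eq hp hu x
    exact ⟨⟨z, hz⟩, hzx⟩
  have hFoff : ∀ t ∈ Set.Icc a b, ∀ x ∉ K, ∀ y ∉ K, F t x = F t y := fun t ht x hx y hy => by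
    rw [hKF t ht x hx, hKF t ht y hy]
  choose xM ym hxM hym hosc using fun t => exists_osc_eq (F' t)
  have hoscF : ∀ t ∈ Set.Icc a b, osc (F t) = osc (F' t) := by
    intro t ht
    rw [osc_eq_of_attained (exists_mem_insert_eq hp (hFoff t ht))]
    exact congrArg osc (funext fun z => (hF' t ht z).symm)
  have hc' : ∀ t ∈ Set.Icc a b, F' t (xM t) - F' t (ym t) = c := fun t ht => by
    rw [← hosc, ← hoscF t ht, hc t ht]
  by_contra hnot
  -- either the maxima or the minima have no common point, so finitely many times have none
  obtain ⟨T, hTne, hTI, hT⟩ : ∃ T : Finset ℝ, T.Nonempty ∧ (∀ t ∈ T, t ∈ Set.Icc a b) ∧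
      ((∀ z, 0 < ∑ t ∈ T, (F' t (xM t) - F' t z)) ∨
        ∀ z, 0 < ∑ t ∈ T, (F' t z - F' t (ym t))) := by
    by_cases h1 : ∀ z, ∃ t ∈ Set.Icc a b, F' t (xM t) - F' t z ≠ 0
    · obtain ⟨T, h2, h3, h4⟩ := exists_finset_sum_pos
        (fun t => ContinuousMap.const Z (F' t (xM t)) - F' t)
        (fun t z => sub_nonneg.2 (hxM t z)) h1
      exact ⟨T, h2, h3, Or.inl h4⟩
    by_cases h2 : ∀ z, ∃ t ∈ Set.Icc a b, F' t z - F' t (ym t) ≠ 0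
    · obtain ⟨T, h2, h3, h4⟩ := exists_finset_sum_pos
        (fun t => F' t - ContinuousMap.const Z (F' t (ym t)))
        (fun t z => sub_nonneg.2 (hym t z)) h2
      exact ⟨T, h2, h3, Or.inr h4⟩
    push Not at h1 h2
    obtain ⟨xp, hxp⟩ := h1
    obtain ⟨xm, hxm⟩ := h2
    refine absurd ⟨xm, xp, fun t ht x => ?_, c, fun t ht => ?_⟩ hnot
    · obtain ⟨z, hz⟩ := hattained (hFoff t ht) x
      rw [← hz, ← hF' t ht, ← hF' t ht, ← hF' t ht]
      constructor
      · linarith [hxm t ht, hym t z]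
      · linarith [hxp t ht, hxM t z]
    · rw [← hF' t ht, ← hF' t ht, ← hc' t ht]
      linarith [hxm t ht, hxp t ht]
  -- with `m_t = max F_t - F_t`, `n_t = F_t - min F_t`, `R = ∑ m_t` and `S = ∑ n_t`, the functions
  -- `h_t = m_t S - n_t R` have sum zero, and `h_t` is `-c R` at the maxima of `F_t` and `c S` at
  -- the minima
  have hTF : ∀ t ∈ T, ContMDiff (𝓡 (2 * n)) 𝓘(ℝ, ℝ) ∞ (F t) := fun t ht =>
    family_contMDiff hF.normalized.smooth (hTI t ht)
  let R : M → ℝ := fun x => ∑ t ∈ T, (F' t (xM t) - F t x)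
  let S : M → ℝ := fun x => ∑ t ∈ T, (F t x - F' t (ym t))
  let h₀ : ℝ → M → ℝ := fun t x =>
    (F' t (xM t) - F t x) * S x - (F t x - F' t (ym t)) * R x
  have hR : ∀ z : Z, R z = ∑ t ∈ T, (F' t (xM t) - F' t z) := fun z =>
    Finset.sum_congr rfl fun t ht => by rw [hF' t (hTI t ht) z]
  have hS : ∀ z : Z, S z = ∑ t ∈ T, (F' t z - F' t (ym t)) := fun z =>
    Finset.sum_congr rfl fun t ht => by rw [hF' t (hTI t ht) z]
  have hRnn : ∀ z : Z, 0 ≤ R z := fun z => by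
    rw [hR]; exact Finset.sum_nonneg fun t _ => sub_nonneg.2 (hxM t z)
  have hSnn : ∀ z : Z, 0 ≤ S z := fun z => by
    rw [hS]; exact Finset.sum_nonneg fun t _ => sub_nonneg.2 (hym t z)
  have hpos : (∀ z : Z, 0 < R z) ∨ ∀ z : Z, 0 < S z := by
    simpa only [hR, hS] using hT
  have hcpos : 0 < c := by
    obtain ⟨t₀, ht₀⟩ := hTne
    have hle : ∀ t ∈ T, ∀ z, F' t (xM t) - F' t z ≤ c ∧ F' t z - F' t (ym t) ≤ c :=
      fun t ht z => by
        have := hc' t (hTI t ht)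
        exact ⟨by linarith [hym t z], by linarith [hxM t z]⟩
    have hcnn : 0 ≤ c := by
      have := hle t₀ ht₀ (xM t₀)
      linarith [this.1]
    refine lt_of_le_of_ne hcnn fun h0 => ?_
    have z₀ : Z := Classical.arbitrary Z
    rcases hT with h | h
    · exact absurd (h z₀) (not_lt.2 (Finset.sum_nonpos fun t ht => by
        linarith [(hle t ht z₀).1]))
    · exact absurd (h z₀) (not_lt.2 (Finset.sum_nonpos fun t ht => by
        linarith [(hle t ht z₀).2]))
  have hRsm : ContMDiff (𝓡 (2 * n)) 𝓘(ℝ, ℝ) ∞ R :=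
    contMDiff_finsetSum fun t ht => contMDiff_const.sub (hTF t ht)
  have hSsm : ContMDiff (𝓡 (2 * n)) 𝓘(ℝ, ℝ) ∞ S :=
    contMDiff_finsetSum fun t ht => (hTF t ht).sub contMDiff_const
  have hh₀sm : ∀ t ∈ T, ContMDiff (𝓡 (2 * n)) 𝓘(ℝ, ℝ) ∞ (h₀ t) := fun t ht =>
    ((contMDiff_const.sub (hTF t ht)).mul hSsm).sub (((hTF t ht).sub contMDiff_const).mul hRsm)
  have hh₀sum : ∀ x, ∑ t ∈ T, h₀ t x = 0 := by
    intro x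
    simp only [h₀]
    rw [Finset.sum_sub_distrib, ← Finset.sum_mul, ← Finset.sum_mul]
    change R x * S x - S x * R x = 0
    ring
  have hh₀off : ∀ t ∈ T, ∀ x ∉ K, ∀ y ∉ K, h₀ t x = h₀ t y := by
    intro t ht x hx y hy
    have hFxy : ∀ s ∈ T, F s x = F s y := fun s hs => hFoff s (hTI s hs) x hx y hy
    have hRxy : R x = R y := Finset.sum_congr rfl fun s hs => by rw [hFxy s hs]
    have hSxy : S x = S y := Finset.sum_congr rfl fun s hs => by rw [hFxy s hs]
    simp only [h₀, hFxy t ht, hRxy, hSxy]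
  have hTne' : Nonempty T := hTne.to_subtype
  have hhZ : ∀ i : T, Continuous fun z : Z => h₀ i z := fun i =>
    (hh₀sm i i.2).continuous.comp continuous_subtype_val
  obtain ⟨χ, hχ, hχa, hχb, κ, hκ, e₀, he₀, hdecr⟩ := exists_length_decrease hab hF'c
    (fun i : T => (i : ℝ)) (fun i => hTI i i.2) (fun i : T => ⟨fun z : Z => h₀ i z, hhZ i⟩) (by
      intro i x y hx hy
      have hi := hTI i i.2
      have h1 : F' i x = F' i (xM i) := le_antisymm (hxM i x) (hx _)
      have h2 : F' i y = F' i (ym i) := le_antisymm (hy _) (hym i y)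
      have h3 := hc' i hi
      change h₀ i x < h₀ i y
      simp only [h₀]
      rw [← hF' i hi, ← hF' i hi, h1, h2, h3, sub_self, sub_self, zero_mul, zero_mul, zero_sub,
        sub_zero]
      have h4 : 0 ≤ c * R x := mul_nonneg hcpos.le (hRnn x)
      have h5 : 0 ≤ c * S y := mul_nonneg hcpos.le (hSnn y)
      rcases hpos with h | h
      · linarith [mul_pos hcpos (h x)]
      · linarith [mul_pos hcpos (h y)])
  obtain ⟨t₀⟩ := id hTne'
  obtain ⟨g, G, C, hg, hvar⟩ := exists_variation hf hF hK (h := fun (i : T) x => h₀ i x - h₀ i p)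
    (fun i => (hh₀sm i i.2).sub contMDiff_const)
    (fun i x hx => sub_eq_zero.2 (hh₀off i i.2 x hx p (hp x hx)))
    (fun x => by
      rw [Finset.sum_sub_distrib, Finset.sum_coe_sort T fun t => h₀ t x,
        Finset.sum_coe_sort T fun t => h₀ t p, hh₀sum, hh₀sum, sub_zero])
    hχ hχa hχb (hχ t₀) (hχa t₀) (hχb t₀)
  refine absurd (hgeo.critical 1 g G hvar hg.hamiltonian) ?_
  -- the remainder contributes at most `2 (b - a) η e = κ e / 2` to the length
  set η := κ / (4 * (b - a)) with hη
  have hba : 0 < b - a := sub_pos.2 hab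
  have hηpos : 0 < η := by positivity
  obtain ⟨e₁, he₁, hclose⟩ := Metric.eventually_nhds_iff.1 (hg.eventually_close hηpos)
  have hl0 : hoferLength a b (fun t => G (t, 0)) = ∫ t in a..b, osc (F' t) := by
    refine intervalIntegral.integral_congr fun t ht => ?_
    rw [Set.uIcc_of_le hab.le] at ht
    have h1 := (hclose (y := 0) (by simpa using he₁)) t ht
    have h2 : ∀ x, G (t, 0) (g (t, 0) x) = F t (f t x) := fun x => by
      have := h1 x
      simp only [abs_zero, mul_zero, zero_mul, add_zero] at this
      linarith [abs_nonpos_iff.1 this]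
    change osc (G (t, 0)) = _
    rw [← hoscF t ht]
    exact (osc_comp_equiv (g (t, 0)).toEquiv (G (t, 0))).symm.trans
      ((congrArg osc (funext h2)).trans (osc_comp_equiv (f t).toEquiv (F t)))
  refine not_isCriticalAtZero (κ := κ / 2) (e₀ := min e₀ (min (e₁ / 2) (1 / 2))) (by positivity)
    (by positivity) fun e he he' => ?_
  have hee₀ : e ≤ e₀ := he'.trans (min_le_left _ _)
  have hee₁ : e ≤ e₁ / 2 := he'.trans ((min_le_right _ _).trans (min_le_left _ _))
  have hee₂ : e ≤ 1 / 2 := he'.trans ((min_le_right _ _).trans (min_le_right _ _))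
  let U : ℝ → C(Z, ℝ) := fun t => F' t + e • ∑ i : T, deriv (χ i) t • ⟨fun z : Z => h₀ i z, hhZ i⟩
  have hUval : ∀ t ∈ Set.Icc a b, ∀ z : Z, U t z = F t z + e * ∑ i : T, deriv (χ i) t * h₀ i z := by
    intro t ht z
    rw [← hF' t ht]
    simp [U]
  have hpt : ∀ t ∈ Set.Icc a b, osc (G (t, e)) ≤ osc (U t) + 2 * (η * e) := by
    intro t ht
    rw [← osc_comp_equiv (g (t, e)).toEquiv]
    have hne' : Nonempty M := ⟨p⟩
    have hval : ∀ x, ∃ z : Z, U t z = F t x + e * ∑ i : T, deriv (χ i) t * h₀ i x := by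
      intro x
      obtain ⟨z, hz⟩ := hattained (u := fun x => F t x + e * ∑ i : T, deriv (χ i) t * h₀ i x)
        (fun x hx y hy => by
          have : ∀ i : T, h₀ i x = h₀ i y := fun i => hh₀off i i.2 x hx y hy
          simp only [hFoff t ht x hx y hy, this]) x
      exact ⟨z, (hUval t ht z).trans hz⟩
    refine osc_le fun x y => ?_
    have hcl := hclose (y := e) (by
      rw [Real.dist_eq, sub_zero, abs_of_pos he]; linarith) t ht
    have h1 := abs_le.1 (hcl x)
    have h2 := abs_le.1 (hcl y)
    rw [abs_of_pos he] at h1 h2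
    obtain ⟨z, hz⟩ := hval (f t x)
    obtain ⟨w, hw⟩ := hval (f t y)
    have h3 := sub_le_osc (U t) z w
    rw [hz, hw] at h3
    have h4 : ∀ x, ∑ i : T, deriv (χ i) t * (h₀ i x - h₀ i p) =
        ∑ i : T, deriv (χ i) t * h₀ i x - ∑ i : T, deriv (χ i) t * h₀ i p := fun x => by
      simp only [mul_sub, Finset.sum_sub_distrib]
    rw [h4] at h1 h2
    change G (t, e) (g (t, e) x) - G (t, e) (g (t, e) y) ≤ _
    linarith [h1.2, h2.1]
  have hsl := hg.hamiltonian.normalized.slice (ε := e) ⟨by linarith, by linarith⟩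
  have hUc : Continuous fun t => osc (U t) := by
    refine continuous_osc.comp
      (hF'c.add ((continuous_finsetSum Finset.univ fun i _ => ?_).const_smul e))
    exact ((hχ i).continuous_deriv (by simp)).smul continuous_const
  have hint1 : IntervalIntegrable (fun t => osc (G (t, e))) volume a b :=
    ContinuousOn.intervalIntegrable (by
      rw [Set.uIcc_of_le hab.le]
      have hne' : Nonempty M := ⟨p⟩
      exact hsl.continuousOn_osc hab.le)
  have hconst : ∫ _ in a..b, 2 * (η * e) = κ / 2 * e := by
    rw [intervalIntegral.integral_const, smul_eq_mul, hη]
    field_simp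
    ring
  calc hoferLength a b (fun t => G (t, e)) = ∫ t in a..b, osc (G (t, e)) := rfl
    _ ≤ ∫ t in a..b, (osc (U t) + 2 * (η * e)) :=
        intervalIntegral.integral_mono_on hab.le hint1
          ((hUc.add continuous_const).intervalIntegrable _ _) hpt
    _ = (∫ t in a..b, osc (U t)) + κ / 2 * e := by
        rw [intervalIntegral.integral_add (hUc.intervalIntegrable _ _)
          (continuous_const.intervalIntegrable _ _), hconst]
    _ ≤ hoferLength a b (fun t => G (t, 0)) - κ / 2 * e := by
        have := hdecr e he.le hee₀
        rw [hl0]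
        change (∫ t in a..b, osc (U t)) ≤ _ at this
        linarith

end

/-! ### The derivative of a family of Hamiltonians -/

section

variable {n : ℕ} {M : Type*} [TopologicalSpace M] [ChartedSpace (Model n) M]

/-- The derivative of a two-parameter family of functions with respect to the second parameter. -/
def derivSnd (G : ℝ × ℝ → M → ℝ) (p : ℝ × ℝ) (x : M) : ℝ := deriv (fun e => G (p.1, e) x) p.2

theorem uniqueDiffOn_strip {a b : ℝ} (hab : a < b) (ε₀ : ℝ) :
    UniqueDiffOn ℝ (Set.Icc a b ×ˢ Set.Ioo (-ε₀) ε₀) :=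
  (uniqueDiffOn_Icc hab).prod isOpen_Ioo.uniqueDiffOn

/-- A function on a strip is differentiable in the second variable, with derivative a value of its
differential. -/
theorem hasDerivAt_snd_of_strip {a b ε₀ : ℝ} {u : ℝ × ℝ → ℝ} {p : ℝ × ℝ}
    (hp : p ∈ Set.Icc a b ×ˢ Set.Ioo (-ε₀) ε₀)
    (hu : DifferentiableWithinAt ℝ u (Set.Icc a b ×ˢ Set.Ioo (-ε₀) ε₀) p) :
    HasDerivAt (fun e => u (p.1, e))
      (fderivWithin ℝ u (Set.Icc a b ×ˢ Set.Ioo (-ε₀) ε₀) p (0, 1)) p.2 := by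
  have h1 : HasDerivWithinAt (fun e : ℝ => (p.1, e)) ((0, 1) : ℝ × ℝ) (Set.Ioo (-ε₀) ε₀) p.2 :=
    ((hasDerivAt_const p.2 p.1).prodMk (hasDerivAt_id p.2)).hasDerivWithinAt
  have h2 := HasFDerivWithinAt.comp_hasDerivWithinAt (f := fun e : ℝ => (p.1, e)) p.2
    (hu.hasFDerivWithinAt) h1 fun e he => ⟨hp.1, he⟩
  exact h2.hasDerivAt (isOpen_Ioo.mem_nhds hp.2)

section
variable {a b ε₀ : ℝ} {G : ℝ × ℝ → M → ℝ}
  (hG : ContMDiffOn (𝓘(ℝ, ℝ × ℝ).prod (𝓡 (2 * n))) 𝓘(ℝ, ℝ) ∞ (fun q : (ℝ × ℝ) × M => G q.1 q.2)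
    ((Set.Icc a b ×ˢ Set.Ioo (-ε₀) ε₀) ×ˢ Set.univ))
include hG

theorem family_contDiffOn_param {S : Set (ℝ × ℝ)}
    (hS : S = Set.Icc a b ×ˢ Set.Ioo (-ε₀) ε₀) (x : M) : ContDiffOn ℝ ∞ (fun p => G p x) S := by
  rw [← contMDiffOn_iff_contDiffOn, hS]
  exact hG.comp (contMDiff_id.prodMk contMDiff_const).contMDiffOn fun p hp => ⟨hp, trivial⟩

theorem family_hasDerivAt {p : ℝ × ℝ} (hp : p ∈ Set.Icc a b ×ˢ Set.Ioo (-ε₀) ε₀) (x : M) :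
    HasDerivAt (fun e => G (p.1, e) x) (derivSnd G p x) p.2 :=
  (hasDerivAt_snd_of_strip hp (((family_contDiffOn_param hG rfl x).differentiableOn
    (by simp)) p hp)).differentiableAt.hasDerivAt

variable [IsManifold (𝓡 (2 * n)) ∞ M]

/-- In a chart, `derivSnd G` is a value of the differential of the smooth function `G`. -/
theorem derivSnd_contMDiffOn (hab : a < b) :
    ContMDiffOn (𝓘(ℝ, ℝ × ℝ).prod (𝓡 (2 * n))) 𝓘(ℝ, ℝ) ∞
      (fun q : (ℝ × ℝ) × M => derivSnd G q.1 q.2)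
      ((Set.Icc a b ×ˢ Set.Ioo (-ε₀) ε₀) ×ˢ Set.univ) := by
  rintro ⟨p, x⟩ ⟨hp, -⟩
  set S := Set.Icc a b ×ˢ Set.Ioo (-ε₀) ε₀ with hS
  set φ := extChartAt (𝓡 (2 * n)) x with hφ
  have hSQ : UniqueDiffOn ℝ (S ×ˢ φ.target) :=
    (uniqueDiffOn_strip hab ε₀).prod (isOpen_extChartAt_target x).uniqueDiffOn
  set W : (ℝ × ℝ) × Model n → ℝ := fun q => G q.1 (φ.symm q.2) with hW
  have hWs : ContDiffOn ℝ ∞ W (S ×ˢ φ.target) := by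
    rw [← contMDiffOn_iff_contDiffOn]
    intro q hq
    have e1 : ContMDiffAt 𝓘(ℝ, (ℝ × ℝ) × Model n) (𝓡 (2 * n)) ∞
        (fun q : (ℝ × ℝ) × Model n => φ.symm q.2) q :=
      (contMDiffAt_extChartAt_symm_target hq.2).comp q contDiffAt_snd.contMDiffAt
    exact (hG _ ⟨hq.1, trivial⟩).comp q
      (contDiffAt_fst.contMDiffAt.prodMk e1).contMDiffWithinAt fun q hq => ⟨hq.1, trivial⟩
  have hDW : ContDiffOn ℝ ∞ (fun q => fderivWithin ℝ W (S ×ˢ φ.target) q ((0, 1), 0))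
      (S ×ˢ φ.target) :=
    (hWs.fderivWithin hSQ (m := ∞) (by simp)).clm_apply contDiffOn_const
  have hx : x ∈ φ.source := mem_extChartAt_source x
  have heq : ∀ q ∈ S ×ˢ φ.source, derivSnd G q.1 q.2 =
      fderivWithin ℝ W (S ×ˢ φ.target) (q.1, φ q.2) ((0, 1), 0) := by
    rintro ⟨p, z⟩ ⟨hp, hz⟩
    have hmem : (p, φ z) ∈ S ×ˢ φ.target := ⟨hp, φ.map_source hz⟩
    have h1 : HasDerivWithinAt (fun e : ℝ => ((p.1, e), φ z))
        (((0, 1), 0) : (ℝ × ℝ) × Model n) (Set.Ioo (-ε₀) ε₀) p.2 :=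
      (((hasDerivAt_const p.2 p.1).prodMk (hasDerivAt_id p.2)).prodMk
        (hasDerivAt_const p.2 (φ z))).hasDerivWithinAt
    have h2 := HasFDerivWithinAt.comp_hasDerivWithinAt (f := fun e : ℝ => ((p.1, e), φ z)) p.2
      ((hWs.differentiableOn (by simp)) _ hmem).hasFDerivWithinAt h1
      fun e he => ⟨⟨hp.1, he⟩, φ.map_source hz⟩
    have h3 := h2.hasDerivAt (isOpen_Ioo.mem_nhds hp.2)
    have h4 : (W ∘ fun e : ℝ => ((p.1, e), φ z)) = fun e => G (p.1, e) z := by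
      funext e
      change G (p.1, e) (φ.symm (φ z)) = _
      rw [φ.left_inv hz]
    rw [h4] at h3
    exact h3.deriv
  have hpx : (p, φ x) ∈ S ×ˢ φ.target := ⟨hp, φ.map_source hx⟩
  have e1 : ContMDiffWithinAt (𝓘(ℝ, ℝ × ℝ).prod (𝓡 (2 * n))) 𝓘(ℝ, (ℝ × ℝ) × Model n) ∞
      (fun q : (ℝ × ℝ) × M => (q.1, φ q.2)) (S ×ˢ φ.source) (p, x) :=
    (contMDiffAt_fst.prodMk_space
      ((contMDiffAt_extChartAt (I := 𝓡 (2 * n)) (x := x)).comp (p, x)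
        contMDiffAt_snd)).contMDiffWithinAt
  have e2 : ContMDiffWithinAt (𝓘(ℝ, ℝ × ℝ).prod (𝓡 (2 * n))) 𝓘(ℝ, ℝ) ∞
      (fun q : (ℝ × ℝ) × M => fderivWithin ℝ W (S ×ˢ φ.target) (q.1, φ q.2) ((0, 1), 0))
      (S ×ˢ φ.source) (p, x) := by
    have hmaps : Set.MapsTo (fun q : (ℝ × ℝ) × M => (q.1, φ q.2)) (S ×ˢ φ.source)
        (S ×ˢ φ.target) := fun q hq => ⟨hq.1, φ.map_source hq.2⟩
    exact (hDW _ hpx).contMDiffWithinAt.comp (p, x) e1 hmaps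
  have e3 := e2.congr heq (heq _ ⟨hp, hx⟩)
  refine e3.mono_of_mem_nhdsWithin ?_
  have h5 : Prod.snd ⁻¹' φ.source ∈ nhds (p, x) :=
    continuousAt_snd.preimage_mem_nhds ((isOpen_extChartAt_source x).mem_nhds hx)
  filter_upwards [mem_nhdsWithin_of_mem_nhds h5, self_mem_nhdsWithin] with q hq hq'
  exact ⟨hq'.1, hq⟩

end

/-- Second order Taylor estimate on an interval. -/
theorem abs_taylor_le {v v' v'' : ℝ → ℝ} {δ C : ℝ} (h1 : ∀ e ∈ Set.Icc (-δ) δ, HasDerivAt v (v' e) e)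
    (h2 : ∀ e ∈ Set.Icc (-δ) δ, HasDerivAt v' (v'' e) e) (hC : ∀ e ∈ Set.Icc (-δ) δ, |v'' e| ≤ C)
    {ε : ℝ} (hε : |ε| ≤ δ) : |v ε - (v 0 + ε * v' 0)| ≤ C * ε ^ 2 := by
  have hsub : Set.Icc (-|ε|) |ε| ⊆ Set.Icc (-δ) δ := Set.Icc_subset_Icc (by linarith) hε
  have h0 : (0 : ℝ) ∈ Set.Icc (-|ε|) |ε| := ⟨by simp, abs_nonneg ε⟩
  have hεm : ε ∈ Set.Icc (-|ε|) |ε| := abs_le.1 le_rfl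
  have hCnn : 0 ≤ C := (abs_nonneg _).trans (hC 0 (hsub h0))
  have hb : ∀ e ∈ Set.Icc (-|ε|) |ε|, |v' e - v' 0| ≤ C * |ε| := by
    intro e he
    have := (convex_Icc (-|ε|) |ε|).norm_image_sub_le_of_norm_hasDerivWithin_le
      (fun x hx => (h2 x (hsub hx)).hasDerivWithinAt) (fun x hx => hC x (hsub hx)) h0 he
    refine this.trans ?_
    rw [sub_zero]
    exact mul_le_mul_of_nonneg_left (abs_le.2 he) hCnn
  have h3 := (convex_Icc (-|ε|) |ε|).norm_image_sub_le_of_norm_hasDerivWithin_le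
    (f := fun e => v e - e * v' 0) (f' := fun e => v' e - 1 * v' 0)
    (fun x hx => ((h1 x (hsub hx)).sub ((hasDerivAt_id x).mul_const (v' 0))).hasDerivWithinAt)
    (fun x hx => by rw [one_mul]; exact hb x hx) h0 hεm
  rw [Real.norm_eq_abs, Real.norm_eq_abs] at h3
  calc |v ε - (v 0 + ε * v' 0)| = |v ε - ε * v' 0 - (v 0 - 0 * v' 0)| := by congr 1; ring
    _ ≤ C * |ε| * |ε - 0| := h3
    _ = C * ε ^ 2 := by rw [sub_zero, mul_assoc, ← sq, sq_abs]

end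

/-! ### Critical points as constant trajectories -/

section

variable {n : ℕ} {M : Type*} [TopologicalSpace M] [ChartedSpace (Model n) M]
  [MeasurableSpace M] [IsManifold (𝓡 (2 * n)) ∞ M] {Ω : SymplecticForm n M} {a b : ℝ}
  {f : ℝ → M ≃ₘ⟮𝓡 (2 * n), 𝓡 (2 * n)⟯ M}

omit [MeasurableSpace M] in
/-- Near a point, the local expressions of a smooth family of Hamiltonian vector fields are
uniformly Lipschitz. -/
theorem exists_lipschitz_localSgrad (hab : a < b) {F : ℝ → M → ℝ}
    (hF : ContMDiffOn (𝓘(ℝ, ℝ).prod (𝓡 (2 * n))) 𝓘(ℝ, ℝ) ∞ (fun q : ℝ × M => F q.1 q.2)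
      (Set.Icc a b ×ˢ Set.univ)) (x : M) {t₀ : ℝ} (ht₀ : t₀ ∈ Set.Icc a b) :
    ∃ (L : NNReal) (δ r : ℝ), 0 < δ ∧ 0 < r ∧
      Metric.ball (extChartAt (𝓡 (2 * n)) x x) r ⊆ (extChartAt (𝓡 (2 * n)) x).target ∧
      ∀ t ∈ Set.Icc a b, |t - t₀| < δ →
        LipschitzOnWith L (localSgrad Ω (F t) x) (Metric.ball (extChartAt (𝓡 (2 * n)) x x) r) := by
  set φ := extChartAt (𝓡 (2 * n)) x with hφ
  have hx : φ x ∈ φ.target := mem_extChartAt_target x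
  obtain ⟨r, hr, hball⟩ := Metric.mem_nhds_iff.1 (mem_extChartAt_target_nhds hx)
  set s : Set (ℝ × Model n) := Set.Icc a b ×ˢ Metric.ball (φ x) r with hs
  have hsu : UniqueDiffOn ℝ s := (uniqueDiffOn_Icc hab).prod Metric.isOpen_ball.uniqueDiffOn
  set W : ℝ × Model n → ℝ := fun q => F q.1 (φ.symm q.2) with hW
  have hWs : ContDiffOn ℝ ∞ W s := by
    rw [← contMDiffOn_iff_contDiffOn]
    intro q hq
    have e1 : ContMDiffAt 𝓘(ℝ, ℝ × Model n) (𝓡 (2 * n)) ∞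
        (fun q : ℝ × Model n => φ.symm q.2) q :=
      (contMDiffAt_extChartAt_symm_target (hball hq.2)).comp q contDiffAt_snd.contMDiffAt
    exact (hF _ ⟨hq.1, trivial⟩).comp q
      (contDiffAt_fst.contMDiffAt.prodMk e1).contMDiffWithinAt fun q hq => ⟨hq.1, trivial⟩
  -- the field, as a smooth function of time and position
  set V : ℝ × Model n → Model n := fun q =>
    (bilinOfForm (Model n) (formInChart Ω.toForm x q.2)).inverse
      (-(fderivWithin ℝ W s q).comp (ContinuousLinearMap.inr ℝ ℝ (Model n))) with hV
  have hVeq : ∀ q ∈ s, V q = localSgrad Ω (F q.1) x q.2 := by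
    intro q hq
    have h1 : HasFDerivWithinAt (fun y : Model n => (q.1, y)) (ContinuousLinearMap.inr ℝ ℝ (Model n))
        (Metric.ball (φ x) r) q.2 := (hasFDerivAt_prodMk_right q.1 q.2).hasFDerivWithinAt
    have h2 := HasFDerivWithinAt.comp (f := fun y : Model n => (q.1, y)) q.2
      ((hWs.differentiableOn (by simp)) _ hq).hasFDerivWithinAt h1 fun y hy => ⟨hq.1, hy⟩
    have h3 := h2.hasFDerivAt (Metric.isOpen_ball.mem_nhds hq.2)
    have h4 : fderiv ℝ (inChart (F q.1) x) q.2 =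
        (fderivWithin ℝ W s q).comp (ContinuousLinearMap.inr ℝ ℝ (Model n)) := h3.fderiv
    rw [localSgrad, h4]
  have hmem : (t₀, φ x) ∈ s := ⟨ht₀, Metric.mem_ball_self hr⟩
  have hVc : ContDiffWithinAt ℝ 1 V s (t₀, φ x) := by
    have h1 : ContDiffAt ℝ ∞ (fun y => bilinOfForm (Model n) (formInChart Ω.toForm x y)) (φ x) :=
      ContDiffAt.comp (g := bilinOfForm (Model n)) (φ x)
        (ContinuousLinearMap.contDiff _).contDiffAt
        ((Ω.smooth x).contDiffAt (mem_extChartAt_target_nhds hx))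
    have h2 := (isInvertible_bilinOfForm Ω hx).contDiffAt_map_inverse (n := ∞)
    have h3 : ContDiffAt ℝ ∞ (fun q : ℝ × Model n =>
        (bilinOfForm (Model n) (formInChart Ω.toForm x q.2)).inverse) (t₀, φ x) :=
      (h2.comp (φ x) h1).comp (t₀, φ x) contDiffAt_snd
    have h4 : ContDiffWithinAt ℝ ∞ (fun q =>
        -(fderivWithin ℝ W s q).comp (ContinuousLinearMap.inr ℝ ℝ (Model n))) s (t₀, φ x) :=
      (((hWs.fderivWithin hsu (m := ∞) (by simp)) _ hmem).clm_comp contDiffWithinAt_const).neg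
    exact (h3.contDiffWithinAt.clm_apply h4).of_le (by simp)
  obtain ⟨L, N, hN, hL⟩ := hVc.exists_lipschitzOnWith ((convex_Icc a b).prod (convex_ball _ _))
  obtain ⟨ρ, hρ, hρN⟩ := Metric.mem_nhdsWithin_iff.1 hN
  refine ⟨L, ρ, min ρ r, hρ, lt_min hρ hr,
    (Metric.ball_subset_ball (min_le_right _ _)).trans hball, fun t ht htd => ?_⟩
  have hin : ∀ y ∈ Metric.ball (φ x) (min ρ r), (t, y) ∈ N ∧ (t, y) ∈ s := by
    intro y hy
    have h1 : (t, y) ∈ s := ⟨ht, Metric.ball_subset_ball (min_le_right _ _) hy⟩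
    refine ⟨hρN ⟨?_, h1⟩, h1⟩
    rw [Metric.mem_ball, Prod.dist_eq, max_lt_iff]
    exact ⟨by rwa [Real.dist_eq], lt_of_lt_of_le hy (min_le_left _ _)⟩
  intro y hy z hz
  have h1 := hL (hin y hy).1 (hin z hz).1
  rw [hVeq _ (hin y hy).2, hVeq _ (hin z hz).2] at h1
  refine h1.trans (le_of_eq ?_)
  rw [Prod.edist_eq]
  simp

omit [MeasurableSpace M] in
/-- The velocity of a Hamiltonian path, in a chart. -/
theorem Generates.hasDerivWithinAt_chart (hab : a < b) {F : ℝ → M → ℝ} (hf : Generates Ω a b F f)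
    (hfs : ContMDiffOn (𝓘(ℝ, ℝ).prod (𝓡 (2 * n))) (𝓡 (2 * n)) ∞ (fun q : ℝ × M => f q.1 q.2)
      (Set.Icc a b ×ˢ Set.univ))
    (hF : ∀ t ∈ Set.Icc a b, ContMDiff (𝓡 (2 * n)) 𝓘(ℝ, ℝ) ∞ (F t)) {t : ℝ} (ht : t ∈ Set.Icc a b)
    {c y : M} (hc : f t y ∈ (extChartAt (𝓡 (2 * n)) c).source) :
    HasDerivWithinAt (fun s => extChartAt (𝓡 (2 * n)) c (f s y))
      (localSgrad Ω (F t) c (extChartAt (𝓡 (2 * n)) c (f t y))) (Set.Icc a b) t := by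
  set φ := extChartAt (𝓡 (2 * n)) c with hφ
  have hΓ : ContMDiffOn 𝓘(ℝ, ℝ) (𝓡 (2 * n)) ∞ (fun s => f s y) (Set.Icc a b) :=
    hfs.comp (contMDiff_id.prodMk contMDiff_const).contMDiffOn fun s hs => ⟨hs, trivial⟩
  have hu := uniqueDiffOn_Icc hab
  have h1 := ((chart_comp_contDiffWithinAt hΓ ht hc).differentiableWithinAt (by simp))
  have h2 := h1.hasFDerivWithinAt.hasDerivWithinAt
  have hz : φ (f t y) ∈ φ.target := φ.map_source hc
  have hzz : φ.symm (φ (f t y)) = f t y := φ.left_inv hc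
  set v : Model n := fderivWithin ℝ (fun s => φ (f s y)) (Set.Icc a b) t 1 with hv
  obtain ⟨X, hX⟩ := hf.exists_field
  have h3 : chartVec c (φ (f t y)) v = X t (f t y) := by
    have h4 := mfderivWithin_eq_chart hu hΓ ht hc
    have h5 := ((hX t ht).2 y).mfderivWithin (uniqueMDiffWithinAt_iff_uniqueDiffWithinAt.2 (hu t ht))
    have h6 := congrArg (fun A : ℝ →L[ℝ] Model n => A 1) (h4.symm.trans h5)
    exact h6.trans (one_smul ℝ (X t (f t y)))
  obtain ⟨J, hJ⟩ := isInvertible_bilinOfForm Ω hz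
  suffices heq : localSgrad Ω (F t) c (φ (f t y)) = v by rw [heq]; exact h2
  refine J.injective ?_
  ext w
  have h7 : J (localSgrad Ω (F t) c (φ (f t y))) w = -fderiv ℝ (inChart (F t) c) (φ (f t y)) w := by
    rw [← formInChart_localSgrad Ω (F t) hz w, ← bilinOfForm_apply, ← hJ]
    rfl
  have h8 : J v w = formAt Ω (φ.symm (φ (f t y))) ![chartVec c (φ (f t y)) v,
      chartVec c (φ (f t y)) w] := by
    rw [← bilinOfForm_formInChart, ← hJ]
    rfl
  rw [h7, h8, h3, fderiv_inChart (hF t ht) hz, hzz]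
  exact ((hX t ht).1 _ _).symm

omit [MeasurableSpace M] in
/-- A point that is critical for all the Hamiltonians `F t` is a constant trajectory, by uniqueness
for ordinary differential equations in a chart. -/
theorem Generates.apply_eq_of_differential_eq_zero [T2Space M] (hab : a < b) {F : ℝ → M → ℝ}
    (hf : Generates Ω a b F f)
    (hfs : ContMDiffOn (𝓘(ℝ, ℝ).prod (𝓡 (2 * n))) (𝓡 (2 * n)) ∞ (fun q : ℝ × M => f q.1 q.2)
      (Set.Icc a b ×ˢ Set.univ))
    (hF : ContMDiffOn (𝓘(ℝ, ℝ).prod (𝓡 (2 * n))) 𝓘(ℝ, ℝ) ∞ (fun q : ℝ × M => F q.1 q.2)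
      (Set.Icc a b ×ˢ Set.univ)) {x y : M}
    (hx : ∀ t ∈ Set.Icc a b, ∀ w : Model n, differential (F t) x w = 0) (hy : f a y = x) :
    ∀ t ∈ Set.Icc a b, f t y = x := by
  have hFs : ∀ t ∈ Set.Icc a b, ContMDiff (𝓡 (2 * n)) 𝓘(ℝ, ℝ) ∞ (F t) := fun t ht =>
    family_contMDiff hF ht
  have hΓ : ContinuousOn (fun s => f s y) (Set.Icc a b) :=
    (hfs.comp (contMDiff_id.prodMk contMDiff_const).contMDiffOn
      fun s hs => ⟨hs, trivial⟩ : ContMDiffOn 𝓘(ℝ, ℝ) (𝓡 (2 * n)) ∞ (fun s => f s y)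
        (Set.Icc a b)).continuousOn
  have hclosed : IsClosed ({t | f t y = x} ∩ Set.Icc a b) := by
    rw [Set.inter_comm]
    exact hΓ.preimage_isClosed_of_isClosed isClosed_Icc (isClosed_singleton (x := x))
  refine IsClosed.Icc_subset_of_forall_mem_nhdsWithin hclosed hy ?_
  rintro t₀ ⟨ht₀x, ht₀⟩
  change f t₀ y = x at ht₀x
  have ht₀I : t₀ ∈ Set.Icc a b := ⟨ht₀.1, ht₀.2.le⟩
  set φ := extChartAt (𝓡 (2 * n)) x with hφ
  obtain ⟨L, δ, r, hδ, hr, hball, hL⟩ := exists_lipschitz_localSgrad (Ω := Ω) hab hF x ht₀I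
  have hxs : x ∈ φ.source := mem_extChartAt_source x
  -- near `t₀` the trajectory stays in the domain of the estimate
  have hnear : ∀ᶠ t in nhdsWithin t₀ (Set.Icc a b), f t y ∈ φ.source ∧
      φ (f t y) ∈ Metric.ball (φ x) r := by
    have h1 : φ.source ∩ φ ⁻¹' Metric.ball (φ x) r ∈ nhds (f t₀ y) := by
      rw [ht₀x]
      exact Filter.inter_mem ((isOpen_extChartAt_source x).mem_nhds hxs)
        ((continuousAt_extChartAt (I := 𝓡 (2 * n)) x).preimage_mem_nhds (Metric.ball_mem_nhds _ hr))
    exact (hΓ t₀ ht₀I).preimage_mem_nhdsWithin h1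
  obtain ⟨ρ, hρ, hρN⟩ := Metric.mem_nhdsWithin_iff.1 hnear
  set t₁ := min b (t₀ + min δ ρ / 2) with ht₁
  have hδρ : 0 < min δ ρ := lt_min hδ hρ
  have ht₀₁ : t₀ < t₁ := lt_min ht₀.2 (by linarith)
  have hsub : Set.Icc t₀ t₁ ⊆ Set.Icc a b := Set.Icc_subset_Icc ht₀.1 (min_le_left _ _)
  have hdist : ∀ t ∈ Set.Icc t₀ t₁, |t - t₀| < min δ ρ := by
    intro t ht
    have h1 : t ≤ t₀ + min δ ρ / 2 := ht.2.trans (min_le_right _ _)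
    rw [abs_of_nonneg (by linarith [ht.1])]
    linarith
  have hin : ∀ t ∈ Set.Icc t₀ t₁, f t y ∈ φ.source ∧ φ (f t y) ∈ Metric.ball (φ x) r := by
    intro t ht
    refine hρN ⟨?_, hsub ht⟩
    rw [Metric.mem_ball, Real.dist_eq]
    exact (hdist t ht).trans_le (min_le_right _ _)
  have hzero : ∀ t ∈ Set.Icc a b, localSgrad Ω (F t) x (φ x) = 0 := by
    intro t ht
    have h1 : fderiv ℝ (inChart (F t) x) (φ x) = 0 := by
      ext w
      rw [fderiv_inChart (hFs t ht) (mem_extChartAt_target x), extChartAt_to_inv]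
      exact hx t ht _
    rw [localSgrad, h1, neg_zero, map_zero]
  have hder : ∀ t ∈ Set.Icc t₀ t₁, HasDerivWithinAt (fun s => φ (f s y))
      (localSgrad Ω (F t) x (φ (f t y))) (Set.Icc a b) t := fun t ht =>
    hf.hasDerivWithinAt_chart hab hfs hFs (hsub ht) (hin t ht).1
  have hmem : ∀ t ∈ Set.Ico t₀ t₁, Set.Icc a b ∈ nhdsWithin t (Set.Ici t) := by
    intro t ht
    refine Filter.mem_of_superset (Icc_mem_nhdsGE (show t < b from ht.2.trans_le (min_le_left _ _)))
      (Set.Icc_subset_Icc (ht₀.1.trans ht.1) le_rfl)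
  have heq := ODE_solution_unique_of_mem_Icc_right (v := fun t => localSgrad Ω (F t) x)
    (s := fun _ => Metric.ball (φ x) r) (K := L) (f := fun s => φ (f s y)) (g := fun _ => φ x)
    (a := t₀) (b := t₁)
    (fun t ht => hL t (hsub ⟨ht.1, ht.2.le⟩)
      ((hdist t ⟨ht.1, ht.2.le⟩).trans_le (min_le_left _ _)))
    (fun t ht => ((hder t ht).continuousWithinAt).mono hsub)
    (fun t ht => (hder t ⟨ht.1, ht.2.le⟩).mono_of_mem_nhdsWithin (hmem t ht))
    (fun t ht => (hin t ⟨ht.1, ht.2.le⟩).2) continuousOn_const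
    (fun t ht => by
      rw [hzero t (hsub ⟨ht.1, ht.2.le⟩)]
      exact hasDerivWithinAt_const _ _ _)
    (fun t _ => Metric.mem_ball_self hr) (by change φ (f t₀ y) = φ x; rw [ht₀x])
  filter_upwards [Ioc_mem_nhdsGT ht₀₁] with t ht
  exact φ.injOn (hin t ⟨ht.1.le, ht.2⟩).1 hxs (heq ⟨ht.1.le, ht.2⟩)

end

/-! ### The first variation along trajectories -/

section

variable {n : ℕ} {M : Type*} [TopologicalSpace M] [ChartedSpace (Model n) M]
  [MeasurableSpace M] [IsManifold (𝓡 (2 * n)) ∞ M] {Ω : SymplecticForm n M} {a b ε₀ : ℝ}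
  {f : ℝ → M ≃ₘ⟮𝓡 (2 * n), 𝓡 (2 * n)⟯ M} {g : ℝ × ℝ → M ≃ₘ⟮𝓡 (2 * n), 𝓡 (2 * n)⟯ M}
  {G : ℝ × ℝ → M → ℝ}

/-- The first variation of the Hamiltonian, integrated along the trajectories `t ↦ f_t y`, does not
depend on `y`: in the chart at `c`, with `Γ(t, ε, y) = g_{t,ε}(y)`, its differential is the integral
over `t` of `-∂ₜ (Γ^* Ω)(∂_ε, ·)`, and `∂_ε Γ` vanishes at both ends. -/
theorem IsVariation.hasFDerivAt_integral_derivSnd (hab : a < b) (hvar : IsVariation Ω a b f ε₀ g)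
    (hG : IsHamiltonianOfVariation Ω a b ε₀ G g) (c : M) {y₀ : Model n}
    (hy₀ : y₀ ∈ (extChartAt (𝓡 (2 * n)) c).target) :
    HasFDerivAt (inChart (fun x => ∫ t in a..b, derivSnd G (t, 0) (g (t, 0) x)) c)
      (0 : Model n →L[ℝ] ℝ) y₀ := by
  set φ := extChartAt (𝓡 (2 * n)) c with hφ
  set S : Set (ℝ × ℝ) := Set.Icc a b ×ˢ Set.Ioo (-ε₀) ε₀ with hS
  set SQ : Set ((ℝ × ℝ) × Model n) := S ×ˢ φ.target with hSQ
  have hε₀ := hvar.pos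
  have h0 : (0 : ℝ) ∈ Set.Ioo (-ε₀) ε₀ := ⟨by linarith, hε₀⟩
  have hto : IsOpen φ.target := isOpen_extChartAt_target c
  have hSu : UniqueDiffOn ℝ S := uniqueDiffOn_strip hab ε₀
  have hSQu : UniqueDiffOn ℝ SQ := hSu.prod hto.uniqueDiffOn
  have hcl : ∀ q ∈ SQ, q ∈ closure (interior SQ) := by
    intro q hq
    rw [hSQ, hS, interior_prod_eq, interior_prod_eq, interior_Icc, isOpen_Ioo.interior_eq,
      hto.interior_eq, closure_prod_eq, closure_prod_eq, closure_Ioo hab.ne]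
    exact ⟨⟨hq.1.1, subset_closure hq.1.2⟩, subset_closure hq.2⟩
  set Γ : (ℝ × ℝ) × Model n → M := fun q => g q.1 (φ.symm q.2) with hΓdef
  have hΓ : ContMDiffOn 𝓘(ℝ, (ℝ × ℝ) × Model n) (𝓡 (2 * n)) ∞ Γ SQ := by
    intro q hq
    have e1 : ContMDiffAt 𝓘(ℝ, (ℝ × ℝ) × Model n) (𝓡 (2 * n)) ∞
        (fun q : (ℝ × ℝ) × Model n => φ.symm q.2) q :=
      (contMDiffAt_extChartAt_symm_target hq.2).comp q contDiffAt_snd.contMDiffAt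
    exact (hvar.smooth.smooth _ ⟨hq.1, trivial⟩).comp q
      (contDiffAt_fst.contMDiffAt.prodMk e1).contMDiffWithinAt fun q hq => ⟨hq.1, trivial⟩
  have hfam : ∀ {H : ℝ × ℝ → M → ℝ}, ContMDiffOn (𝓘(ℝ, ℝ × ℝ).prod (𝓡 (2 * n))) 𝓘(ℝ, ℝ) ∞
      (fun q : (ℝ × ℝ) × M => H q.1 q.2) (S ×ˢ Set.univ) →
      ContDiffOn ℝ ∞ (fun q : (ℝ × ℝ) × Model n => H q.1 (Γ q)) SQ := by
    intro H hH
    rw [← contMDiffOn_iff_contDiffOn]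
    exact hH.comp (contDiff_fst.contMDiff.contMDiffOn.prodMk hΓ) fun q hq => ⟨hq.1, trivial⟩
  have hGs := hG.normalized.smooth
  have hB := hfam hGs
  set fu : (ℝ × ℝ) × Model n → ℝ := fun q => derivSnd G q.1 (Γ q) with hfu
  have hfus : ContDiffOn ℝ ∞ fu SQ := hfam (derivSnd_contMDiffOn hGs hab)
  -- the contraction of `Γ^* Ω` with `∂ₜ`
  have hpull : ∀ u : (ℝ × ℝ) × Model n, ∀ q ∈ SQ, pull Ω Γ SQ ((1, 0), 0) u q =
      fderivWithin ℝ (fun p => G p (Γ q)) S q.1 u.1 -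
        fderivWithin ℝ (fun q : (ℝ × ℝ) × Model n => G q.1 (Γ q)) SQ q u := by
    intro u q hq
    obtain ⟨X, hX⟩ := hG.generates q.1.2 hq.1.2
    have e1 : mfderivWithin 𝓘(ℝ, (ℝ × ℝ) × Model n) (𝓡 (2 * n)) Γ SQ q ((1, 0), 0) =
        X q.1.1 (Γ q) := by
      have h1 : HasDerivWithinAt (fun s : ℝ => ((s, q.1.2), q.2))
          (((1, 0), 0) : (ℝ × ℝ) × Model n) (Set.Icc a b) q.1.1 :=
        (((hasDerivAt_id q.1.1).prodMk (hasDerivAt_const q.1.1 q.1.2)).prodMk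
          (hasDerivAt_const q.1.1 q.2)).hasDerivWithinAt
      have h2 := HasMFDerivWithinAt.comp (f := fun s : ℝ => ((s, q.1.2), q.2)) q.1.1
        ((hΓ.mdifferentiableOn (by simp)) q hq).hasMFDerivWithinAt
        h1.hasFDerivWithinAt.hasMFDerivWithinAt fun s hs => ⟨⟨hs, hq.1.2⟩, hq.2⟩
      have h3 := (uniqueMDiffWithinAt_iff_uniqueDiffWithinAt.2
        (uniqueDiffOn_Icc hab q.1.1 hq.1.1)).eq h2 ((hX q.1.1 hq.1.1).2 (φ.symm q.2))
      have h4 := congrArg (fun A : ℝ →L[ℝ] Model n => A 1) h3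
      refine Eq.trans ?_ (h4.trans (one_smul ℝ (X q.1.1 (Γ q) : Model n)))
      exact congrArg (mfderivWithin 𝓘(ℝ, (ℝ × ℝ) × Model n) (𝓡 (2 * n)) Γ SQ q)
        (one_smul ℝ (((1, 0), 0) : (ℝ × ℝ) × Model n)).symm
    exact pull_of_isSgrad (G := G) hSu hGs hSQu hΓ (ContinuousLinearMap.fst ℝ (ℝ × ℝ) (Model n))
      (fun q hq => hq.1) hq ((hX q.1.1 hq.1.1).1) e1 u
  have hpu : ∀ q ∈ SQ, pull Ω Γ SQ ((1, 0), 0) ((0, 1), 0) q = fu q -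
      fderivWithin ℝ (fun q : (ℝ × ℝ) × Model n => G q.1 (Γ q)) SQ q ((0, 1), 0) := by
    intro q hq
    rw [hpull _ q hq]
    congr 1
    exact ((hasDerivAt_snd_of_strip hq.1 (((family_contDiffOn_param hGs rfl (Γ q)).differentiableOn
      (by simp)) q.1 hq.1)).deriv).symm
  have hpw : ∀ w : Model n, ∀ q ∈ SQ, pull Ω Γ SQ ((1, 0), 0) ((0, 0), w) q =
      (fun _ => (0 : ℝ)) q -
      fderivWithin ℝ (fun q : (ℝ × ℝ) × Model n => G q.1 (Γ q)) SQ q ((0, 0), w) := by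
    intro w q hq
    rw [hpull _ q hq]
    congr 1
    exact (fderivWithin ℝ (fun p => G p (Γ q)) S q.1).map_zero
  have hclosed : ∀ w : Model n, ∀ q ∈ SQ,
      fderivWithin ℝ (pull Ω Γ SQ ((0, 1), 0) ((0, 0), w)) SQ q ((1, 0), 0) =
        -fderivWithin ℝ fu SQ q ((0, 0), w) := by
    intro w q hq
    have := fderivWithin_pull_of_potential hSQu hΓ hq (hcl q hq) hB
      ((hfus.differentiableOn (by simp)) q hq) (differentiableWithinAt_const 0) hpu (hpw w)
    rw [this]
    simp
  -- the end points are fixed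
  have hend : ∀ w : Model n, ∀ t, t ∈ Set.Icc a b → (∀ ε ∈ Set.Ioo (-ε₀) ε₀, g (t, ε) = f t) →
      pull Ω Γ SQ ((0, 1), 0) ((0, 0), w) ((t, 0), y₀) = 0 := by
    intro w t ht hgt
    have hq : (((t, 0), y₀) : (ℝ × ℝ) × Model n) ∈ SQ := ⟨⟨ht, h0⟩, hy₀⟩
    have e1 : (mfderivWithin 𝓘(ℝ, (ℝ × ℝ) × Model n) (𝓡 (2 * n)) Γ SQ ((t, 0), y₀) ((0, 1), 0) :
        Model n) = 0 := by
      have h1 : HasDerivWithinAt (fun s : ℝ => ((t, s), y₀))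
          (((0, 1), 0) : (ℝ × ℝ) × Model n) (Set.Ioo (-ε₀) ε₀) 0 :=
        (((hasDerivAt_const (0 : ℝ) t).prodMk (hasDerivAt_id (0 : ℝ))).prodMk
          (hasDerivAt_const (0 : ℝ) y₀)).hasDerivWithinAt
      have h2 := HasMFDerivWithinAt.comp (f := fun s : ℝ => ((t, s), y₀)) 0
        ((hΓ.mdifferentiableOn (by simp)) _ hq).hasMFDerivWithinAt
        h1.hasFDerivWithinAt.hasMFDerivWithinAt fun s hs => ⟨⟨ht, hs⟩, hy₀⟩
      have h3 : HasMFDerivWithinAt 𝓘(ℝ, ℝ) (𝓡 (2 * n)) (Γ ∘ fun s : ℝ => ((t, s), y₀))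
          (Set.Ioo (-ε₀) ε₀) 0 (0 : ℝ →L[ℝ] Model n) := by
        refine HasMFDerivWithinAt.congr_mono (hasMFDerivWithinAt_const (f t (φ.symm y₀)) _ _)
          (fun s hs => ?_) ?_ subset_rfl
        · change g (t, s) (φ.symm y₀) = _
          rw [hgt s hs]
        · change g (t, 0) (φ.symm y₀) = _
          rw [hgt 0 h0]
      have h4 := (uniqueMDiffWithinAt_iff_uniqueDiffWithinAt.2
        (isOpen_Ioo.uniqueDiffOn 0 h0)).eq h2 h3
      refine Eq.trans ?_ (congrArg (fun A : ℝ →L[ℝ] Model n => A 1) h4)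
      exact congrArg (mfderivWithin 𝓘(ℝ, (ℝ × ℝ) × Model n) (𝓡 (2 * n)) Γ SQ ((t, 0), y₀))
        (one_smul ℝ (((0, 1), 0) : (ℝ × ℝ) × Model n)).symm
    have e2 : ∀ z : Model n, formAt Ω (Γ ((t, 0), y₀)) ![(0 : Model n), z] = 0 := fun z =>
      congrArg (fun A : Model n →L[ℝ] ℝ => A z)
        (bilinOfForm (Model n) (formAt Ω (Γ ((t, 0), y₀)))).map_zero
    change formAt Ω (Γ ((t, 0), y₀)) ![(mfderivWithin 𝓘(ℝ, (ℝ × ℝ) × Model n) (𝓡 (2 * n)) Γ SQ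
      ((t, 0), y₀) ((0, 1), 0) : Model n), (mfderivWithin 𝓘(ℝ, (ℝ × ℝ) × Model n) (𝓡 (2 * n)) Γ SQ
      ((t, 0), y₀) ((0, 0), w) : Model n)] = 0
    rw [e1]
    exact e2 _
  -- differentiation under the integral sign
  obtain ⟨r, hr, hball⟩ := Metric.nhds_basis_closedBall.mem_iff.1 (hto.mem_nhds hy₀)
  set F' : Model n → ℝ → Model n →L[ℝ] ℝ := fun y t =>
    (fderivWithin ℝ fu SQ ((t, 0), y)).comp (ContinuousLinearMap.inr ℝ (ℝ × ℝ) (Model n)) with hF'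
  have hdfu : ContinuousOn (fderivWithin ℝ fu SQ) SQ :=
    (hfus.fderivWithin hSQu (m := ∞) (by simp)).continuousOn
  have hF'c : ContinuousOn (fun q : ℝ × Model n => F' q.2 q.1)
      (Set.Icc a b ×ˢ Metric.closedBall y₀ r) := by
    have h1 : ContinuousOn (fun q : ℝ × Model n => fderivWithin ℝ fu SQ ((q.1, 0), q.2))
        (Set.Icc a b ×ˢ Metric.closedBall y₀ r) :=
      hdfu.comp (by fun_prop) fun q hq => ⟨⟨hq.1, h0⟩, hball hq.2⟩
    exact h1.clm_comp continuousOn_const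
  have hFd : ∀ t ∈ Set.Icc a b, ∀ y ∈ φ.target, HasFDerivAt (fun y => fu ((t, 0), y)) (F' y t) y := by
    intro t ht y hy
    have h1 : HasFDerivWithinAt (fun y : Model n => ((t, (0 : ℝ)), y))
        (ContinuousLinearMap.inr ℝ (ℝ × ℝ) (Model n)) φ.target y :=
      (hasFDerivAt_prodMk_right (t, (0 : ℝ)) y).hasFDerivWithinAt
    have h2 := HasFDerivWithinAt.comp (f := fun y : Model n => ((t, (0 : ℝ)), y)) y
      ((hfus.differentiableOn (by simp)) ((t, 0), y) ⟨⟨ht, h0⟩, hy⟩).hasFDerivWithinAt h1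
      fun z hz => ⟨⟨ht, h0⟩, hz⟩
    exact h2.hasFDerivAt (hto.mem_nhds hy)
  obtain ⟨C, hC⟩ := ((isCompact_Icc.prod (isCompact_closedBall y₀ r)).image_of_continuousOn
    hF'c.norm).bddAbove
  have hfc : ∀ y ∈ φ.target, ContinuousOn (fun t => fu ((t, 0), y)) (Set.Icc a b) := fun y hy =>
    hfus.continuousOn.comp (by fun_prop) fun t ht => ⟨⟨ht, h0⟩, hy⟩
  have hF'c0 : ContinuousOn (F' y₀) (Set.Icc a b) :=
    hF'c.comp (f := fun t : ℝ => (t, y₀)) (by fun_prop)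
      fun t ht => ⟨ht, Metric.mem_closedBall_self hr.le⟩
  have hIoc : Set.uIoc a b ⊆ Set.Icc a b := by
    rw [Set.uIoc_of_le hab.le]
    exact Set.Ioc_subset_Icc_self
  have hmain := intervalIntegral.hasFDerivAt_integral_of_dominated_of_fderiv_le (μ := volume)
    (𝕜 := ℝ) (a := a) (b := b) (F := fun y t => fu ((t, 0), y)) (F' := F') (x₀ := y₀)
    (bound := fun _ => C) (Metric.ball_mem_nhds y₀ hr)
    (by
      filter_upwards [hto.mem_nhds hy₀] with y hy
      exact ((hfc y hy).mono hIoc).aestronglyMeasurable measurableSet_uIoc)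
    (ContinuousOn.intervalIntegrable (by rw [Set.uIcc_of_le hab.le]; exact hfc y₀ hy₀))
    ((hF'c0.mono hIoc).aestronglyMeasurable measurableSet_uIoc)
    (Filter.Eventually.of_forall fun t ht y hy =>
      hC ⟨(t, y), ⟨hIoc ht, Metric.ball_subset_closedBall hy⟩, rfl⟩)
    (continuous_const.intervalIntegrable _ _)
    (Filter.Eventually.of_forall fun t ht y hy =>
      hFd t (hIoc ht) y (hball (Metric.ball_subset_closedBall hy)))
  refine hmain.congr_fderiv ?_
  -- the derivative is computed by the fundamental theorem of calculus
  have hF'int : IntervalIntegrable (F' y₀) volume a b :=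
    ContinuousOn.intervalIntegrable (by rw [Set.uIcc_of_le hab.le]; exact hF'c0)
  ext w
  rw [ContinuousLinearMap.intervalIntegral_apply hF'int]
  set P : ℝ → ℝ := fun t => pull Ω Γ SQ ((0, 1), 0) ((0, 0), w) ((t, 0), y₀) with hP
  have hPs := pull_contDiffOn Ω hSQu hΓ ((0, 1), 0) ((0, 0), w)
  have hPd : ∀ t ∈ Set.Icc a b, HasDerivWithinAt P (-(F' y₀ t w)) (Set.Icc a b) t := by
    intro t ht
    have hq : (((t, 0), y₀) : (ℝ × ℝ) × Model n) ∈ SQ := ⟨⟨ht, h0⟩, hy₀⟩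
    have h1 : HasDerivWithinAt (fun s : ℝ => ((s, (0 : ℝ)), y₀))
        (((1, 0), 0) : (ℝ × ℝ) × Model n) (Set.Icc a b) t :=
      (((hasDerivAt_id t).prodMk (hasDerivAt_const t (0 : ℝ))).prodMk
        (hasDerivAt_const t y₀)).hasDerivWithinAt
    have h2 := HasFDerivWithinAt.comp_hasDerivWithinAt (f := fun s : ℝ => ((s, (0 : ℝ)), y₀)) t
      ((hPs.differentiableOn (by simp)) _ hq).hasFDerivWithinAt h1
      fun s hs => ⟨⟨hs, h0⟩, hy₀⟩
    exact h2.congr_deriv (hclosed w _ hq)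
  have hint := intervalIntegral.integral_eq_sub_of_hasDerivAt_of_le hab.le
    (fun t ht => (hPd t ht).continuousWithinAt)
    (fun t ht => (hPd t (Set.Ioo_subset_Icc_self ht)).hasDerivAt (Icc_mem_nhds ht.1 ht.2))
    (ContinuousOn.intervalIntegrable (by
      rw [Set.uIcc_of_le hab.le]
      exact (hF'c0.clm_apply continuousOn_const).neg))
  have hPa : P a = 0 := hend w a (Set.left_mem_Icc.2 hab.le) hvar.left
  have hPb : P b = 0 := hend w b (Set.right_mem_Icc.2 hab.le) hvar.right
  rw [hPa, hPb, intervalIntegral.integral_neg, sub_zero, neg_eq_zero] at hint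
  exact hint

theorem IsVariation.integral_derivSnd_eq [ConnectedSpace M] (hab : a < b)
    (hvar : IsVariation Ω a b f ε₀ g) (hG : IsHamiltonianOfVariation Ω a b ε₀ G g) (x y : M) :
    ∫ t in a..b, derivSnd G (t, 0) (g (t, 0) x) = ∫ t in a..b, derivSnd G (t, 0) (g (t, 0) y) :=
  eq_of_fderiv_inChart_eq_zero
    (u := fun x => ∫ t in a..b, derivSnd G (t, 0) (g (t, 0) x))
    (fun c _ hy => hvar.hasFDerivAt_integral_derivSnd hab hG c hy) x y

end

/-! ### Fixed extrema give geodesics -/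

section

/-- The oscillation is convex along affine families of functions. -/
theorem convexOn_osc_add_smul {Z : Type*} [TopologicalSpace Z] [CompactSpace Z] [Nonempty Z]
    (A B : C(Z, ℝ)) {s : Set ℝ} (hs : Convex ℝ s) : ConvexOn ℝ s fun e => osc ⇑(A + e • B) := by
  refine ⟨hs, fun x _ y _ r q hr hq hrq => osc_le fun z w => ?_⟩
  have h1 := mul_le_mul_of_nonneg_left (sub_le_osc (A + x • B) z w) hr
  have h2 := mul_le_mul_of_nonneg_left (sub_le_osc (A + y • B) z w) hq
  simp only [ContinuousMap.add_apply, ContinuousMap.smul_apply, smul_eq_mul] at h1 h2 ⊢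
  calc A z + (r * x + q * y) * B z - (A w + (r * x + q * y) * B w)
      = r * (A z + x * B z - (A w + x * B w)) + q * (A z + y * B z - (A w + y * B w)) := by
        linear_combination (-(A z - A w)) * hrq
    _ ≤ _ := add_le_add h1 h2

/-- The integral of a continuous family of convex functions is convex. -/
theorem convexOn_intervalIntegral {a b : ℝ} (hab : a ≤ b) {s : Set ℝ} (hs : Convex ℝ s)
    {v : ℝ → ℝ → ℝ} (hv : ∀ t, ConvexOn ℝ s (v t)) (hc : ∀ e, Continuous fun t => v t e) :
    ConvexOn ℝ s fun e => ∫ t in a..b, v t e := by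
  refine ⟨hs, fun x hx y hy r q hr hq hrq => ?_⟩
  have hi : ∀ e, IntervalIntegrable (fun t => v t e) volume a b := fun e =>
    (hc e).intervalIntegrable _ _
  simp only [smul_eq_mul]
  rw [← intervalIntegral.integral_const_mul, ← intervalIntegral.integral_const_mul,
    ← intervalIntegral.integral_add ((hi x).const_mul r) ((hi y).const_mul q)]
  exact intervalIntegral.integral_mono_on hab (hi _) (((hi x).const_mul r).add ((hi y).const_mul q))
    fun t _ => (hv t).2 hx hy hr hq hrq

variable {n : ℕ} {M : Type*} [TopologicalSpace M] [ChartedSpace (Model n) M]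
  [IsManifold (𝓡 (2 * n)) ∞ M]

theorem differential_eq_zero_of_isLocalExtr {u : M → ℝ} (hu : ContMDiff (𝓡 (2 * n)) 𝓘(ℝ, ℝ) ∞ u)
    {x : M} (hx : IsLocalExtr u x) (w : Model n) : differential u x w = 0 := by
  have hy := mem_extChartAt_target (I := 𝓡 (2 * n)) x
  have hyx := extChartAt_to_inv (I := 𝓡 (2 * n)) x
  obtain ⟨D, hD⟩ := isInvertible_chartVec hy
  have h1 := fderiv_inChart hu hy (D.symm w)
  have h2 : IsLocalExtr (inChart u x) (extChartAt (𝓡 (2 * n)) x x) := by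
    have hc := continuousAt_extChartAt_symm'' (I := 𝓡 (2 * n)) hy
    have hx' : IsLocalExtr u ((extChartAt (𝓡 (2 * n)) x).symm (extChartAt (𝓡 (2 * n)) x x)) := by
      rwa [hyx]
    exact hx'.comp_tendsto hc
  have h3 : chartVec x (extChartAt (𝓡 (2 * n)) x x) (D.symm w) = w := by
    rw [← hD]; exact D.apply_symm_apply w
  rw [h2.fderiv_eq_zero, h3, hyx] at h1
  exact h1.symm

variable [MeasurableSpace M] {Ω : SymplecticForm n M} {a b ε₀ : ℝ}
  {f : ℝ → M ≃ₘ⟮𝓡 (2 * n), 𝓡 (2 * n)⟯ M} {g : ℝ × ℝ → M ≃ₘ⟮𝓡 (2 * n), 𝓡 (2 * n)⟯ M}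
  {G : ℝ × ℝ → M → ℝ}

omit [TopologicalSpace M] [ChartedSpace (Model n) M] [IsManifold (𝓡 (2 * n)) ∞ M]
  [MeasurableSpace M] in
/-- The first variation vanishes outside the common support. -/
theorem derivSnd_eq_zero {K : Set M}
    (hG : ∀ p ∈ Set.Icc a b ×ˢ Set.Ioo (-ε₀) ε₀, ∀ x ∉ K, G p x = 0) :
    ∀ p ∈ Set.Icc a b ×ˢ Set.Ioo (-ε₀) ε₀, ∀ x ∉ K, derivSnd G p x = 0 := by
  intro p hp x hx
  have : (fun e => G (p.1, e) x) =ᶠ[nhds p.2] fun _ => (0 : ℝ) := by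
    filter_upwards [isOpen_Ioo.mem_nhds hp.2] with e he
    exact hG (p.1, e) ⟨hp.1, he⟩ x hx
  rw [derivSnd, this.deriv_eq, deriv_const]

/-- The first order expansion in `ε` of a normalized family holds uniformly on `M`. -/
theorem IsNormalizedHamiltonian.exists_taylor_bound (hab : a < b) (hε₀ : 0 < ε₀)
    (hG : IsNormalizedHamiltonian Ω (Set.Icc a b ×ˢ Set.Ioo (-ε₀) ε₀) G) :
    ∃ C, 0 ≤ C ∧ ∀ t ∈ Set.Icc a b, ∀ ε, |ε| ≤ ε₀ / 2 → ∀ x,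
      |G (t, ε) x - (G (t, 0) x + ε * derivSnd G (t, 0) x)| ≤ C * ε ^ 2 := by
  obtain ⟨K, hK, hKG⟩ := hG.exists_compact
  have hG1 := derivSnd_contMDiffOn hG.smooth hab
  have hG2 := derivSnd_contMDiffOn hG1 hab
  have hK2 := derivSnd_eq_zero (derivSnd_eq_zero hKG)
  have hsub : ∀ e ∈ Set.Icc (-(ε₀ / 2)) (ε₀ / 2), e ∈ Set.Ioo (-ε₀) ε₀ := fun e he =>
    ⟨by linarith [he.1], by linarith [he.2]⟩
  obtain ⟨C, hC⟩ := (((isCompact_Icc (a := a) (b := b)).prod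
    (isCompact_Icc (a := -(ε₀ / 2)) (b := ε₀ / 2))).prod hK).bddAbove_image
    (f := fun q : (ℝ × ℝ) × M => |derivSnd (derivSnd G) q.1 q.2|)
    ((hG2.continuousOn.mono fun q hq => ⟨⟨hq.1.1, hsub _ hq.1.2⟩, trivial⟩).abs)
  refine ⟨max C 0, le_max_right _ _, fun t ht ε hε x => ?_⟩
  refine abs_taylor_le (v := fun e => G (t, e) x) (v' := fun e => derivSnd G (t, e) x)
    (v'' := fun e => derivSnd (derivSnd G) (t, e) x)
    (fun e he => family_hasDerivAt hG.smooth (p := (t, e)) ⟨ht, hsub e he⟩ x)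
    (fun e he => family_hasDerivAt hG1 (p := (t, e)) ⟨ht, hsub e he⟩ x) (fun e he => ?_) hε
  by_cases hx : x ∈ K
  · exact (hC ⟨((t, e), x), ⟨⟨ht, he⟩, hx⟩, rfl⟩).trans (le_max_left _ _)
  · rw [hK2 (t, e) ⟨ht, hsub e he⟩ x hx, abs_zero]
    exact le_max_right _ _

variable [ConnectedSpace M] [T2Space M]

/-- A path whose Hamiltonian has fixed extrema is a geodesic. To first order in `ε` the Hamiltonian
of a variation is `G₀ + ε G₁`, so the length is approximated by the integral of the oscillations
of `G₀ + ε G₁`, a convex function of `ε`. It is at least the integral of the difference of the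
values at the fixed extrema `x₊` and `x₋`; these are constant trajectories, so the integrals of
`G₁(x₊)` and `G₁(x₋)` agree, and the bound is the value for `ε = 0`. -/
theorem isGeodesic_of_hasFixedExtrema (hab : a < b) (hf : IsHamiltonianPath Ω a b f)
    {F : ℝ → M → ℝ} (hF : IsHamiltonianOf Ω a b F f) (hfix : HasFixedExtrema a b F) :
    IsGeodesic Ω a b f := by
  obtain ⟨xm, xp, hext, c, hc⟩ := hfix
  refine ⟨⟨F, hF, c, fun t ht => ?_⟩, fun ε₀ g G hvar hG => ?_⟩
  · have h1 : ⨆ x, F t x = F t xp :=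
      le_antisymm (ciSup_le fun x => (hext t ht x).2)
        (le_ciSup (f := F t) ⟨F t xp, by rintro _ ⟨x, rfl⟩; exact (hext t ht x).2⟩ xp)
    have h2 : ⨅ x, F t x = F t xm :=
      le_antisymm (ciInf_le (f := F t) ⟨F t xm, by rintro _ ⟨x, rfl⟩; exact (hext t ht x).1⟩ xm)
        (le_ciInf fun x => (hext t ht x).1)
    rw [osc, h1, h2, hc t ht]
  have hε₀ := hvar.pos
  have h0 : (0 : ℝ) ∈ Set.Ioo (-ε₀) ε₀ := ⟨by linarith, hε₀⟩
  -- the Hamiltonian `G (t, 0)` of the path differs from `F t` by a function of time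
  have hG0 : IsHamiltonianOf Ω a b (fun t => G (t, 0)) f := by
    refine ⟨hG.normalized.slice h0, ?_⟩
    obtain ⟨X, hX⟩ := hG.generates 0 h0
    refine ⟨X, fun t ht => ⟨(hX t ht).1, fun x => ?_⟩⟩
    have e1 : (X t (g (t, 0) x) : Model n) = X t (f t x) := by rw [hvar.center t ht]
    refine HasMFDerivWithinAt.congr_mfderiv (HasMFDerivWithinAt.congr_mono ((hX t ht).2 x)
      (fun s hs => ?_) ?_ subset_rfl)
      (congrArg (fun w : Model n => (1 : ℝ →L[ℝ] ℝ).smulRight w) e1)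
    · change f s x = g (s, 0) x
      rw [hvar.center s hs]
    · change f t x = g (t, 0) x
      rw [hvar.center t ht]
  have hext0 : ∀ t ∈ Set.Icc a b, ∀ x, G (t, 0) xm ≤ G (t, 0) x ∧ G (t, 0) x ≤ G (t, 0) xp := by
    intro t ht x
    have h1 := hG0.sub_eq_sub hab hF ht x xm
    have h2 := hG0.sub_eq_sub hab hF ht x xp
    have h3 := hext t ht x
    exact ⟨by linarith [h3.1], by linarith [h3.2]⟩
  -- the extrema are constant trajectories
  have hfixed : ∀ x, (∀ t ∈ Set.Icc a b, IsLocalExtr (F t) x) → ∀ t ∈ Set.Icc a b,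
      g (t, 0) ((f a).symm x) = x := by
    intro x hx t ht
    rw [hvar.center t ht]
    exact hF.generates.apply_eq_of_differential_eq_zero hab hf.smooth.smooth hF.normalized.smooth
      (fun t ht w => differential_eq_zero_of_isLocalExtr
        (family_contMDiff hF.normalized.smooth ht) (hx t ht) w)
      ((f a).apply_symm_apply x) t ht
  have hfm := hfixed xm fun t ht =>
    Or.inl (Filter.Eventually.of_forall fun x => (hext t ht x).1)
  have hfp := hfixed xp fun t ht =>
    Or.inr (Filter.Eventually.of_forall fun x => (hext t ht x).2)
  have hbal : ∫ t in a..b, derivSnd G (t, 0) xp = ∫ t in a..b, derivSnd G (t, 0) xm := by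
    have h1 := hvar.integral_derivSnd_eq hab hG ((f a).symm xp) ((f a).symm xm)
    have h2 : ∀ x, (∀ t ∈ Set.Icc a b, g (t, 0) ((f a).symm x) = x) →
        ∫ t in a..b, derivSnd G (t, 0) (g (t, 0) ((f a).symm x)) =
          ∫ t in a..b, derivSnd G (t, 0) x := fun x hx =>
      intervalIntegral.integral_congr fun t ht => by
        rw [Set.uIcc_of_le hab.le] at ht
        simp only [hx t ht]
    rwa [h2 xp hfp, h2 xm hfm] at h1
  -- the first order approximation, as a path of continuous functions on a compact set
  obtain ⟨K, hK, hKG⟩ := hG.normalized.exists_compact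
  have hKG1 := derivSnd_eq_zero hKG
  obtain ⟨p, hp⟩ := exists_base_point (M := M) (K ∪ {xm, xp})
  set Z : Set M := insert p (K ∪ {xm, xp}) with hZdef
  have hZ : CompactSpace Z := isCompact_iff_compactSpace.1
    ((hK.union (Set.toFinite _).isCompact).insert p)
  have hne : Nonempty Z := ⟨⟨p, Set.mem_insert p _⟩⟩
  let zm : Z := ⟨xm, Set.mem_insert_of_mem _ (Or.inr (Or.inl rfl))⟩
  let zp : Z := ⟨xp, Set.mem_insert_of_mem _ (Or.inr (Or.inr rfl))⟩
  have hslice : ∀ {H : ℝ × ℝ → M → ℝ}, ContMDiffOn (𝓘(ℝ, ℝ × ℝ).prod (𝓡 (2 * n))) 𝓘(ℝ, ℝ) ∞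
      (fun q : (ℝ × ℝ) × M => H q.1 q.2) ((Set.Icc a b ×ˢ Set.Ioo (-ε₀) ε₀) ×ˢ Set.univ) →
      ContinuousOn (fun q : ℝ × M => H (q.1, 0) q.2) (Set.Icc a b ×ˢ Set.univ) := by
    intro H hH
    exact hH.continuousOn.comp (f := fun q : ℝ × M => ((q.1, (0 : ℝ)), q.2)) (by fun_prop)
      fun q hq => ⟨⟨hq.1, h0⟩, trivial⟩
  obtain ⟨A, hAc, hA⟩ := exists_curve (Z := Z) (F := fun t => G (t, 0)) hab.le
    (hslice hG.normalized.smooth)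
  obtain ⟨B, hBc, hB⟩ := exists_curve (Z := Z) (F := fun t => derivSnd G (t, 0)) hab.le
    (hslice (derivSnd_contMDiffOn hG.normalized.smooth hab))
  obtain ⟨C, hC, htaylor⟩ := hG.normalized.exists_taylor_bound hab hε₀
  have hcont : ∀ e : ℝ, Continuous fun t => osc ⇑(A t + e • B t) := fun e =>
    continuous_osc.comp (hAc.add (hBc.const_smul e))
  have hcv : Convex ℝ (Set.Ioo (-(ε₀ / 2)) (ε₀ / 2)) := convex_Ioo _ _
  have hba : 0 < b - a := sub_pos.2 hab
  refine ⟨fun e => ∫ t in a..b, osc ⇑(A t + e • B t), ε₀ / 2, 2 * C * (b - a) + 1, by positivity,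
    by positivity, convexOn_intervalIntegral hab.le hcv (fun t => convexOn_osc_add_smul _ _ hcv)
    hcont, fun e he => ?_, fun e he => ?_⟩
  · have hes : e ∈ Set.Ioo (-ε₀) ε₀ := ⟨by linarith [he.1], by linarith [he.2]⟩
    have hsl := hG.normalized.slice hes
    have hint : IntervalIntegrable (fun t => osc (G (t, e))) volume a b :=
      ContinuousOn.intervalIntegrable (by
        rw [Set.uIcc_of_le hab.le]
        exact hsl.continuousOn_osc hab.le)
    have hint' := (hcont e).intervalIntegrable (μ := volume) a b
    have hpt : ∀ t ∈ Set.Icc a b, ‖osc (G (t, e)) - osc ⇑(A t + e • B t)‖ ≤ 2 * (C * e ^ 2) := by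
      intro t ht
      have hcz : Continuous fun z : Z => G (t, e) z :=
        (family_contMDiff hG.normalized.smooth (p := (t, e)) ⟨ht, hes⟩).continuous.comp
          continuous_subtype_val
      have h1 : osc (G (t, e)) = osc (⟨_, hcz⟩ : C(Z, ℝ)) :=
        osc_eq_of_attained (exists_mem_insert_eq hp fun x hx y hy => by
          rw [hKG _ ⟨ht, hes⟩ x fun h => hx (Or.inl h), hKG _ ⟨ht, hes⟩ y fun h => hy (Or.inl h)])
      have h2 : ‖(⟨_, hcz⟩ : C(Z, ℝ)) - (A t + e • B t)‖ ≤ C * e ^ 2 := by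
        refine (ContinuousMap.norm_le _ (by positivity)).2 fun z => ?_
        have := htaylor t ht e (abs_le.2 ⟨he.1.le, he.2.le⟩) z
        rw [← hA t ht z, ← hB t ht z] at this
        exact this
      have h3 := osc_le_add (⟨_, hcz⟩ : C(Z, ℝ)) (A t + e • B t)
      have h4 := osc_le_add (A t + e • B t) (⟨_, hcz⟩ : C(Z, ℝ))
      rw [norm_sub_rev] at h4
      rw [h1, Real.norm_eq_abs, abs_le]
      constructor <;> linarith
    have h5 := intervalIntegral.norm_integral_le_of_norm_le_const (a := a) (b := b)
      fun t ht => hpt t (by rw [Set.uIoc_of_le hab.le] at ht; exact Set.Ioc_subset_Icc_self ht)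
    rw [intervalIntegral.integral_sub hint hint', Real.norm_eq_abs, abs_of_pos hba] at h5
    calc _ ≤ 2 * (C * e ^ 2) * (b - a) := h5
      _ ≤ (2 * C * (b - a) + 1) * e ^ 2 := by linarith [sq_nonneg e]
  · have hAi : ∀ z, IntervalIntegrable (fun t => A t z) volume a b := fun z =>
      ((continuous_eval_const z).comp hAc).intervalIntegrable _ _
    have hBi : ∀ z, IntervalIntegrable (fun t => B t z) volume a b := fun z =>
      ((continuous_eval_const z).comp hBc).intervalIntegrable _ _
    have hBz : ∀ z : Z, ∫ t in a..b, B t z = ∫ t in a..b, derivSnd G (t, 0) z := fun z =>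
      intervalIntegral.integral_congr fun t ht => hB t (by rwa [Set.uIcc_of_le hab.le] at ht) z
    have hzero : ∫ t in a..b, e * (B t zp - B t zm) = 0 := by
      rw [intervalIntegral.integral_const_mul, intervalIntegral.integral_sub (hBi _) (hBi _), hBz,
        hBz, hbal, sub_self, mul_zero]
    calc ∫ t in a..b, osc ⇑(A t + (0 : ℝ) • B t)
        ≤ ∫ t in a..b, (A t zp - A t zm) := by
          refine intervalIntegral.integral_mono_on hab.le ((hcont 0).intervalIntegrable _ _)
            ((hAi _).sub (hAi _)) fun t ht => ?_
          rw [zero_smul, add_zero]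
          refine osc_le fun z w => ?_
          rw [hA t ht, hA t ht, hA t ht, hA t ht]
          linarith [(hext0 t ht z).2, (hext0 t ht w).1]
      _ = ∫ t in a..b, (A t zp - A t zm + e * (B t zp - B t zm)) := by
          rw [intervalIntegral.integral_add ((hAi _).sub (hAi _))
            (((hBi _).sub (hBi _)).const_mul e), hzero, add_zero]
      _ ≤ ∫ t in a..b, osc ⇑(A t + e • B t) := by
          refine intervalIntegral.integral_mono_on hab.le
            (((hAi _).sub (hAi _)).add (((hBi _).sub (hBi _)).const_mul e))
            ((hcont e).intervalIntegrable _ _) fun t ht => ?_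
          have := sub_le_osc (A t + e • B t) zp zm
          simp only [ContinuousMap.add_apply, ContinuousMap.smul_apply, smul_eq_mul] at this
          linarith

end

end

end Hofer

theorem mainTheorem8 {n : ℕ} {M : Type*} [TopologicalSpace M] [T2Space M]
    [SecondCountableTopology M] [ConnectedSpace M] [ChartedSpace (Hofer.Model n) M]
    [IsManifold (𝓡 (2 * n)) ∞ M] [MeasurableSpace M] [BorelSpace M]
    (Ω : Hofer.SymplecticForm n M) {a b : ℝ} (hab : a < b)
    (f : ℝ → M ≃ₘ⟮𝓡 (2 * n), 𝓡 (2 * n)⟯ M) (hf : Hofer.IsHamiltonianPath Ω a b f)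
    (F : ℝ → M → ℝ) (hF : Hofer.IsHamiltonianOf Ω a b F f) :
    Hofer.IsGeodesic Ω a b f ↔ Hofer.HasFixedExtrema a b F :=
  ⟨fun h => Hofer.hasFixedExtrema_of_isGeodesic hab hf hF h,
    fun h => Hofer.isGeodesic_of_hasFixedExtrema hab hf hF h⟩
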